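/- Let $W\in C^2(\mathbb{R})$ be a double-well potential: $W(0)=W(1)=0$, $W>0$ on $\mathbb{R}\setminus\{0,1\}$, $W''(0)>0$, $W''(1)>0$, and $\int_0^1\sqrt{2W(z)}\,dz=1$. Put $\phi(v)=\int_0^v\sqrt{2W(z)}\,dz$. (1) There is exactly one $U\in C^2(\mathbb{R})$ with $U''=W'(U)$, $U(-\infty)=0$, $U(+\infty)=1$ and $U(0)=\tfrac12$. (2) Let $d\ge 1$, $\alpha\in(0,1)$, and let $\Omega_0\subset\mathbb{R}^d$ be a nonempty bounded open set whose boundary $\Sigma_0=\partial\Omega_0$ is a hypersurface of class $C^{3,\alpha}$ with $\Omega_0$ locally on one side. Let $\mathbf{s}(x)=\operatorname{dist}(x,\Omega_0)-\operatorname{dist}(x,\mathbb{R}^d\setminus\Omega_0)$. Then there are real numbers $(a_\varepsilon)_{\varepsilon>0}$ with $a_\varepsilon=O(\varepsilon)$ as $\varepsilon\downarrow0$ such that the functions $$u_\varepsilon(x)=U\Big(\frac{-\mathbf{s}(x)-a_\varepsilon}{\varepsilon}\Big),\qquad \psi_\varepsilon=\phi\circ u_\varepsilon ,$$ are well-prepared,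 that is: (i) for every $\varepsilon>0$, $\psi_\varepsilon$ is integrable and $\int_{\mathbb{R}^d}\psi_\varepsilon\,dx=|\Omega_0|$; (ii) for every $T\ge0$, every family $(\Omega(t))_{t\in[0,T]}$ with $\Omega(0)=\Omega_0$, and every gradient-flow calibration $(\xi,B,\vartheta,\lambda)$ (defined below) along it, the integrals $$\mathcal{E}_\varepsilon=\int_{\mathbb{R}^d}\Big(\frac{\varepsilon}{2}|\nabla u_\varepsilon|^2+\frac1\varepsilon W(u_\varepsilon)\Big)dx+\int_{\mathbb{R}^d}\xi(x,0)\cdot\nabla\psi_\varepsilon\,dx,\qquad \mathcal{F}_\varepsilon=\int_{\mathbb{R}^d}|\psi_\varepsilon-\chi_{\Omega_0}|\,|\vartheta(x,0)|\,dx$$ converge absolutely for every $\varepsilon>0$, and $\mathcal{E}_\varepsilon+\mathcal{F}_\varepsilon=O(\varepsilon^2)$ as $\varepsilon\downarrow0$. The numbers $a_\varepsilon$ do not depend on $T$, on the family or on the calibration. Here a gradient-flow calibration along nonempty bounded open sets $\Omega(t)$, $t\in[0,T]$, with $\Sigma(t)=\partial\Omega(t)$ of class $C^1$ and $\Omega(t)$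 locally on one side, consists of vector fields $\xi,B:\mathbb{R}^d\times[0,T]\to\mathbb{R}^d$ and functions $\vartheta:\mathbb{R}^d\times[0,T]\to\mathbb{R}$, $\lambda:[0,T]\to\mathbb{R}$ such that the following holds. All constants, including those in the $O$-terms, are uniform in $x$ and $t$, derivatives of Lipschitz functions are taken at almost every $x$, and $\delta=\operatorname{dist}(\cdot,\Sigma(t))$. - Regularity: $\xi$ and $\vartheta$ are Lipschitz on $\mathbb{R}^d\times[0,T]$, and $B(\cdot,t)$ is Lipschitz for each $t$. - Normal extension and shortness: $\xi(\cdot,t)$ is the exterior unit normal on $\Sigma(t)$, and $|\xi(\cdot,t)|\le(1-c\,\delta^2)_+$ for some $c>0$. - Divergence constraints: for every $t$, $\nabla\cdot B-c(t)=O(\delta)$ for some bounded function $c$ on $[0,T]$, and $\xi\otimes\xi:\nabla B=O(\delta)$. - Transport, for almost every $t$: $\partial_t\vartheta+(B\cdot\nabla)\vartheta=O(\delta)$, $\partial_t|\xi|^2+(B\cdot\nabla)|\xi|^2=O(\delta^2)$, and $\partial_t\xi+(B\cdot\nabla)\xi+(\nabla B)^{\mathsf T}\xi=O(\delta)$. (These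 are void when $T=0$.) - Evolution: for every $t$, $B\cdot\xi+\nabla\cdot\xi-\lambda(t)=O(\delta)$. - Weight: $\vartheta(\cdot,t)>0$ on $\mathbb{R}^d\setminus\overline{\Omega(t)}$, $\vartheta(\cdot,t)<0$ in $\Omega(t)$, $\vartheta$ is bounded, and $c'\delta\le|\vartheta(\cdot,t)|\le C'\delta$ on $\operatorname{supp}\xi(\cdot,t)$ for some $0<c'\le C'<\infty$. -/

import Mathlib

open Set Filter Topology MeasureTheory Asymptotics
open scoped NNReal

noncomputable section

/-- A double-well potential of class `C²` with exactly the two wells `0` and `1`, both of them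
nondegenerate, and with normalized surface tension `∫₀¹ √(2 W) = 1`. -/
structure IsDoubleWell (W : ℝ → ℝ) : Prop where
  contDiff : ContDiff ℝ 2 W
  zero : W 0 = 0
  one : W 1 = 0
  pos : ∀ z, z ≠ 0 → z ≠ 1 → 0 < W z
  nondegenerate_zero : 0 < deriv (deriv W) 0
  nondegenerate_one : 0 < deriv (deriv W) 1
  surfaceTension : ∫ z in (0 : ℝ)..1, √(2 * W z) = 1

/-- `φ(v) = ∫₀ᵛ √(2 W(z)) dz`. -/
def wellPrimitive (W : ℝ → ℝ) (v : ℝ) : ℝ := ∫ z in (0 : ℝ)..v, √(2 * W z)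

/-- `U'' = W'(U)`, `U(-∞) = 0`, `U(+∞) = 1`, `U(0) = 1/2`. -/
structure IsOptimalProfile (W U : ℝ → ℝ) : Prop where
  contDiff : ContDiff ℝ 2 U
  ode : ∀ z, deriv (deriv U) z = deriv W (U z)
  atBot : Tendsto U atBot (𝓝 0)
  atTop : Tendsto U atTop (𝓝 1)
  half : U 0 = 1 / 2

variable {d : ℕ}

/-- Signed distance to the boundary of `Ω`, negative inside `Ω`. -/
def signedDistBoundary (Ω : Set (EuclideanSpace ℝ (Fin d))) (x : EuclideanSpace ℝ (Fin d)) : ℝ :=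
  Metric.infDist x Ω - Metric.infDist x Ωᶜ

/-- Nonempty bounded open sets. -/
structure IsBoundedRegion (Ω : Set (EuclideanSpace ℝ (Fin d))) : Prop where
  isOpen : IsOpen Ω
  isBounded : Bornology.IsBounded Ω
  nonempty : Ω.Nonempty

/-- The boundary of `Ω` is a hypersurface of class `C^{3,α}` with `Ω` on one side: near each
boundary point, `Ω` is the sublevel set `{f < 0}` of a function `f` of class `C^{3,α}` without
critical points. (For open `Ω` the boundary is then locally `{f = 0}`.) -/
def HasC3HolderBoundary (α : ℝ≥0) (Ω : Set (EuclideanSpace ℝ (Fin d))) : Prop :=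
  ∀ p ∈ frontier Ω, ∃ (V : Set (EuclideanSpace ℝ (Fin d))) (f : EuclideanSpace ℝ (Fin d) → ℝ),
    IsOpen V ∧ p ∈ V ∧ ContDiffOn ℝ 3 f V ∧
    (∃ C : ℝ≥0, HolderOnWith C α (iteratedFDeriv ℝ 3 f) V) ∧
    (∀ x ∈ V, gradient f x ≠ 0) ∧ (∀ x ∈ V, x ∈ Ω ↔ f x < 0)

/-- `n` is the exterior unit normal of `Ω` at the boundary point `p`: near `p`, `Ω` is the sublevel
set `{f < 0}` of a `C¹` function whose gradient at `p` is a positive multiple of the unit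
vector `n`. -/
def IsExteriorNormal (Ω : Set (EuclideanSpace ℝ (Fin d))) (p n : EuclideanSpace ℝ (Fin d)) : Prop :=
  ‖n‖ = 1 ∧
  ∃ (V : Set (EuclideanSpace ℝ (Fin d))) (f : EuclideanSpace ℝ (Fin d) → ℝ) (r : ℝ),
    IsOpen V ∧ p ∈ V ∧ ContDiffOn ℝ 1 f V ∧ (∀ x ∈ V, x ∈ Ω ↔ f x < 0) ∧
    0 < r ∧ gradient f p = r • n

/-- The divergence of a vector field. -/
def divergence (X : EuclideanSpace ℝ (Fin d) → EuclideanSpace ℝ (Fin d))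
    (x : EuclideanSpace ℝ (Fin d)) : ℝ :=
  ∑ i, (fderiv ℝ X x (EuclideanSpace.single i 1)) i

/-- `(ξ, B, ϑ, lam)` is a gradient-flow calibration for volume-preserving mean curvature flow along
the family of closed hypersurfaces `∂Ω(t)`, `t ∈ [0,T]`. Identities that involve derivatives of
Lipschitz functions are required almost everywhere. The degenerate case `T = 0` is allowed: then
the transport equations are void and the remaining conditions concern the single time `0`. -/
structure IsGradientFlowCalibration (T : ℝ) (Ω : ℝ → Set (EuclideanSpace ℝ (Fin d)))
    (ξ B : ℝ → EuclideanSpace ℝ (Fin d) → EuclideanSpace ℝ (Fin d))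
    (ϑ : ℝ → EuclideanSpace ℝ (Fin d) → ℝ) (lam : ℝ → ℝ) : Prop where
  region : ∀ t ∈ Icc 0 T, IsBoundedRegion (Ω t)
  -- regularity
  lipschitz_xi : ∃ K : ℝ≥0, LipschitzOnWith K
    (fun p : ℝ × EuclideanSpace ℝ (Fin d) => ξ p.1 p.2) (Icc 0 T ×ˢ univ)
  lipschitz_weight : ∃ K : ℝ≥0, LipschitzOnWith K
    (fun p : ℝ × EuclideanSpace ℝ (Fin d) => ϑ p.1 p.2) (Icc 0 T ×ˢ univ)
  lipschitz_B : ∀ t ∈ Icc 0 T, ∃ K : ℝ≥0, LipschitzWith K (B t)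
  -- normal extension and shortness
  normal : ∀ t ∈ Icc 0 T, ∀ p ∈ frontier (Ω t), IsExteriorNormal (Ω t) p (ξ t p)
  short : ∃ c : ℝ, 0 < c ∧ ∀ t ∈ Icc 0 T, ∀ x,
    ‖ξ t x‖ ≤ max (1 - c * Metric.infDist x (frontier (Ω t)) ^ 2) 0
  -- divergence constraints
  div_B : ∃ (c : ℝ → ℝ) (M C : ℝ), ∀ t ∈ Icc 0 T, |c t| ≤ M ∧
    ∀ᵐ x, |divergence (B t) x - c t| ≤ C * Metric.infDist x (frontier (Ω t))
  normal_B : ∃ C : ℝ, ∀ t ∈ Icc 0 T, ∀ᵐ x,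
    |inner ℝ (ξ t x) (fderiv ℝ (B t) x (ξ t x))| ≤ C * Metric.infDist x (frontier (Ω t))
  -- approximate transport equations
  transport_weight : ∃ C : ℝ, ∀ᵐ t ∂(volume.restrict (Icc 0 T)), ∀ᵐ x,
    |deriv (fun τ => ϑ τ x) t + fderiv ℝ (ϑ t) x (B t x)|
      ≤ C * Metric.infDist x (frontier (Ω t))
  transport_length : ∃ C : ℝ, ∀ᵐ t ∂(volume.restrict (Icc 0 T)), ∀ᵐ x,
    |deriv (fun τ => ‖ξ τ x‖ ^ 2) t + fderiv ℝ (fun y => ‖ξ t y‖ ^ 2) x (B t x)|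
      ≤ C * Metric.infDist x (frontier (Ω t)) ^ 2
  transport_xi : ∃ C : ℝ, ∀ᵐ t ∂(volume.restrict (Icc 0 T)), ∀ᵐ x,
    ‖deriv (fun τ => ξ τ x) t + fderiv ℝ (ξ t) x (B t x)
        + ContinuousLinearMap.adjoint (fderiv ℝ (B t) x) (ξ t x)‖
      ≤ C * Metric.infDist x (frontier (Ω t))
  -- geometric evolution equation
  evolution : ∃ C : ℝ, ∀ t ∈ Icc 0 T, ∀ᵐ x,
    |inner ℝ (B t x) (ξ t x) + divergence (ξ t) x - lam t|
      ≤ C * Metric.infDist x (frontier (Ω t))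
  -- sign and coercivity of the weight
  weight_pos : ∀ t ∈ Icc 0 T, ∀ x ∉ closure (Ω t), 0 < ϑ t x
  weight_neg : ∀ t ∈ Icc 0 T, ∀ x ∈ Ω t, ϑ t x < 0
  weight_bounded : ∃ M : ℝ, ∀ t ∈ Icc 0 T, ∀ x, |ϑ t x| ≤ M
  weight_coercive : ∃ c C : ℝ, 0 < c ∧ ∀ t ∈ Icc 0 T, ∀ x ∈ tsupport (ξ t),
    c * Metric.infDist x (frontier (Ω t)) ≤ |ϑ t x| ∧
      |ϑ t x| ≤ C * Metric.infDist x (frontier (Ω t))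

/-- The Cahn--Hilliard energy density `ε/2 |∇u|² + W(u)/ε`. -/
def energyDensity (W : ℝ → ℝ) (ε : ℝ) (u : EuclideanSpace ℝ (Fin d) → ℝ)
    (x : EuclideanSpace ℝ (Fin d)) : ℝ :=
  ε / 2 * ‖gradient u x‖ ^ 2 + 1 / ε * W (u x)

/-- The integrand `ξ · ∇ψ` with `ψ = φ ∘ u`. -/
def tiltDensity (W : ℝ → ℝ) (ξ : EuclideanSpace ℝ (Fin d) → EuclideanSpace ℝ (Fin d))
    (u : EuclideanSpace ℝ (Fin d) → ℝ) (x : EuclideanSpace ℝ (Fin d)) : ℝ :=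
  inner ℝ (ξ x) (gradient (fun y => wellPrimitive W (u y)) x)

/-- The integrand `|ψ - χ_Ω| |ϑ|` with `ψ = φ ∘ u`. -/
def volumeErrorDensity (W : ℝ → ℝ) (Ω : Set (EuclideanSpace ℝ (Fin d)))
    (ϑ : EuclideanSpace ℝ (Fin d) → ℝ) (u : EuclideanSpace ℝ (Fin d) → ℝ)
    (x : EuclideanSpace ℝ (Fin d)) : ℝ :=
  |wellPrimitive W (u x) - Ω.indicator (fun _ => (1 : ℝ)) x| * |ϑ x|

/-- The relative energy `𝓔_ε = E_ε[u] + ∫ ξ · ∇ψ`. -/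
def relativeEnergy (W : ℝ → ℝ) (ε : ℝ) (ξ : EuclideanSpace ℝ (Fin d) → EuclideanSpace ℝ (Fin d))
    (u : EuclideanSpace ℝ (Fin d) → ℝ) : ℝ :=
  (∫ x, energyDensity W ε u x) + ∫ x, tiltDensity W ξ u x

/-- The volume error `𝓕_ε = ∫ |ψ - χ_Ω| |ϑ|`. -/
def volumeError (W : ℝ → ℝ) (Ω : Set (EuclideanSpace ℝ (Fin d)))
    (ϑ : EuclideanSpace ℝ (Fin d) → ℝ) (u : EuclideanSpace ℝ (Fin d) → ℝ) : ℝ :=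
  ∫ x, volumeErrorDensity W Ω ϑ u x

/-- The exact mass constraint `∫ φ ∘ u = |Ω|`. -/
def HasExactMass (W : ℝ → ℝ) (Ω : Set (EuclideanSpace ℝ (Fin d)))
    (u : EuclideanSpace ℝ (Fin d) → ℝ) : Prop :=
  Integrable (fun x => wellPrimitive W (u x)) ∧
    ∫ x, wellPrimitive W (u x) = (volume Ω).toReal

/-- Well-prepared initial data `(u_ε)_{ε>0}` relative to the initial region `Ω` and the initial
values `ξ`, `ϑ` of a calibration: exact mass, and `𝓔_ε + 𝓕_ε = O(ε²)` as `ε ↓ 0` (with all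
the integrals finite). -/
structure IsWellPrepared (W : ℝ → ℝ) (Ω : Set (EuclideanSpace ℝ (Fin d)))
    (ξ : EuclideanSpace ℝ (Fin d) → EuclideanSpace ℝ (Fin d))
    (ϑ : EuclideanSpace ℝ (Fin d) → ℝ) (u : ℝ → EuclideanSpace ℝ (Fin d) → ℝ) : Prop where
  mass : ∀ ε : ℝ, 0 < ε → HasExactMass W Ω (u ε)
  integrable_energy : ∀ ε : ℝ, 0 < ε → Integrable (energyDensity W ε (u ε))
  integrable_tilt : ∀ ε : ℝ, 0 < ε → Integrable (tiltDensity W ξ (u ε))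
  integrable_volumeError : ∀ ε : ℝ, 0 < ε → Integrable (volumeErrorDensity W Ω ϑ (u ε))
  rate : (fun ε : ℝ => relativeEnergy W ε ξ (u ε) + volumeError W Ω ϑ (u ε))
    =O[𝓝[>] 0] fun ε : ℝ => ε ^ 2

/-- The optimal profile glued around `∂Ω` with shift `a`:
`u_ε(x) = U((-s(x) - a)/ε)`. -/
def gluedProfile (U : ℝ → ℝ) (Ω : Set (EuclideanSpace ℝ (Fin d))) (a ε : ℝ)
    (x : EuclideanSpace ℝ (Fin d)) : ℝ :=
  U ((-signedDistBoundary Ω x - a) / ε)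

end

/-! The profile. Multiplying the equation by `U'` shows that `U'² - 2 W(U)` is constant, and the
limit at `+∞` forces the constant to be zero. Since `√(2W)` is at most linear at the wells, a
solution of `|U'| = √(2 W(U))` through `1/2` never reaches them, so it stays in `(0,1)`, its
derivative has one sign, and `U' = √(2 W(U))`. Thus `U` is the inverse of the time map
`profileTime`, which gives uniqueness. For existence one inverts this map, which is onto because its
integrand has a nonintegrable singularity of order `1/distance` at each well. Nondegeneracy of the
wells makes the convergence of `U` exponential.

The scaling. Translation arguments bound the volume of a tube of width `r` around the boundary by a
multiple of `r` (for small `r`), and bound the collars on either side from below by a multiple of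
`r`. The upper bound turns exponential decay in `|s|/ε` into moments: `∫ exp(-κ|s|/ε) |s|^k =
O(ε^(k+1))`. The lower bound yields the shift: moving the profile by `±Kε` gains mass of order `ε`
in one collar and loses only `exp(-κK)` times order `ε` elsewhere, so the intermediate value theorem
gives exact mass with `a_ε = O(ε)` (`exists_shifts`).

The energy. Almost everywhere `|∇s| = 1`, so the energy density is `2W(u)/ε` and `∇ψ =
-(2W(u)/ε)∇s`. The relative energy is therefore the integral of `(2W(u)/ε)(1 - ξ·∇s)`. A field that
is merely Lipschitz makes the last factor `O(|s|)`, which gives only `O(ε)`. The remedy is to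
compare `ξ` with a `C²` field `Y` that extends the normal and has unit length near the boundary. For
it `1 - Y·∇s = |Y - n|²/2 = O(s²)`, with `n` the normal at a nearest point, and this contributes
`O(ε²)`.

The remaining field `η = ξ - Y` vanishes on the boundary. Integration by parts turns its
contribution into `-∫ (ψ - χ) div η`, where `χ` may be subtracted because `div η` has zero integral
over the region. This is `O(ε²)` once `div η = O(|s|)`. The evolution equation writes `div η` as a
Lipschitz function `k` plus `O(|s|)`, and it remains to see that `k` vanishes on the boundary.
Formally `k` is there the normal derivative of `η·∇s`. Shortness of `ξ` gives `η·∇s ≤ O(s²)`, hence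
`k ≤ 0` seen from outside and `k ≥ 0` seen from inside. The lemmas `mul_nonpos_of_divergence` and
`exists_divergence_le` make this rigorous with test functions on thin collars, without surface
integrals. Finally, the weight vanishes on the boundary, so the volume error is controlled by the
first moment. -/

/-! ### The double well and the optimal profile -/

namespace IsDoubleWell

variable {W : ℝ → ℝ}

lemma nonneg (hW : IsDoubleWell W) (z : ℝ) : 0 ≤ W z := by
  by_cases h0 : z = 0
  · rw [h0, hW.zero]
  by_cases h1 : z = 1
  · rw [h1, hW.one]
  exact (hW.pos z h0 h1).le

lemma differentiable (hW : IsDoubleWell W) : Differentiable ℝ W :=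
  hW.contDiff.differentiable (by norm_num)

lemma contDiff_deriv (hW : IsDoubleWell W) : ContDiff ℝ 1 (deriv W) := by
  have := hW.contDiff
  rw [show (2 : WithTop ℕ∞) = 1 + 1 from by norm_num, contDiff_succ_iff_deriv] at this
  exact this.2.2

lemma differentiable_deriv (hW : IsDoubleWell W) : Differentiable ℝ (deriv W) :=
  hW.contDiff_deriv.differentiable (by norm_num)

lemma continuous_deriv_deriv (hW : IsDoubleWell W) : Continuous (deriv (deriv W)) :=
  (contDiff_one_iff_deriv.1 hW.contDiff_deriv).2

lemma continuous_sqrt (hW : IsDoubleWell W) : Continuous fun z => √(2 * W z) :=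
  (continuous_const.mul hW.contDiff.continuous).sqrt

lemma sqrt_pos (hW : IsDoubleWell W) {z : ℝ} (hz : z ∈ Ioo (0 : ℝ) 1) : 0 < √(2 * W z) :=
  Real.sqrt_pos.2 (mul_pos two_pos (hW.pos z hz.1.ne' hz.2.ne))

lemma deriv_eq_zero (hW : IsDoubleWell W) {w : ℝ} (hw : W w = 0) : deriv W w = 0 :=
  IsLocalMin.deriv_eq_zero (Eventually.of_forall fun z => hw ▸ hW.nonneg z)

/-- The square root of the potential is at most linear at a well. -/
lemma sqrt_le (hW : IsDoubleWell W) {w : ℝ} (hw : W w = 0) (R : ℝ) :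
    ∃ L : ℝ, 0 < L ∧ ∀ z, |z| ≤ R → √(2 * W z) ≤ L * |z - w| := by
  set S := Icc (-(max R |w|)) (max R |w|) with hS
  have hSc : Convex ℝ S := convex_Icc _ _
  obtain ⟨M, hM⟩ := (isCompact_Icc (a := -(max R |w|)) (b := max R |w|)).exists_bound_of_continuousOn
    hW.continuous_deriv_deriv.continuousOn
  have hwS : w ∈ S := abs_le.1 (le_max_right _ _)
  have hM0 : 0 ≤ M := (norm_nonneg _).trans (hM w hwS)
  have h1 : ∀ z ∈ S, ‖deriv W z‖ ≤ M * |z - w| := fun z hz => by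
    have := hSc.norm_image_sub_le_of_norm_deriv_le
      (fun x _ => hW.differentiable_deriv x) hM hwS hz
    simpa [hW.deriv_eq_zero hw] using this
  -- The summand 1 keeps the constant positive even if `M = 0`.
  refine ⟨√(2 * M) + 1, by positivity, fun z hz => ?_⟩
  have hzS : z ∈ S := abs_le.1 (hz.trans (le_max_left _ _))
  -- A second use of the mean value inequality, on the segment between `w` and `z`, where `h1`
  -- bounds the slope by `M * |z - w|`.
  have h2 : W z ≤ M * |z - w| * |z - w| := by
    have hseg : segment ℝ w z ⊆ S := hSc.segment_subset hwS hzS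
    have := (convex_segment w z).norm_image_sub_le_of_norm_deriv_le (f := W)
      (C := M * |z - w|) (fun x _ => hW.differentiable x) (fun x hx => (h1 x (hseg hx)).trans ?_)
      (left_mem_segment ℝ w z) (right_mem_segment ℝ w z)
    · rw [hw, sub_zero] at this
      exact (le_abs_self _).trans this
    · rw [segment_eq_uIcc] at hx
      exact mul_le_mul_of_nonneg_left (abs_sub_left_of_mem_uIcc hx) hM0
  calc √(2 * W z) ≤ √(2 * M * |z - w| ^ 2) := Real.sqrt_le_sqrt (by nlinarith)
    _ = √(2 * M) * |z - w| := by
      rw [Real.sqrt_mul (by positivity), Real.sqrt_sq (abs_nonneg _)]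
    _ ≤ _ := by gcongr; linarith

/-- A nondegenerate well is at least quadratic. -/
lemma eventually_sq_le (hW : IsDoubleWell W) {w : ℝ} (hw : W w = 0) (hw2 : 0 < deriv (deriv W) w) :
    ∃ c : ℝ, 0 < c ∧ ∀ᶠ z in 𝓝 w, c * |z - w| ≤ √(2 * W z) := by
  set m := deriv (deriv W) w with hm
  have hd : HasDerivAt (deriv W) m w := (hW.differentiable_deriv w).hasDerivAt
  have h1 : ∀ᶠ z in 𝓝 w, m / 2 * (z - w) ^ 2 ≤ deriv W z * (z - w) := by
    have := hd.isLittleO.def (half_pos hw2)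
    filter_upwards [this] with z hz
    rw [hW.deriv_eq_zero hw, sub_zero, smul_eq_mul, Real.norm_eq_abs, Real.norm_eq_abs] at hz
    have h3 : -(m / 2 * |z - w| ^ 2) ≤ (deriv W z - (z - w) * m) * (z - w) := by
      have := neg_abs_le ((deriv W z - (z - w) * m) * (z - w))
      rw [abs_mul] at this
      nlinarith [abs_nonneg (z - w)]
    rw [sq_abs] at h3
    nlinarith
  obtain ⟨ρ, hρ, hb⟩ := Metric.eventually_nhds_iff_ball.1 h1
  refine ⟨√(m / 2), Real.sqrt_pos.2 (by positivity),
    Metric.eventually_nhds_iff_ball.2 ⟨ρ, hρ, fun z hz => ?_⟩⟩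
  have key : m / 4 * (z - w) ^ 2 ≤ W z := by
    -- Integration of `h1` along the segment, phrased as monotonicity; the slope `m / 2` integrates
    -- to `m / 4`.
    let h : ℝ → ℝ := fun t => W (w + t * (z - w)) - m / 4 * (t * (z - w)) ^ 2
    have hh : ∀ t, HasDerivAt h
        (deriv W (w + t * (z - w)) * (z - w) - m / 4 * (2 * (t * (z - w)) * (z - w))) t := by
      intro t
      have hl : HasDerivAt (fun t : ℝ => t * (z - w)) (z - w) t := by
        simpa using (hasDerivAt_id t).mul_const (z - w)
      have a1 : HasDerivAt (fun t => W (w + t * (z - w)))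
          (deriv W (w + t * (z - w)) * (z - w)) t :=
        (hW.differentiable (w + t * (z - w))).hasDerivAt.comp t (hl.const_add w)
      have a2 := (hl.pow 2).const_mul (m / 4)
      exact (a1.sub a2).congr_deriv (by norm_num)
    have hmono : MonotoneOn h (Icc 0 1) := by
      apply monotoneOn_of_deriv_nonneg (convex_Icc 0 1)
        (fun t _ => (hh t).continuousAt.continuousWithinAt)
        (fun t _ => (hh t).differentiableAt.differentiableWithinAt)
      intro t ht
      rw [interior_Icc] at ht
      rw [(hh t).deriv]
      have hmem : w + t * (z - w) ∈ Metric.ball w ρ := by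
        rw [Metric.mem_ball, Real.dist_eq] at hz ⊢
        rw [add_sub_cancel_left, abs_mul, abs_of_pos ht.1]
        nlinarith [abs_nonneg (z - w), ht.2]
      have := hb _ hmem
      rw [add_sub_cancel_left] at this
      have h5 : 0 ≤ t * (deriv W (w + t * (z - w)) * (z - w) - m / 2 * (t * (z - w) ^ 2)) := by
        nlinarith
      have := nonneg_of_mul_nonneg_right h5 ht.1
      nlinarith
    have := hmono (left_mem_Icc.2 zero_le_one) (right_mem_Icc.2 zero_le_one) zero_le_one
    simp only [h, zero_mul, add_zero, hw, one_mul, add_sub_cancel] at this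
    linarith
  calc √(m / 2) * |z - w| = √(m / 2 * |z - w| ^ 2) := by
        rw [Real.sqrt_mul (by positivity), Real.sqrt_sq (abs_nonneg _)]
    _ ≤ _ := Real.sqrt_le_sqrt (by rw [sq_abs]; linarith)

/-- Compactness of `[0,1]`: near each well nondegeneracy gives a linear lower bound, elsewhere the
root is positive. The form `z * (1 - z)` makes the profile a supersolution of the logistic equation,
which is what yields exponential decay. -/
lemma le_sqrt (hW : IsDoubleWell W) :
    ∃ κ : ℝ, 0 < κ ∧ ∀ z ∈ Icc (0 : ℝ) 1, κ * (z * (1 - z)) ≤ √(2 * W z) := by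
  suffices h : ∃ κ : ℝ, 0 < κ ∧ ∀ z ∈ Icc (0 : ℝ) 1, z ∈ Icc (0 : ℝ) 1 →
      κ * (z * (1 - z)) ≤ √(2 * W z) by
    obtain ⟨κ, h1, h2⟩ := h
    exact ⟨κ, h1, fun z hz => h2 z hz hz⟩
  refine isCompact_Icc.induction_on
    (p := fun S => ∃ κ : ℝ, 0 < κ ∧ ∀ z ∈ S, z ∈ Icc (0 : ℝ) 1 → κ * (z * (1 - z)) ≤ √(2 * W z))
    ⟨1, one_pos, by simp⟩ (fun S T hST ⟨κ, h1, h2⟩ => ⟨κ, h1, fun z hz => h2 z (hST hz)⟩) ?_ ?_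
  · rintro S T ⟨κ, h1, h2⟩ ⟨κ', h1', h2'⟩
    refine ⟨min κ κ', lt_min h1 h1', fun z hz hz1 => ?_⟩
    have h0 : 0 ≤ z * (1 - z) := mul_nonneg hz1.1 (by linarith [hz1.2])
    rcases hz with hz | hz
    · exact (mul_le_mul_of_nonneg_right (min_le_left _ _) h0).trans (h2 z hz hz1)
    · exact (mul_le_mul_of_nonneg_right (min_le_right _ _) h0).trans (h2' z hz hz1)
  · intro p hp
    suffices h : ∃ κ : ℝ, 0 < κ ∧ ∀ᶠ z in 𝓝 p, z ∈ Icc (0 : ℝ) 1 →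
        κ * (z * (1 - z)) ≤ √(2 * W z) by
      obtain ⟨κ, h1, h2⟩ := h
      exact ⟨_, mem_nhdsWithin_of_mem_nhds h2, κ, h1, fun z hz => hz⟩
    by_cases hp0 : p = 0
    · obtain ⟨c, hc, h⟩ := hW.eventually_sq_le hW.zero hW.nondegenerate_zero
      subst hp0
      refine ⟨c, hc, h.mono fun z hz hz1 => le_trans ?_ hz⟩
      rw [sub_zero, abs_of_nonneg hz1.1]
      have := mul_nonneg hc.le (mul_nonneg hz1.1 hz1.1)
      nlinarith
    by_cases hp1 : p = 1
    · obtain ⟨c, hc, h⟩ := hW.eventually_sq_le hW.one hW.nondegenerate_one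
      subst hp1
      refine ⟨c, hc, h.mono fun z hz hz1 => le_trans ?_ hz⟩
      rw [abs_sub_comm, abs_of_nonneg (by linarith [hz1.2])]
      have := mul_nonneg hc.le (mul_nonneg (sub_nonneg.2 hz1.2) (sub_nonneg.2 hz1.2))
      nlinarith
    have hpI : p ∈ Ioo (0 : ℝ) 1 :=
      ⟨lt_of_le_of_ne hp.1 (Ne.symm hp0), lt_of_le_of_ne hp.2 hp1⟩
    have hpos := hW.sqrt_pos hpI
    refine ⟨√(2 * W p) / 2, half_pos hpos, ?_⟩
    filter_upwards [hW.continuous_sqrt.continuousAt.eventually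
      (lt_mem_nhds (half_lt_self hpos))] with z hz hz1
    refine le_trans ?_ (le_of_lt hz)
    have : z * (1 - z) ≤ 1 := by nlinarith [hz1.1, hz1.2]
    nlinarith

lemma hasDerivAt_wellPrimitive (hW : IsDoubleWell W) (v : ℝ) :
    HasDerivAt (wellPrimitive W) (√(2 * W v)) v :=
  intervalIntegral.integral_hasDerivAt_right (hW.continuous_sqrt.intervalIntegrable _ _)
    hW.continuous_sqrt.stronglyMeasurable.stronglyMeasurableAtFilter hW.continuous_sqrt.continuousAt

/-- The primitive is Lipschitz on `[0,1]` and takes the values 0 and 1 at the wells, the latter by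
the normalization of the surface tension. -/
lemma wellPrimitive_bounds (hW : IsDoubleWell W) :
    ∃ L : ℝ, 0 < L ∧ ∀ v ∈ Icc (0 : ℝ) 1,
      wellPrimitive W v ≤ L * v ∧ 1 - wellPrimitive W v ≤ L * (1 - v) := by
  obtain ⟨L, hL, h⟩ := hW.sqrt_le hW.zero 1
  have hb : ∀ z ∈ Icc (0 : ℝ) 1, √(2 * W z) ≤ L := fun z hz => by
    refine (h z (by rw [abs_of_nonneg hz.1]; exact hz.2)).trans ?_
    rw [sub_zero, abs_of_nonneg hz.1]
    nlinarith [hz.2]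
  have hsub : ∀ a b, a ∈ Icc (0 : ℝ) 1 → b ∈ Icc (0 : ℝ) 1 →
      |wellPrimitive W b - wellPrimitive W a| ≤ L * |b - a| := fun a b ha hb' =>
    (convex_Icc (0 : ℝ) 1).norm_image_sub_le_of_norm_hasDerivWithin_le
      (fun x _ => (hW.hasDerivAt_wellPrimitive x).hasDerivWithinAt)
      (fun x hx => by rw [Real.norm_of_nonneg (Real.sqrt_nonneg _)]; exact hb x hx) ha hb'
  have e0 : wellPrimitive W 0 = 0 := by simp [wellPrimitive]
  have e1 : wellPrimitive W 1 = 1 := hW.surfaceTension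
  refine ⟨L, hL, fun v hv => ⟨?_, ?_⟩⟩
  · have := hsub 0 v (by simp) hv
    rw [e0, sub_zero, sub_zero, abs_of_nonneg hv.1] at this
    exact (le_abs_self _).trans this
  · have := hsub v 1 hv (by simp)
    rw [e1, abs_of_nonneg (sub_nonneg.2 hv.2)] at this
    exact (le_abs_self _).trans this

lemma wellPrimitive_mem_Ioo (hW : IsDoubleWell W) {v : ℝ} (hv : v ∈ Ioo (0 : ℝ) 1) :
    wellPrimitive W v ∈ Ioo (0 : ℝ) 1 := by
  have hmono : StrictMonoOn (wellPrimitive W) (Icc 0 1) := by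
    apply strictMonoOn_of_deriv_pos (convex_Icc 0 1)
      (fun t _ => (hW.hasDerivAt_wellPrimitive t).continuousAt.continuousWithinAt)
    intro t ht
    rw [interior_Icc] at ht
    rw [(hW.hasDerivAt_wellPrimitive t).deriv]
    exact hW.sqrt_pos ht
  have e0 : wellPrimitive W 0 = 0 := by simp [wellPrimitive]
  have e1 : wellPrimitive W 1 = 1 := hW.surfaceTension
  refine ⟨?_, ?_⟩
  · rw [← e0]; exact hmono (by simp) ⟨hv.1.le, hv.2.le⟩ hv.1
  · rw [← e1]; exact hmono ⟨hv.1.le, hv.2.le⟩ (by simp) hv.2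

end IsDoubleWell

/-- The inverse of the optimal profile. -/
noncomputable def profileTime (W : ℝ → ℝ) (v : ℝ) : ℝ := ∫ z in (1 / 2 : ℝ)..v, (√(2 * W z))⁻¹

lemma IsDoubleWell.hasDerivAt_profileTime {W : ℝ → ℝ} (hW : IsDoubleWell W) {v : ℝ}
    (hv : v ∈ Ioo (0 : ℝ) 1) : HasDerivAt (profileTime W) (√(2 * W v))⁻¹ v := by
  have hc : ContinuousOn (fun z => (√(2 * W z))⁻¹) (Ioo 0 1) :=
    hW.continuous_sqrt.continuousOn.inv₀ fun z hz => (hW.sqrt_pos hz).ne'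
  have hI : uIcc (1 / 2 : ℝ) v ⊆ Ioo 0 1 :=
    (ordConnected_Ioo).uIcc_subset (by norm_num) hv
  exact intervalIntegral.integral_hasDerivAt_right ((hc.mono hI).intervalIntegrable)
    (hc.stronglyMeasurableAtFilter isOpen_Ioo v hv) (hc.continuousAt (isOpen_Ioo.mem_nhds hv))

lemma IsDoubleWell.strictMonoOn_profileTime {W : ℝ → ℝ} (hW : IsDoubleWell W) :
    StrictMonoOn (profileTime W) (Ioo 0 1) := by
  apply strictMonoOn_of_deriv_pos (convex_Ioo 0 1)
    (fun t ht => (hW.hasDerivAt_profileTime ht).continuousAt.continuousWithinAt)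
  intro t ht
  rw [interior_Ioo] at ht
  rw [(hW.hasDerivAt_profileTime ht).deriv]
  exact inv_pos.2 (hW.sqrt_pos ht)

lemma profileTime_half (W : ℝ → ℝ) : profileTime W (1 / 2) = 0 := by simp [profileTime]

/-- An orbit needs infinite time to reach a well: the integrand is at least `1 / (L * distance)`
there, so the time map is compared with a logarithm and is unbounded in both directions. The
intermediate value theorem does the rest. -/
lemma IsDoubleWell.surjOn_profileTime {W : ℝ → ℝ} (hW : IsDoubleWell W) :
    SurjOn (profileTime W) (Ioo 0 1) univ := by
  have hc : ContinuousOn (profileTime W) (Ioo 0 1) := fun t ht =>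
    (hW.hasDerivAt_profileTime ht).continuousAt.continuousWithinAt
  have hhalf : (1 / 2 : ℝ) ∈ Ioo (0 : ℝ) 1 := by norm_num
  have hlow : ∀ y : ℝ, ∃ v ∈ Ioo (0 : ℝ) 1, profileTime W v ≤ y := by
    intro y
    obtain ⟨L, hL, h⟩ := hW.sqrt_le hW.zero 1
    have hmono : AntitoneOn (fun v => L⁻¹ * Real.log v - profileTime W v) (Ioo 0 1) := by
      have hd : ∀ v ∈ Ioo (0 : ℝ) 1, HasDerivAt (fun v => L⁻¹ * Real.log v - profileTime W v)
          (L⁻¹ * v⁻¹ - (√(2 * W v))⁻¹) v := fun v hv =>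
        ((Real.hasDerivAt_log hv.1.ne').const_mul _).sub (hW.hasDerivAt_profileTime hv)
      apply antitoneOn_of_deriv_nonpos (convex_Ioo 0 1)
        (fun t ht => (hd t ht).continuousAt.continuousWithinAt)
        (fun t ht => (hd t (interior_subset ht)).differentiableAt.differentiableWithinAt)
      intro v hv
      rw [interior_Ioo] at hv
      rw [(hd v hv).deriv, sub_nonpos, ← mul_inv]
      have := h v (by rw [abs_of_pos hv.1]; exact hv.2.le)
      rw [sub_zero, abs_of_pos hv.1] at this
      exact inv_anti₀ (hW.sqrt_pos hv) this
    have hlim : Tendsto (fun v => L⁻¹ * Real.log v) (𝓝[>] 0) atBot :=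
      Real.tendsto_log_nhdsGT_zero.const_mul_atBot (inv_pos.2 hL)
    have h1 := hlim.eventually (eventually_le_atBot (y + L⁻¹ * Real.log (1 / 2)))
    have h2 : ∀ᶠ v in 𝓝[>] (0 : ℝ), v ∈ Ioo (0 : ℝ) (1 / 2) := Ioo_mem_nhdsGT (by norm_num)
    obtain ⟨v, h1, h2⟩ := (h1.and h2).exists
    have hv : v ∈ Ioo (0 : ℝ) 1 := ⟨h2.1, h2.2.trans (by norm_num)⟩
    refine ⟨v, hv, ?_⟩
    have := hmono hv hhalf h2.2.le
    simp only [profileTime_half] at this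
    linarith
  have hhigh : ∀ y : ℝ, ∃ v ∈ Ioo (0 : ℝ) 1, y ≤ profileTime W v := by
    intro y
    obtain ⟨L, hL, h⟩ := hW.sqrt_le hW.one 1
    have hmono : MonotoneOn (fun v => L⁻¹ * Real.log (1 - v) + profileTime W v) (Ioo 0 1) := by
      have hd : ∀ v ∈ Ioo (0 : ℝ) 1,
          HasDerivAt (fun v => L⁻¹ * Real.log (1 - v) + profileTime W v)
          (L⁻¹ * (-1 / (1 - v)) + (√(2 * W v))⁻¹) v := fun v hv =>
        ((((hasDerivAt_id v).const_sub 1).log (by simpa using (sub_pos.2 hv.2).ne')).const_mul _).add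
          (hW.hasDerivAt_profileTime hv)
      apply monotoneOn_of_deriv_nonneg (convex_Ioo 0 1)
        (fun t ht => (hd t ht).continuousAt.continuousWithinAt)
        (fun t ht => (hd t (interior_subset ht)).differentiableAt.differentiableWithinAt)
      intro v hv
      rw [interior_Ioo] at hv
      rw [(hd v hv).deriv]
      have := h v (by rw [abs_of_pos hv.1]; exact hv.2.le)
      rw [abs_sub_comm, abs_of_pos (sub_pos.2 hv.2)] at this
      have := inv_anti₀ (hW.sqrt_pos hv) this
      rw [mul_inv] at this
      have e : L⁻¹ * (-1 / (1 - v)) = - (L⁻¹ * (1 - v)⁻¹) := by ring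
      rw [e]; linarith
    have hlim : Tendsto (fun v => L⁻¹ * Real.log v) (𝓝[>] 0) atBot :=
      Real.tendsto_log_nhdsGT_zero.const_mul_atBot (inv_pos.2 hL)
    have h1 := hlim.eventually (eventually_le_atBot (-y + L⁻¹ * Real.log (1 / 2)))
    have h2 : ∀ᶠ v in 𝓝[>] (0 : ℝ), v ∈ Ioo (0 : ℝ) (1 / 2) := Ioo_mem_nhdsGT (by norm_num)
    obtain ⟨v, h1, h2⟩ := (h1.and h2).exists
    have hv : 1 - v ∈ Ioo (0 : ℝ) 1 := ⟨by linarith [h2.2], by linarith [h2.1]⟩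
    refine ⟨1 - v, hv, ?_⟩
    have := hmono hhalf hv (by linarith [h2.2])
    simp only [profileTime_half, sub_sub_cancel] at this
    norm_num at this h1
    linarith
  intro y _
  obtain ⟨a, ha, hay⟩ := hlow y
  obtain ⟨b, hb, hby⟩ := hhigh y
  exact isPreconnected_Ioo.intermediate_value ha hb hc ⟨hay, hby⟩

/-- The profile is the inverse of the time map. It solves `U' = √(2 W(U))`, and this can be
differentiated once more because `W(U) > 0`; the two roots cancel and leave `W'(U)`. -/
lemma IsDoubleWell.exists_isOptimalProfile {W : ℝ → ℝ} (hW : IsDoubleWell W) :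
    ∃ U : ℝ → ℝ, IsOptimalProfile W U := by
  let G : Ioo (0 : ℝ) 1 → ℝ := fun v => profileTime W v
  have hG : StrictMono G := fun a b hab => hW.strictMonoOn_profileTime a.2 b.2 hab
  have hGs : Function.Surjective G := fun y => by
    obtain ⟨v, hv, h⟩ := hW.surjOn_profileTime (mem_univ y)
    exact ⟨⟨v, hv⟩, h⟩
  let e : Ioo (0 : ℝ) 1 ≃o ℝ := hG.orderIsoOfSurjective G hGs
  let U : ℝ → ℝ := fun y => (e.symm y : ℝ)
  have hUm : ∀ y, U y ∈ Ioo (0 : ℝ) 1 := fun y => (e.symm y).2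
  have hGU : ∀ y, profileTime W (U y) = y := fun y => e.apply_symm_apply y
  have hUG : ∀ v ∈ Ioo (0 : ℝ) 1, U (profileTime W v) = v := fun v hv =>
    congrArg Subtype.val (e.symm_apply_apply ⟨v, hv⟩)
  have hUc : Continuous U := continuous_subtype_val.comp e.symm.continuous
  have hUmono : Monotone U := fun a b hab => e.symm.monotone hab
  have hd : ∀ y, HasDerivAt U (√(2 * W (U y))) y := fun y => by
    have := HasDerivAt.of_local_left_inverse (f := profileTime W) (g := U) (a := y)
      hUc.continuousAt (hW.hasDerivAt_profileTime (hUm y))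
      (inv_ne_zero (hW.sqrt_pos (hUm y)).ne') (Eventually.of_forall hGU)
    rwa [inv_inv] at this
  have hdU : deriv U = fun y => √(2 * W (U y)) := funext fun y => (hd y).deriv
  have hdd : ∀ y, HasDerivAt (deriv U) (deriv W (U y)) y := fun y => by
    rw [hdU]
    have h2 : HasDerivAt (fun y => 2 * W (U y)) (2 * (deriv W (U y) * √(2 * W (U y)))) y :=
      ((hW.differentiable (U y)).hasDerivAt.comp y (hd y)).const_mul 2
    have hp := hW.sqrt_pos (hUm y)
    convert h2.sqrt (Real.sqrt_pos.1 hp).ne' using 1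
    field_simp
  refine ⟨U, ?_, fun z => (hdd z).deriv, ?_, ?_, ?_⟩
  · rw [show (2 : WithTop ℕ∞) = 1 + 1 from by norm_num, contDiff_succ_iff_deriv]
    refine ⟨fun y => (hd y).differentiableAt, by simp, ?_⟩
    rw [contDiff_one_iff_deriv]
    refine ⟨fun y => (hdd y).differentiableAt, ?_⟩
    rw [show deriv (deriv U) = fun y => deriv W (U y) from funext fun y => (hdd y).deriv]
    exact hW.contDiff_deriv.continuous.comp hUc
  · apply tendsto_atBot_isGLB hUmono
    refine ⟨by rintro _ ⟨y, rfl⟩; exact (hUm y).1.le, fun b hb => ?_⟩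
    by_contra! hcon
    -- A value of `U` below the supposed positive lower bound `b`; the minimum with `1 / 2` keeps it
    -- in the range.
    have hm : min b (1 / 2) / 2 ∈ Ioo (0 : ℝ) 1 := by
      constructor
      · positivity
      · linarith [min_le_right b (1 / 2)]
    have := hb ⟨profileTime W (min b (1 / 2) / 2), rfl⟩
    rw [hUG _ hm] at this
    have h0 : 0 < min b (1 / 2) := by positivity
    linarith [min_le_left b (1 / 2)]
  · apply tendsto_atTop_isLUB hUmono
    refine ⟨by rintro _ ⟨y, rfl⟩; exact (hUm y).2.le, fun b hb => ?_⟩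
    by_contra! hcon
    have h0 : 0 < min (1 - b) (1 / 2) := lt_min (by linarith) (by norm_num)
    have hm : 1 - min (1 - b) (1 / 2) / 2 ∈ Ioo (0 : ℝ) 1 := by
      constructor
      · linarith [min_le_right (1 - b) (1 / 2)]
      · linarith
    have := hb ⟨profileTime W (1 - min (1 - b) (1 / 2) / 2), rfl⟩
    rw [hUG _ hm] at this
    linarith [min_le_left (1 - b) (1 / 2)]
  · have := hUG (1 / 2) (by norm_num)
    rwa [profileTime_half] at this

/-- A function that grows at most at an exponential rate vanishes everywhere or nowhere. -/
lemma eq_zero_of_abs_deriv_le {f f' : ℝ → ℝ} {L : ℝ} (hf : ∀ x, HasDerivAt f (f' x) x)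
    (hL : ∀ x, |f' x| ≤ L * |f x|) {a : ℝ} (ha : f a = 0) (x : ℝ) : f x = 0 := by
  have hb : ∀ x, |f x * f' x| ≤ L * f x ^ 2 := fun x => by
    rw [abs_mul, ← sq_abs (f x)]
    nlinarith [hL x, abs_nonneg (f x)]
  have hexp : ∀ c x : ℝ, HasDerivAt (fun x => f x ^ 2 * Real.exp (c * x))
      ((2 * (f x * f' x) + c * f x ^ 2) * Real.exp (c * x)) x := fun c x => by
    have h2 : HasDerivAt (fun x : ℝ => Real.exp (c * x)) (Real.exp (c * x) * c) x := by
      simpa using ((hasDerivAt_id x).const_mul c).exp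
    exact (((hf x).pow 2).mul h2).congr_deriv (by simp only [Pi.pow_apply]; push_cast; ring)
  have hz : ∀ c : ℝ, f a ^ 2 * Real.exp (c * a) = 0 := fun c => by rw [ha]; simp
  have hsq : ∀ c : ℝ, f x ^ 2 * Real.exp (c * x) ≤ 0 → f x = 0 := fun c hc => by
    have h1 : f x ^ 2 * Real.exp (c * x) = 0 := le_antisymm hc (by positivity)
    simpa [Real.exp_ne_zero] using h1
  -- On either side of `a` the sign of the exponent is chosen so that the weighted square does not
  -- decrease towards `a`, where it vanishes.
  rcases le_total x a with h | h
  · have hm : Monotone (fun x => f x ^ 2 * Real.exp (2 * L * x)) :=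
      monotone_of_hasDerivAt_nonneg (hexp (2 * L)) fun x =>
        mul_nonneg (by linarith [neg_le_of_abs_le (hb x)]) (Real.exp_pos _).le
    exact hsq _ ((hm h).trans (hz _).le)
  · have hm : Antitone (fun x => f x ^ 2 * Real.exp (-(2 * L) * x)) :=
      antitone_of_hasDerivAt_nonpos (hexp (-(2 * L))) fun x =>
        mul_nonpos_of_nonpos_of_nonneg (by linarith [le_of_abs_le (hb x)]) (Real.exp_pos _).le
    exact hsq _ ((hm h).trans (hz _).le)

/-! ### First integral, uniqueness and decay of optimal profiles -/

namespace IsOptimalProfile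

variable {W U : ℝ → ℝ}

lemma hasDerivAt_deriv (hU : IsOptimalProfile W U) (z : ℝ) :
    HasDerivAt (deriv U) (deriv W (U z)) z := by
  have := hU.contDiff
  rw [show (2 : WithTop ℕ∞) = 1 + 1 from by norm_num, contDiff_succ_iff_deriv] at this
  rw [← hU.ode z]
  exact (this.2.2.differentiable (by norm_num) z).hasDerivAt

/-- Conservation of energy. The conserved value `c` is the limit of `U'²` at `+∞`; the mean value
theorem on `[x, x + 1]` produces points tending to infinity at which `U'` is small, so `c = 0`. -/
lemma deriv_sq (hW : IsDoubleWell W) (hU : IsOptimalProfile W U) (z : ℝ) :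
    deriv U z ^ 2 = 2 * W (U z) := by
  have hd : ∀ z, HasDerivAt U (deriv U z) z := fun z =>
    (hU.contDiff.differentiable (by norm_num) z).hasDerivAt
  have hconst : ∀ z, deriv U z ^ 2 - 2 * W (U z) = deriv U 0 ^ 2 - 2 * W (U 0) := by
    have hder : ∀ z, HasDerivAt (fun z => deriv U z ^ 2 - 2 * W (U z)) 0 z := fun z => by
      have h1 := (hU.hasDerivAt_deriv z).pow 2
      have h2 : HasDerivAt (fun z => 2 * W (U z)) (2 * (deriv W (U z) * deriv U z)) z :=
        ((hW.differentiable (U z)).hasDerivAt.comp z (hd z)).const_mul 2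
      exact (h1.sub h2).congr_deriv (by push_cast; ring)
    intro z
    exact is_const_of_deriv_eq_zero (fun z => (hder z).differentiableAt)
      (fun z => (hder z).deriv) z 0
  set c := deriv U 0 ^ 2 - 2 * W (U 0)
  have hlim : Tendsto (fun z => deriv U z ^ 2) Filter.atTop (𝓝 c) := by
    have h1 : Tendsto (fun z => 2 * W (U z) + c) Filter.atTop (𝓝 (2 * W 1 + c)) :=
      (((hW.contDiff.continuous.tendsto 1).comp hU.atTop).const_mul 2).add_const c
    rw [hW.one, mul_zero, zero_add] at h1
    exact h1.congr fun z => by linarith [hconst z]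
  have hmv : ∀ x : ℝ, ∃ y ∈ Ioo x (x + 1), deriv U y = U (x + 1) - U x := fun x => by
    obtain ⟨y, hy, h⟩ := exists_deriv_eq_slope U (lt_add_one x)
      hU.contDiff.continuous.continuousOn
      (hU.contDiff.differentiable (by norm_num)).differentiableOn
    exact ⟨y, hy, by simpa using h⟩
  choose y hy hyd using hmv
  have hyt : Tendsto y Filter.atTop Filter.atTop := tendsto_atTop_mono (fun x => (hy x).1.le) tendsto_id
  have h1 : Tendsto (fun x => (U (x + 1) - U x) ^ 2) Filter.atTop (𝓝 c) :=
    (hlim.comp hyt).congr fun x => by simp [hyd]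
  have h2 : Tendsto (fun x => (U (x + 1) - U x) ^ 2) Filter.atTop (𝓝 ((1 - 1) ^ 2)) :=
    ((hU.atTop.comp (tendsto_atTop_add_const_right _ 1 tendsto_id)).sub hU.atTop).pow 2
  have hc : c = 0 := by simpa using tendsto_nhds_unique h1 h2
  linarith [hconst z]

/-- By the first integral and the linear bound at the well, `|U'| ≤ L |U - w|` on the bounded range
of `U`. A solution that touches the well is therefore identically `w`, contrary to `U 0 = 1 / 2`. -/
lemma ne_well (hW : IsDoubleWell W) (hU : IsOptimalProfile W U) {w : ℝ} (hw : W w = 0)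
    (hne : w ≠ 1 / 2) (z : ℝ) : U z ≠ w := by
  have hbdd : ∃ R : ℝ, ∀ z, |U z| ≤ R := by
    obtain ⟨a, ha⟩ := eventually_atBot.1 (hU.atBot.abs.eventually (ge_mem_nhds
      (show |(0 : ℝ)| < 2 by norm_num)))
    obtain ⟨b, hb⟩ := eventually_atTop.1 (hU.atTop.abs.eventually (ge_mem_nhds
      (show |(1 : ℝ)| < 2 by norm_num)))
    obtain ⟨M, hM⟩ := (isCompact_Icc (a := a) (b := b)).exists_bound_of_continuousOn
      hU.contDiff.continuous.continuousOn
    refine ⟨max 2 M, fun z => ?_⟩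
    rcases le_total z a with h | h
    · exact (ha z h).trans (le_max_left _ _)
    rcases le_total b z with h' | h'
    · exact (hb z h').trans (le_max_left _ _)
    exact (hM z ⟨h, h'⟩).trans (le_max_right _ _)
  obtain ⟨R, hR⟩ := hbdd
  obtain ⟨L, hL, h⟩ := hW.sqrt_le hw R
  intro hz
  have := eq_zero_of_abs_deriv_le (f := fun z => U z - w) (f' := deriv U) (L := L)
    (fun x => ((hU.contDiff.differentiable (by norm_num) x).hasDerivAt).sub_const w)
    (fun x => by
      rw [← Real.sqrt_sq_eq_abs, hU.deriv_sq hW]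
      exact h _ (hR x)) (a := z) (by simp [hz]) 0
  rw [hU.half] at this
  exact hne (by linarith)

lemma mem_Ioo (hW : IsDoubleWell W) (hU : IsOptimalProfile W U) (z : ℝ) :
    U z ∈ Ioo (0 : ℝ) 1 := by
  have hc := hU.contDiff.continuous
  constructor
  · by_contra! h
    obtain ⟨y, hy⟩ := mem_range_of_exists_le_of_exists_ge hc ⟨z, h⟩
      ⟨0, show (0 : ℝ) ≤ U 0 by rw [hU.half]; norm_num⟩
    exact hU.ne_well hW hW.zero (by norm_num) y hy
  · by_contra! h
    obtain ⟨y, hy⟩ := mem_range_of_exists_le_of_exists_ge hc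
      ⟨0, show U 0 ≤ (1 : ℝ) by rw [hU.half]; norm_num⟩ ⟨z, h⟩
    exact hU.ne_well hW hW.one (by norm_num) y hy

/-- The first integral determines `U'` up to sign, and `U'` has no zeros, so the sign is constant. A
decreasing profile with limit 1 would satisfy `U 0 ≥ 1`. -/
lemma hasDerivAt (hW : IsDoubleWell W) (hU : IsOptimalProfile W U) (z : ℝ) :
    HasDerivAt U (√(2 * W (U z))) z := by
  have hd : Differentiable ℝ U := hU.contDiff.differentiable (by norm_num)
  have hc : Continuous (deriv U) := hU.contDiff.continuous_deriv (by norm_num)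
  have hne : ∀ z, deriv U z ≠ 0 := fun z h => by
    have h1 := hU.deriv_sq hW z
    rw [h] at h1
    have := hW.sqrt_pos (hU.mem_Ioo hW z)
    rw [Real.sqrt_pos] at this
    linarith
  have hpos : ∀ z, 0 < deriv U z := by
    by_contra! hcon
    obtain ⟨z₀, hz₀⟩ := hcon
    have hneg : ∀ z, deriv U z ≤ 0 := by
      by_contra! hcon
      obtain ⟨z₁, hz₁⟩ := hcon
      obtain ⟨y, hy⟩ := mem_range_of_exists_le_of_exists_ge hc ⟨z₀, hz₀⟩ ⟨z₁, hz₁.le⟩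
      exact hne y hy
    have := (antitone_of_deriv_nonpos hd hneg).le_of_tendsto hU.atTop 0
    rw [hU.half] at this
    norm_num at this
  have : deriv U z = √(2 * W (U z)) := by
    rw [← hU.deriv_sq hW, Real.sqrt_sq (hpos z).le]
  rw [← this]
  exact (hd z).hasDerivAt

lemma profileTime_apply (hW : IsDoubleWell W) (hU : IsOptimalProfile W U) (z : ℝ) :
    profileTime W (U z) = z := by
  have hder : ∀ z, HasDerivAt (fun z => profileTime W (U z) - z) 0 z := fun z => by
    have h1 : HasDerivAt (fun z => profileTime W (U z)) _ z :=
      (hW.hasDerivAt_profileTime (hU.mem_Ioo hW z)).comp z (hU.hasDerivAt hW z)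
    exact (h1.sub (hasDerivAt_id z)).congr_deriv
      (by rw [inv_mul_cancel₀ (hW.sqrt_pos (hU.mem_Ioo hW z)).ne', sub_self])
  have := is_const_of_deriv_eq_zero (fun z => (hder z).differentiableAt)
      (fun z => (hder z).deriv) z 0
  simp only [hU.half, profileTime_half] at this
  linarith

lemma unique {V : ℝ → ℝ} (hW : IsDoubleWell W) (hU : IsOptimalProfile W U)
    (hV : IsOptimalProfile W V) : U = V :=
  funext fun z => hW.strictMonoOn_profileTime.injOn (hU.mem_Ioo hW z) (hV.mem_Ioo hW z)
    ((hU.profileTime_apply hW z).trans (hV.profileTime_apply hW z).symm)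

/-- Exponential convergence of the optimal profile to the wells. -/
lemma exponential_decay (hW : IsDoubleWell W) (hU : IsOptimalProfile W U) :
    ∃ κ : ℝ, 0 < κ ∧ ∀ z, U z ≤ Real.exp (κ * z) ∧ 1 - U z ≤ Real.exp (-(κ * z)) := by
  obtain ⟨κ, hκ, h⟩ := hW.le_sqrt
  refine ⟨κ, hκ, ?_⟩
  have hm := hU.mem_Ioo hW
  -- The logarithm of the odds `U / (1 - U)` has derivative `√(2 W(U)) / (U (1 - U)) ≥ κ`. The odds
  -- equal 1 at the origin, so they are compared with `exp (κ z)` on both sides of it.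
  have hmono : Monotone fun z => U z / (1 - U z) * Real.exp (-κ * z) := by
    have h2 : ∀ z, HasDerivAt (fun x : ℝ => Real.exp (-κ * x)) (Real.exp (-κ * z) * -κ) z := by
      intro z
      simpa using ((hasDerivAt_id z).const_mul (-κ)).exp
    have h1 := fun z => ((hU.hasDerivAt hW z).div ((hU.hasDerivAt hW z).const_sub 1)
      (sub_pos.2 (hm z).2).ne').mul (h2 z)
    refine monotone_of_hasDerivAt_nonneg h1 fun z => ?_
    have hz := hm z
    have h1z : 0 < 1 - U z := sub_pos.2 hz.2
    have h3 := h (U z) ⟨hz.1.le, hz.2.le⟩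
    have e : (√(2 * W (U z)) * (1 - U z) - U z * -√(2 * W (U z))) / (1 - U z) ^ 2 *
        Real.exp (-κ * z) + U z / (1 - U z) * (Real.exp (-κ * z) * -κ) =
        (√(2 * W (U z)) - κ * (U z * (1 - U z))) * (Real.exp (-κ * z) / (1 - U z) ^ 2) := by
      field_simp
      ring
    refine le_of_le_of_eq ?_ e.symm
    exact mul_nonneg (by linarith) (by positivity)
  have h0 : U 0 / (1 - U 0) * Real.exp (-κ * 0) = 1 := by rw [hU.half]; norm_num
  intro z
  have hz := hm z
  have h1z : 0 < 1 - U z := sub_pos.2 hz.2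
  have hq : U z / (1 - U z) * Real.exp (-κ * z) * Real.exp (κ * z) = U z / (1 - U z) := by
    rw [mul_assoc, ← Real.exp_add]; simp
  rcases le_total z 0 with hz0 | hz0
  · constructor
    · have := hmono hz0
      simp only [h0] at this
      calc U z ≤ U z / (1 - U z) := by rw [le_div_iff₀ h1z]; nlinarith [hz.1]
        _ ≤ 1 * Real.exp (κ * z) := by rw [← hq]; gcongr
        _ = _ := one_mul _
    · refine (show 1 - U z ≤ 1 by linarith [hz.1]).trans (Real.one_le_exp ?_)
      nlinarith
  · constructor
    · refine hz.2.le.trans (Real.one_le_exp (by positivity))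
    · have := hmono hz0
      simp only [h0] at this
      have h4 : 1 * Real.exp (κ * z) ≤ U z / (1 - U z) := by rw [← hq]; gcongr
      rw [one_mul, le_div_iff₀ h1z] at h4
      rw [Real.exp_neg, ← one_div, le_div_iff₀ (Real.exp_pos _)]
      nlinarith [hz.2]

/-- The properties of the profile `U` and of `Φ = φ ∘ U` that enter the estimates. -/
lemma bounds (hW : IsDoubleWell W) (hU : IsOptimalProfile W U) :
    ∃ κ C : ℝ, 0 < κ ∧ 0 < C ∧ ∀ z,
      2 * W (U z) ≤ C * Real.exp (-(κ * |z|)) ∧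
      wellPrimitive W (U z) ≤ C * Real.exp (κ * z) ∧
      1 - wellPrimitive W (U z) ≤ C * Real.exp (-(κ * z)) := by
  obtain ⟨κ, hκ, h⟩ := hU.exponential_decay hW
  obtain ⟨L, hL, hφ⟩ := hW.wellPrimitive_bounds
  obtain ⟨A, hA, h0⟩ := hW.sqrt_le hW.zero 1
  obtain ⟨B, hB, h1⟩ := hW.sqrt_le hW.one 1
  refine ⟨κ, L + A ^ 2 + B ^ 2, hκ, by positivity, fun z => ?_⟩
  have hz := hU.mem_Ioo hW z
  have hz' : U z ∈ Icc (0 : ℝ) 1 := ⟨hz.1.le, hz.2.le⟩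
  have hLe : ∀ x : ℝ, L * Real.exp x ≤ (L + A ^ 2 + B ^ 2) * Real.exp x := fun x => by
    gcongr; nlinarith
  refine ⟨?_, ?_, ?_⟩
  · have hnn : 0 ≤ 2 * W (U z) := mul_nonneg two_pos.le (hW.nonneg _)
    have habs : |U z| ≤ 1 := by rw [abs_of_pos hz.1]; exact hz.2.le
    have e0 := h0 _ habs
    have e1 := h1 _ habs
    rw [sub_zero, abs_of_pos hz.1] at e0
    rw [abs_sub_comm, abs_of_pos (sub_pos.2 hz.2)] at e1
    rw [← Real.sq_sqrt hnn]
    have hs := Real.sqrt_nonneg (2 * W (U z))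
    rcases le_total z 0 with hz0 | hz0
    · rw [abs_of_nonpos hz0, mul_neg, neg_neg]
      have h2 := (h z).1
      calc √(2 * W (U z)) ^ 2 ≤ (A * U z) ^ 2 := by gcongr
        _ ≤ A ^ 2 * U z := by rw [mul_pow]; gcongr; nlinarith [hz.1, hz.2]
        _ ≤ (L + A ^ 2 + B ^ 2) * Real.exp (κ * z) := by
          gcongr
          · exact hz.1.le
          · linarith [sq_nonneg B]
    · rw [abs_of_nonneg hz0]
      have h2 := (h z).2
      calc √(2 * W (U z)) ^ 2 ≤ (B * (1 - U z)) ^ 2 := by gcongr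
        _ ≤ B ^ 2 * (1 - U z) := by rw [mul_pow]; gcongr; nlinarith [hz.1, hz.2]
        _ ≤ (L + A ^ 2 + B ^ 2) * Real.exp (-(κ * z)) := by
          gcongr
          · linarith [hz.2]
          · linarith [sq_nonneg A]
  · exact (hφ _ hz').1.trans ((mul_le_mul_of_nonneg_left (h z).1 hL.le).trans (hLe _))
  · exact (hφ _ hz').2.trans ((mul_le_mul_of_nonneg_left (h z).2 hL.le).trans (hLe _))

/-- Both factors of the chain rule equal `√(2 W(U))`. This equipartition lets `∇ψ` match the energy
density exactly. -/
lemma hasDerivAt_wellPrimitive_comp (hW : IsDoubleWell W) (hU : IsOptimalProfile W U) (z : ℝ) :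
    HasDerivAt (fun z => wellPrimitive W (U z)) (2 * W (U z)) z := by
  have h : HasDerivAt (fun z => wellPrimitive W (U z)) _ z :=
    (hW.hasDerivAt_wellPrimitive (U z)).comp z (hU.hasDerivAt hW z)
  rwa [Real.mul_self_sqrt (mul_nonneg two_pos.le (hW.nonneg _))] at h

end IsOptimalProfile

section Geometry

variable {d : ℕ}

local notation "𝔼" => EuclideanSpace ℝ (Fin d)

section SignedDistance

/-! ### Signed distance and exterior normals -/

lemma inner_gradient (f : 𝔼 → ℝ) (x v : 𝔼) : inner ℝ (gradient f x) v = fderiv ℝ f x v := by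
  simp [gradient]

lemma norm_gradient (f : 𝔼 → ℝ) (x : 𝔼) : ‖gradient f x‖ = ‖fderiv ℝ f x‖ := by
  simp [gradient]

/-- The constant 2 is crude but serves for continuity, differentiability almost everywhere and
qualitative Lipschitz bounds. The sharp bound on the gradient is `norm_fderiv_signedDist_le`. -/
lemma lipschitzWith_signedDist (Ω : Set 𝔼) : LipschitzWith 2 (signedDistBoundary Ω) := by
  have := (Metric.lipschitz_infDist_pt Ω).sub (Metric.lipschitz_infDist_pt Ωᶜ)
  rwa [one_add_one_eq_two] at this

lemma continuous_signedDist (Ω : Set 𝔼) : Continuous (signedDistBoundary Ω) :=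
  (lipschitzWith_signedDist Ω).continuous

lemma signedDist_of_mem {Ω : Set 𝔼} {x : 𝔼} (hx : x ∈ Ω) :
    signedDistBoundary Ω x = -Metric.infDist x Ωᶜ := by
  rw [signedDistBoundary, Metric.infDist_zero_of_mem hx, zero_sub]

lemma signedDist_of_notMem {Ω : Set 𝔼} {x : 𝔼} (hx : x ∉ Ω) :
    signedDistBoundary Ω x = Metric.infDist x Ω := by
  rw [signedDistBoundary, Metric.infDist_zero_of_mem (mem_compl hx), sub_zero]

lemma signedDist_nonpos {Ω : Set 𝔼} {x : 𝔼} (hx : x ∈ Ω) : signedDistBoundary Ω x ≤ 0 := by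
  rw [signedDist_of_mem hx, neg_nonpos]
  exact Metric.infDist_nonneg

lemma signedDist_nonneg {Ω : Set 𝔼} {x : 𝔼} (hx : x ∉ Ω) : 0 ≤ signedDistBoundary Ω x := by
  rw [signedDist_of_notMem hx]
  exact Metric.infDist_nonneg

lemma ne_univ_of_frontier_nonempty {Ω : Set 𝔼} (hne : (frontier Ω).Nonempty) : Ω ≠ univ := by
  rintro rfl
  simp at hne

lemma nonempty_of_frontier_nonempty {Ω : Set 𝔼} (hne : (frontier Ω).Nonempty) : Ω.Nonempty := by
  rw [nonempty_iff_ne_empty]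
  rintro rfl
  simp at hne

/-- A nearest point on the other side lies on the boundary. Combined with a Lipschitz bound, this
turns vanishing on the boundary into a bound by `|s|`, a device used throughout. -/
lemma exists_frontier_dist_eq {Ω : Set 𝔼} (hne : (frontier Ω).Nonempty) (x : 𝔼) :
    ∃ p ∈ frontier Ω, dist x p = |signedDistBoundary Ω x| := by
  by_cases hx : x ∈ Ω
  · obtain ⟨p, hp, h⟩ := exists_mem_frontier_infDist_compl_eq_dist hx
      (ne_univ_of_frontier_nonempty hne)
    exact ⟨p, hp, by rw [signedDist_of_mem hx, abs_neg, h, abs_of_nonneg dist_nonneg]⟩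
  · obtain ⟨p, hp, h⟩ := exists_mem_frontier_infDist_compl_eq_dist (s := Ωᶜ) hx
      (fun h => (nonempty_of_frontier_nonempty hne).ne_empty (compl_univ_iff.1 h))
    rw [frontier_compl] at hp
    rw [compl_compl] at h
    exact ⟨p, hp, by rw [signedDist_of_notMem hx, h, abs_of_nonneg dist_nonneg]⟩

lemma signedDist_eq_zero_of_mem_frontier {Ω : Set 𝔼} {p : 𝔼} (hp : p ∈ frontier Ω) :
    signedDistBoundary Ω p = 0 := by
  rw [frontier_eq_closure_inter_closure] at hp
  rw [signedDistBoundary, Metric.infDist_zero_of_mem_closure hp.1,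
    Metric.infDist_zero_of_mem_closure hp.2, sub_zero]

lemma signedDist_eq_zero_iff {Ω : Set 𝔼} (hne : (frontier Ω).Nonempty) {x : 𝔼} :
    signedDistBoundary Ω x = 0 ↔ x ∈ frontier Ω := by
  refine ⟨fun h => ?_, signedDist_eq_zero_of_mem_frontier⟩
  obtain ⟨p, hp, hd⟩ := exists_frontier_dist_eq hne x
  rw [h, abs_zero, dist_eq_zero] at hd
  rwa [hd]

lemma infDist_frontier_le {Ω : Set 𝔼} (hne : (frontier Ω).Nonempty) (x : 𝔼) :
    Metric.infDist x (frontier Ω) ≤ |signedDistBoundary Ω x| := by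
  obtain ⟨p, hp, h⟩ := exists_frontier_dist_eq hne x
  rw [← h]
  exact Metric.infDist_le_dist_of_mem hp

/-- A function that describes `Ω` as a sublevel set vanishes on the boundary. -/
lemma eq_zero_of_mem_frontier {Ω : Set 𝔼} (hO : IsOpen Ω) {f : 𝔼 → ℝ} {p : 𝔼}
    (hp : p ∈ frontier Ω) (hf : ContinuousAt f p) (h : ∀ᶠ x in 𝓝 p, x ∈ Ω ↔ f x < 0) :
    f p = 0 := by
  rw [hO.frontier_eq] at hp
  apply le_antisymm
  · by_contra! hcon
    have h1 : ∀ᶠ x in 𝓝 p, 0 < f x := hf.eventually (lt_mem_nhds hcon)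
    obtain ⟨x, hx1, hx2, hx3⟩ := mem_closure_iff_frequently.1 hp.1 |>.and_eventually (h.and h1)
      |>.exists
    linarith [hx2.1 hx1]
  · by_contra! hcon
    exact hp.2 (h.self_of_nhds.2 hcon)

namespace IsExteriorNormal

/-- A line through the boundary point that is not tangential crosses the boundary. -/
lemma eventually_sign {Ω : Set 𝔼} {p n : 𝔼} (hO : IsOpen Ω) (hp : p ∈ frontier Ω) (hn : IsExteriorNormal Ω p n)
    (w : 𝔼) :
    (inner ℝ n w < 0 → ∀ᶠ t : ℝ in 𝓝[>] 0, p + t • w ∈ Ω) ∧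
    (0 < inner ℝ n w → ∀ᶠ t : ℝ in 𝓝[>] 0, p + t • w ∉ Ω) := by
  obtain ⟨-, V, f, r, hV, hpV, hf, hΩ, hr, hg⟩ := hn
  have hfa : ContDiffAt ℝ 1 f p := hf.contDiffAt (hV.mem_nhds hpV)
  have hfd : DifferentiableAt ℝ f p := hfa.differentiableAt (by norm_num)
  have hev : ∀ᶠ x in 𝓝 p, x ∈ Ω ↔ f x < 0 := by
    filter_upwards [hV.mem_nhds hpV] with x hx using hΩ x hx
  have h0 : f p = 0 := eq_zero_of_mem_frontier hO hp hfd.continuousAt hev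
  have hline : HasDerivAt (fun t : ℝ => p + t • w) w 0 := by
    simpa using ((hasDerivAt_id (0 : ℝ)).smul_const w).const_add p
  have hcomp : HasDerivAt (fun t : ℝ => f (p + t • w)) (r * inner ℝ n w) 0 := by
    have h1 : HasFDerivAt f (fderiv ℝ f p) (p + (0 : ℝ) • w) := by
      rw [zero_smul, add_zero]; exact hfd.hasFDerivAt
    have := h1.comp_hasDerivAt (0 : ℝ) hline
    rwa [← inner_gradient, hg, inner_smul_left] at this
  have hevt : ∀ᶠ t : ℝ in 𝓝[>] 0, (p + t • w ∈ Ω ↔ f (p + t • w) < 0) := by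
    have : Tendsto (fun t : ℝ => p + t • w) (𝓝[>] 0) (𝓝 p) := by
      have := hline.continuousAt.tendsto
      rw [zero_smul, add_zero] at this
      exact this.mono_left nhdsWithin_le_nhds
    exact this.eventually hev
  have hslope := (hasDerivAt_iff_tendsto_slope.1 hcomp).mono_left
    (nhdsWithin_mono 0 (fun t (ht : 0 < t) => ht.ne'))
  constructor
  · intro hw
    filter_upwards [hevt, hslope.eventually (gt_mem_nhds (mul_neg_of_pos_of_neg hr hw)),
      self_mem_nhdsWithin] with t h1 h2 h3
    rw [h1]
    rw [slope_def_field, zero_smul, add_zero, h0, sub_zero, sub_zero] at h2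
    exact (div_neg_iff.1 h2).resolve_left (fun h => lt_asymm h.2 h3) |>.1
  · intro hw
    filter_upwards [hevt, hslope.eventually (lt_mem_nhds (mul_pos hr hw)),
      self_mem_nhdsWithin] with t h1 h2 h3
    rw [h1, not_lt]
    rw [slope_def_field, zero_smul, add_zero, h0, sub_zero, sub_zero] at h2
    exact ((div_pos_iff.1 h2).resolve_right (fun h => lt_asymm h.2 h3)).1.le

end IsExteriorNormal

/-- Two unit vectors agree if the open half-space below one is contained in the closed half-space
below the other. -/
lemma eq_of_halfSpace_subset {a b : 𝔼} (ha : ‖a‖ = 1) (hb : ‖b‖ = 1)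
    (h : ∀ w : 𝔼, inner ℝ a w < 0 → inner ℝ b w ≤ 0) : a = b := by
  by_contra hne
  have hlt := (inner_lt_one_iff_real_of_norm_eq_one ha hb).2 hne
  -- If `a ≠ b`, the test vector `b - a` lies strictly below `a`, yet `⟨b, b - a⟩ = 1 - ⟨a, b⟩ > 0`.
  have h1 := h (b - a) (by rw [inner_sub_right, real_inner_self_eq_norm_sq, ha]; linarith)
  rw [inner_sub_right, real_inner_self_eq_norm_sq, hb, real_inner_comm] at h1
  linarith

/-- A direction that enters the region according to one normal cannot leave it according to the
other, so the half-spaces are nested. -/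
lemma IsExteriorNormal.unique {Ω : Set 𝔼} {p n m : 𝔼} (hO : IsOpen Ω) (hp : p ∈ frontier Ω)
    (hn : IsExteriorNormal Ω p n) (hm : IsExteriorNormal Ω p m) : n = m := by
  refine eq_of_halfSpace_subset hn.1 hm.1 fun w hw => ?_
  by_contra! hcon
  obtain ⟨t, h1, h2⟩ :=
    (((hn.eventually_sign hO hp w).1 hw).and ((hm.eventually_sign hO hp w).2 hcon)).exists
  exact h2 h1

/-- First-order optimality of a nearest point. -/
lemma inner_nonpos_of_dist_le {x p w : 𝔼}
    (h : ∀ᶠ t : ℝ in 𝓝[>] 0, dist x p ≤ dist x (p + t • w)) : inner ℝ (x - p) w ≤ 0 := by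
  have h1 : ∀ᶠ t : ℝ in 𝓝[>] 0, 2 * inner ℝ (x - p) w ≤ t * ‖w‖ ^ 2 := by
    filter_upwards [h, self_mem_nhdsWithin] with t ht ht0
    have ht0' : 0 < t := ht0
    rw [dist_eq_norm, dist_eq_norm, ← sub_sub] at ht
    have h2 : ‖x - p‖ ^ 2 ≤ ‖x - p - t • w‖ ^ 2 := by gcongr
    rw [norm_sub_sq_real (x - p), inner_smul_right, norm_smul, mul_pow, Real.norm_eq_abs, sq_abs] at h2
    have h3 : 0 ≤ t * (t * ‖w‖ ^ 2 - 2 * inner ℝ (x - p) w) := by nlinarith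
    linarith [nonneg_of_mul_nonneg_right h3 ht0']
  have h2 : Tendsto (fun t : ℝ => t * ‖w‖ ^ 2) (𝓝[>] 0) (𝓝 0) := by
    have : Continuous fun t : ℝ => t * ‖w‖ ^ 2 := by fun_prop
    simpa using (this.tendsto 0).mono_left nhdsWithin_le_nhds
  linarith [ge_of_tendsto h2 h1]

/-- A point off the boundary lies on the normal line through its nearest boundary point. -/
lemma IsExteriorNormal.sub_eq_smul {Ω : Set 𝔼} {x p n : 𝔼} (hO : IsOpen Ω)
    (hp : p ∈ frontier Ω) (hn : IsExteriorNormal Ω p n)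
    (hd : dist x p = |signedDistBoundary Ω x|) (h0 : signedDistBoundary Ω x ≠ 0) :
    x - p = signedDistBoundary Ω x • n := by
  suffices h : n = (signedDistBoundary Ω x)⁻¹ • (x - p) by
    rw [h, smul_smul, mul_inv_cancel₀ h0, one_smul]
  refine eq_of_halfSpace_subset hn.1 ?_ fun w hw => ?_
  · rw [norm_smul, norm_inv, Real.norm_eq_abs, ← dist_eq_norm, hd,
      inv_mul_cancel₀ (abs_ne_zero.2 h0)]
  rw [real_inner_smul_left]
  -- No point across the boundary is closer to `x` than `p`. From inside, the competitors are the
  -- directions that leave the region; from outside, those that enter it.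
  by_cases hx : x ∈ Ω
  · have hw' : 0 < inner ℝ n (-w) := by rw [inner_neg_right]; linarith
    have h1 : inner ℝ (x - p) (-w) ≤ 0 := by
      apply inner_nonpos_of_dist_le
      filter_upwards [(hn.eventually_sign hO hp (-w)).2 hw'] with t ht
      rw [hd, signedDist_of_mem hx, abs_neg, abs_of_nonneg Metric.infDist_nonneg]
      exact Metric.infDist_le_dist_of_mem ht
    rw [inner_neg_right] at h1
    exact mul_nonpos_of_nonpos_of_nonneg (inv_nonpos.2 (signedDist_nonpos hx)) (by linarith)
  · have h1 : inner ℝ (x - p) w ≤ 0 := by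
      apply inner_nonpos_of_dist_le
      filter_upwards [(hn.eventually_sign hO hp w).1 hw] with t ht
      rw [hd, signedDist_of_notMem hx, abs_of_nonneg Metric.infDist_nonneg]
      exact Metric.infDist_le_dist_of_mem ht
    exact mul_nonpos_of_nonneg_of_nonpos (inv_nonneg.2 (signedDist_nonneg hx)) h1

/-- Off the boundary only one of the two distances is active locally, and each is 1-Lipschitz. -/
lemma norm_fderiv_signedDist_le {Ω : Set 𝔼} (hO : IsOpen Ω) {x : 𝔼} (hx : x ∉ frontier Ω) :
    ‖fderiv ℝ (signedDistBoundary Ω) x‖ ≤ 1 := by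
  by_cases hxΩ : x ∈ Ω
  · have : signedDistBoundary Ω =ᶠ[𝓝 x] fun y => -Metric.infDist y Ωᶜ := by
      filter_upwards [hO.mem_nhds hxΩ] with y hy using signedDist_of_mem hy
    rw [this.fderiv_eq]
    rw [fderiv_fun_neg, norm_neg]
    simpa using norm_fderiv_le_of_lipschitz ℝ (Metric.lipschitz_infDist_pt Ωᶜ) (x₀ := x)
  · have hxc : x ∈ (closure Ω)ᶜ := fun h => hx (by rw [hO.frontier_eq]; exact ⟨h, hxΩ⟩)
    have : signedDistBoundary Ω =ᶠ[𝓝 x] fun y => Metric.infDist y Ω := by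
      filter_upwards [isClosed_closure.isOpen_compl.mem_nhds hxc] with y hy using
        signedDist_of_notMem fun h => hy (subset_closure h)
    rw [this.fderiv_eq]
    simpa using norm_fderiv_le_of_lipschitz ℝ (Metric.lipschitz_infDist_pt Ω) (x₀ := x)

/-- The distance to a set along the segment to a nearest point. -/
lemma infDist_segment {A : Set 𝔼} {x p : 𝔼} (hp : p ∈ closure A)
    (hd : dist x p = Metric.infDist x A) {t : ℝ} (ht : t ∈ Icc (0 : ℝ) 1) :
    Metric.infDist (p + t • (x - p)) A = t * Metric.infDist x A := by
  apply le_antisymm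
  · rw [← Metric.infDist_closure, ← hd, dist_eq_norm]
    refine (Metric.infDist_le_dist_of_mem hp).trans_eq ?_
    rw [dist_eq_norm, add_sub_cancel_left, norm_smul, Real.norm_of_nonneg ht.1]
  · have h1 := Metric.infDist_le_infDist_add_dist (s := A) (x := x) (y := p + t • (x - p))
    have h2 : dist x (p + t • (x - p)) = (1 - t) * Metric.infDist x A := by
      rw [← hd, dist_eq_norm, dist_eq_norm,
        show x - (p + t • (x - p)) = (1 - t) • (x - p) by rw [sub_smul, one_smul]; abel,
        norm_smul, Real.norm_of_nonneg (sub_nonneg.2 ht.2)]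
    rw [h2] at h1
    linarith

/-- Off the boundary the gradient of the signed distance is the exterior normal at a nearest
point. -/
lemma gradient_signedDist {Ω : Set 𝔼} {x p n : 𝔼} (hO : IsOpen Ω)
    (hp : p ∈ frontier Ω) (hn : IsExteriorNormal Ω p n)
    (hd : dist x p = |signedDistBoundary Ω x|) (hx : x ∉ frontier Ω)
    (hdiff : DifferentiableAt ℝ (signedDistBoundary Ω) x) :
    gradient (signedDistBoundary Ω) x = n := by
  set s := signedDistBoundary Ω with hs
  have h0 : s x ≠ 0 := fun h => hx ((signedDist_eq_zero_iff ⟨p, hp⟩).1 h)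
  have hxp : x - p = s x • n := hn.sub_eq_smul hO hp hd h0
  have hline : HasDerivAt (fun t : ℝ => p + t • (x - p)) (x - p) 1 := by
    simpa using ((hasDerivAt_id (1 : ℝ)).smul_const (x - p)).const_add p
  have hval : ∀ t ∈ Ioo (0 : ℝ) 1, s (p + t • (x - p)) = t * s x := fun t ht => by
    by_cases hxΩ : x ∈ Ω
    · rw [hs, signedDist_of_mem hxΩ, abs_neg, abs_of_nonneg Metric.infDist_nonneg] at hd
      rw [hs, signedDist_of_mem hxΩ] at h0
      have hp' : p ∈ closure Ωᶜ := by
        rw [frontier_eq_closure_inter_closure] at hp; exact hp.2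
      have h1 := infDist_segment hp' hd ⟨ht.1.le, ht.2.le⟩
      have h2 : p + t • (x - p) ∈ Ω := by
        by_contra hcon
        rw [Metric.infDist_zero_of_mem hcon] at h1
        exact mul_ne_zero ht.1.ne' (neg_ne_zero.1 h0) h1.symm
      rw [hs, signedDist_of_mem h2, signedDist_of_mem hxΩ, h1, mul_neg]
    · rw [hs, signedDist_of_notMem hxΩ, abs_of_nonneg Metric.infDist_nonneg] at hd
      rw [hs, signedDist_of_notMem hxΩ] at h0
      have h1 := infDist_segment hp.1 hd ⟨ht.1.le, ht.2.le⟩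
      have h2 : p + t • (x - p) ∉ Ω := by
        intro hcon
        rw [Metric.infDist_zero_of_mem hcon] at h1
        exact mul_ne_zero ht.1.ne' h0 h1.symm
      rw [hs, signedDist_of_notMem h2, signedDist_of_notMem hxΩ, h1]
  have hseg : ∀ t ∈ Ioo (0 : ℝ) 1, slope (fun t : ℝ => s (p + t • (x - p))) 1 t = s x :=
    fun t ht => by
      rw [slope_def_field, hval t ht, one_smul, add_sub_cancel, div_eq_iff (by linarith [ht.2])]
      ring
  have h1 : fderiv ℝ s x (x - p) = s x := by
    have hx1 : p + (1 : ℝ) • (x - p) = x := by simp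
    have hc : HasDerivAt (fun t : ℝ => s (p + t • (x - p))) (fderiv ℝ s x (x - p)) 1 := by
      have h2 : HasFDerivAt s (fderiv ℝ s x) (p + (1 : ℝ) • (x - p)) := by
        rw [hx1]; exact hdiff.hasFDerivAt
      exact h2.comp_hasDerivAt (1 : ℝ) hline
    have h2 := (hasDerivAt_iff_tendsto_slope.1 hc).mono_left
      (nhdsWithin_mono 1 (fun t (ht : t ∈ Iio (1 : ℝ)) => ht.ne))
    refine tendsto_nhds_unique h2 (tendsto_const_nhds.congr' ?_)
    filter_upwards [Ioo_mem_nhdsLT (show (0 : ℝ) < 1 by norm_num)] with t ht using (hseg t ht).symm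
  -- Linearity of `s` along the segment gives slope 1 in direction `n`. Since the gradient has norm
  -- at most 1, equality holds in the Cauchy–Schwarz inequality and the gradient is `n`.
  have h2 : inner ℝ (gradient s x) n = (1 : ℝ) := by
    rw [hxp, map_smul, smul_eq_mul] at h1
    rw [inner_gradient]
    exact mul_left_cancel₀ h0 (by rw [h1, mul_one])
  have h3 : ‖gradient s x‖ ≤ 1 := by
    rw [norm_gradient]; exact norm_fderiv_signedDist_le hO hx
  have h4 : ‖gradient s x - n‖ ^ 2 ≤ 0 := by
    rw [norm_sub_sq_real, h2, hn.1]
    nlinarith [norm_nonneg (gradient s x)]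
  have h5 : ‖gradient s x - n‖ = 0 := by
    nlinarith [norm_nonneg (gradient s x - n)]
  exact sub_eq_zero.1 (norm_eq_zero.1 h5)

end SignedDistance

section Collar

/-! ### Volumes of one-sided and two-sided collars -/

/-- Near a boundary point, `Ω` is the sublevel set of a function that increases uniformly in a
direction `e`. -/
lemma HasC3HolderBoundary.exists_increasing {α : ℝ≥0} {Ω : Set 𝔼} (hΩ : HasC3HolderBoundary α Ω)
    (hO : IsOpen Ω) {p : 𝔼} (hp : p ∈ frontier Ω) :
    ∃ (f : 𝔼 → ℝ) (e : 𝔼) (m ρ : ℝ), ‖e‖ = 1 ∧ 0 < m ∧ 0 < ρ ∧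
      (∀ x ∈ Metric.ball p ρ, x ∈ Ω ↔ f x < 0) ∧
      (∀ q ∈ frontier Ω ∩ Metric.ball p ρ, f q = 0) ∧
      (∀ x ∈ Metric.ball p ρ, ∀ y ∈ Metric.ball p ρ, |f x - f y| ≤ 3 * m * dist x y) ∧
      ∀ x ∈ Metric.ball p ρ, ∀ t : ℝ, 0 ≤ t → x + t • e ∈ Metric.ball p ρ →
        m * t ≤ f (x + t • e) - f x := by
  obtain ⟨V, f, hV, hpV, hf, -, hg, hfΩ⟩ := hΩ p hp
  have hfa : ∀ x ∈ V, ContDiffAt ℝ 3 f x := fun x hx => hf.contDiffAt (hV.mem_nhds hx)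
  have hst := (hfa p hpV).hasStrictFDerivAt (by norm_num)
  set a := gradient f p with ha
  have ha0 : 0 < ‖a‖ := norm_pos_iff.2 (hg p hpV)
  have hL : ∀ v : 𝔼, fderiv ℝ f p v = inner ℝ a v := fun v => (inner_gradient f p v).symm
  -- Strict differentiability with error `‖a‖ / 2`: slopes in the gradient direction are at least `m
  -- = ‖a‖ / 2`, and the Lipschitz constant is at most `3 * m`.
  have hev := hst.isLittleO.def (half_pos ha0)
  rw [nhds_prod_eq, ← nhds_prod_eq] at hev
  obtain ⟨ρ₁, hρ₁, h₁⟩ := Metric.eventually_nhds_iff_ball.1 hev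
  obtain ⟨ρ₂, hρ₂, h₂⟩ := Metric.isOpen_iff.1 hV p hpV
  have hb : ∀ x ∈ Metric.ball p (min ρ₁ ρ₂), ∀ y ∈ Metric.ball p (min ρ₁ ρ₂),
      |f x - f y - inner ℝ a (x - y)| ≤ ‖a‖ / 2 * ‖x - y‖ := fun x hx y hy => by
    have := h₁ (x, y) (by
      rw [Metric.mem_ball, Prod.dist_eq]
      exact max_lt (lt_of_lt_of_le hx (min_le_left _ _)) (lt_of_lt_of_le hy (min_le_left _ _)))
    rwa [hL, Real.norm_eq_abs] at this
  refine ⟨f, ‖a‖⁻¹ • a, ‖a‖ / 2, min ρ₁ ρ₂, ?_, half_pos ha0, lt_min hρ₁ hρ₂, ?_, ?_, ?_, ?_⟩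
  · rw [norm_smul, norm_inv, norm_norm, inv_mul_cancel₀ ha0.ne']
  · exact fun x hx => hfΩ x (h₂ (Metric.ball_subset_ball (min_le_right _ _) hx))
  · intro q hq
    have hqV : q ∈ V := h₂ (Metric.ball_subset_ball (min_le_right _ _) hq.2)
    refine eq_zero_of_mem_frontier hO hq.1 (hfa q hqV).continuousAt ?_
    filter_upwards [hV.mem_nhds hqV] with x hx using hfΩ x hx
  · intro x hx y hy
    have h1 := hb x hx y hy
    have h2 := abs_real_inner_le_norm a (x - y)
    rw [dist_eq_norm]
    calc |f x - f y| = |(f x - f y - inner ℝ a (x - y)) + inner ℝ a (x - y)| := by ring_nf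
      _ ≤ _ := abs_add_le _ _
      _ ≤ ‖a‖ / 2 * ‖x - y‖ + ‖a‖ * ‖x - y‖ := add_le_add h1 h2
      _ = _ := by ring
  · intro x hx t ht hxt
    have h1 := (abs_le.1 (hb _ hxt x hx)).1
    rw [add_sub_cancel_left, inner_smul_right, inner_smul_right, real_inner_self_eq_norm_sq,
      norm_smul, norm_smul, norm_inv, norm_norm, inv_mul_cancel₀ ha0.ne', mul_one,
      Real.norm_of_nonneg ht] at h1
    have h2 : t * (‖a‖⁻¹ * ‖a‖ ^ 2) = ‖a‖ * t := by field_simp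
    rw [h2] at h1
    linarith

/-- The tube of radius `r` around a piece of the boundary has volume `O(r)`: translates of the tube
in a transversal direction are disjoint. -/
lemma HasC3HolderBoundary.exists_local_tube_le {α : ℝ≥0} {Ω : Set 𝔼}
    (hΩ : HasC3HolderBoundary α Ω) (hO : IsOpen Ω) {p : 𝔼} (hp : p ∈ frontier Ω) :
    ∃ ρ C : ℝ, 0 < ρ ∧ 0 ≤ C ∧ ∀ r : ℝ, 0 < r →
      volume.real ({x | |signedDistBoundary Ω x| ≤ r} ∩ Metric.ball p ρ) ≤ C * r := by
  obtain ⟨f, e, m, ρ, he, hm, hρ, -, hf0, hlip, hinc⟩ := hΩ.exists_increasing hO hp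
  set v := volume.real (Metric.ball p ρ) with hv
  have hv0 : 0 ≤ v := measureReal_nonneg
  refine ⟨ρ / 2, 14 * v / ρ, half_pos hρ, by positivity, fun r hr => ?_⟩
  set A := {x | |signedDistBoundary Ω x| ≤ r} ∩ Metric.ball p (ρ / 2) with hA
  have hAρ : A ⊆ Metric.ball p ρ :=
    inter_subset_right.trans (Metric.ball_subset_ball (half_le_self hρ.le))
  by_cases hr2 : ρ / 2 ≤ r
  · calc volume.real A ≤ v := measureReal_mono hAρ measure_ball_lt_top.ne
      _ ≤ 14 * v / ρ * r := by
        rw [div_mul_eq_mul_div, le_div_iff₀ hρ]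
        nlinarith
  rw [not_le] at hr2
  have hAm : MeasurableSet A :=
    ((isClosed_le (continuous_signedDist Ω).abs continuous_const).measurableSet).inter
      measurableSet_ball
  have hfA : ∀ x ∈ A, |f x| ≤ 3 * m * r := fun x hx => by
    obtain ⟨q, hq, hd⟩ := exists_frontier_dist_eq ⟨p, hp⟩ x
    have hqρ : q ∈ Metric.ball p ρ := by
      have h1 : dist x p < ρ / 2 := hx.2
      have h2 : dist x q ≤ r := hd ▸ hx.1
      have := dist_triangle q x p
      rw [dist_comm q x] at this
      rw [Metric.mem_ball]; linarith
    have := hlip x (hAρ hx) q hqρ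
    rw [hf0 q ⟨hq, hqρ⟩, sub_zero, hd] at this
    exact this.trans (mul_le_mul_of_nonneg_left hx.1 (by positivity))
  -- On `A` the values of `f` lie in an interval of length `6 * m * r`, whereas a translation by `7
  -- * r` along `e` raises `f` by at least `7 * m * r`. The translates are thus disjoint, and at
  -- least `ρ / (14 * r)` of them fit into the ball.
  set N := ⌊ρ / 2 / (7 * r)⌋₊ + 1 with hN
  have hNle : ρ / 2 / (7 * r) ≤ N := by
    rw [hN]; push_cast; exact (Nat.lt_floor_add_one _).le
  let B : ℕ → Set 𝔼 := fun k => (fun x => x + (-(k * (7 * r))) • e) ⁻¹' A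
  have hBm : ∀ k, MeasurableSet (B k) := fun k => (measurable_add_const _) hAm
  have hBv : ∀ k, volume.real (B k) = volume.real A := fun k => by
    simp only [measureReal_def, B, measure_preimage_add_right]
  have hk : ∀ k ∈ Finset.range N, (k : ℝ) * (7 * r) ≤ ρ / 2 := fun k hk => by
    have h1 : k ≤ ⌊ρ / 2 / (7 * r)⌋₊ := Nat.lt_succ_iff.1 (Finset.mem_range.1 hk)
    have h2 : (k : ℝ) ≤ ρ / 2 / (7 * r) := (Nat.le_floor_iff (by positivity)).1 h1
    rwa [le_div_iff₀ (by positivity)] at h2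
  have hBsub : ∀ k ∈ Finset.range N, B k ⊆ Metric.ball p ρ := fun k hkN x hx => by
    have h1 : dist (x + (-(k * (7 * r))) • e) p < ρ / 2 := hx.2
    have h2 : dist x (x + (-(k * (7 * r))) • e) ≤ ρ / 2 := by
      rw [dist_eq_norm, sub_add_cancel_left, norm_neg, norm_smul, he, mul_one, norm_neg,
        Real.norm_of_nonneg (by positivity)]
      exact hk k hkN
    have := dist_triangle x (x + (-(k * (7 * r))) • e) p
    rw [Metric.mem_ball]; linarith
  have hdisj' : ∀ j k : ℕ, j < k → Disjoint (B j) (B k) := fun j k hjk => by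
    rw [Set.disjoint_left]
    intro x hxj hxk
    have hxj' : x + (-(j * (7 * r))) • e ∈ A := hxj
    have hxk' : x + (-(k * (7 * r))) • e ∈ A := hxk
    have hjk' : (1 : ℝ) ≤ k - j := by
      have : (j : ℝ) + 1 ≤ k := by exact_mod_cast hjk
      linarith
    have e1 : x + (-(k * (7 * r))) • e + ((k - j) * (7 * r)) • e = x + (-(j * (7 * r))) • e := by
      rw [add_assoc, ← add_smul]; ring_nf
    have h1 := hinc _ (hAρ hxk') ((k - j) * (7 * r)) (by positivity) (by rw [e1]; exact hAρ hxj')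
    rw [e1] at h1
    have h2 := (abs_le.1 (hfA _ hxj')).2
    have h3 := (abs_le.1 (hfA _ hxk')).1
    have h4 : m * (1 * (7 * r)) ≤ m * ((k - j) * (7 * r)) := by gcongr
    nlinarith [mul_pos hm hr]
  have hdisj : (↑(Finset.range N) : Set ℕ).PairwiseDisjoint B := fun j _ k _ hjk => by
    rcases lt_or_gt_of_ne hjk with h | h
    · exact hdisj' j k h
    · exact (hdisj' k j h).symm
  have hsum := measureReal_biUnion_finset (μ := (volume : Measure 𝔼)) hdisj (fun k _ => hBm k)
    (fun k hkN => (measure_mono (hBsub k hkN)).trans_lt measure_ball_lt_top |>.ne)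
  simp only [hBv, Finset.sum_const, Finset.card_range, nsmul_eq_mul] at hsum
  have hle : (N : ℝ) * volume.real A ≤ v := by
    rw [← hsum]
    exact measureReal_mono (iUnion₂_subset hBsub) measure_ball_lt_top.ne
  have h0 : 0 ≤ volume.real A := measureReal_nonneg
  have h1 : ρ / 2 / (7 * r) * volume.real A ≤ v :=
    (mul_le_mul_of_nonneg_right hNle h0).trans hle
  rw [div_div, div_mul_eq_mul_div, div_le_iff₀ (by positivity)] at h1
  rw [div_mul_eq_mul_div, le_div_iff₀ hρ]
  linarith

/-- The tube of radius `r` around the boundary has volume `O(r)` for small `r`, and at most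
polynomial volume for large `r`. -/
lemma HasC3HolderBoundary.exists_tube_le {α : ℝ≥0} {Ω : Set 𝔼}
    (hΩ : HasC3HolderBoundary α Ω) (hR : IsBoundedRegion Ω) (hne : (frontier Ω).Nonempty) :
    ∃ C : ℝ, 0 ≤ C ∧ ∀ r : ℝ, 0 < r →
      volume {x | |signedDistBoundary Ω x| ≤ r} ≤ ENNReal.ofReal (C * (r * (1 + r) ^ d)) := by
  have hcomp : IsCompact (frontier Ω) :=
    Metric.isCompact_of_isClosed_isBounded isClosed_frontier
      (hR.isBounded.closure.subset frontier_subset_closure)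
  obtain ⟨R, hRpos, hRsub⟩ := hcomp.isBounded.subset_closedBall_lt 0 0
  have hsub : ∀ r, {x | |signedDistBoundary Ω x| ≤ r} ⊆ Metric.closedBall 0 (R + r) := fun r x hx => by
    obtain ⟨q, hq, hd⟩ := exists_frontier_dist_eq hne x
    have h1 := mem_closedBall_zero_iff.1 (hRsub hq)
    have hx' : |signedDistBoundary Ω x| ≤ r := hx
    rw [mem_closedBall_zero_iff]
    have h2 : ‖x‖ ≤ ‖x - q‖ + ‖q‖ := by simpa using norm_add_le (x - q) q
    rw [← dist_eq_norm, hd] at h2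
    linarith
  have hfin : ∀ r, volume {x | |signedDistBoundary Ω x| ≤ r} ≠ ⊤ := fun r =>
    (measure_mono (hsub r)).trans_lt measure_closedBall_lt_top |>.ne
  choose! ρ C hρ hC hloc using fun p (hp : p ∈ frontier Ω) => hΩ.exists_local_tube_le hR.isOpen hp
  obtain ⟨F, hF, hcov⟩ := hcomp.elim_nhds_subcover (fun p => Metric.ball p (ρ p))
    (fun p hp => Metric.ball_mem_nhds p (hρ p hp))
  obtain ⟨r₀, hr₀, hthick⟩ := hcomp.exists_thickening_subset_open
    (isOpen_biUnion fun p (_ : p ∈ F) => Metric.isOpen_ball) hcov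
  set v := volume.real (Metric.ball (0 : 𝔼) 1)
  have hv : 0 ≤ v := measureReal_nonneg
  have hCsum : 0 ≤ ∑ p ∈ F, C p := Finset.sum_nonneg fun p hp => hC p (hF p hp)
  refine ⟨∑ p ∈ F, C p + (R + 1) ^ d * v / r₀, by positivity, fun r hr => ?_⟩
  refine (ENNReal.le_ofReal_iff_toReal_le (hfin r) (by positivity)).2 ?_
  change volume.real _ ≤ _
  have hpow : 1 ≤ (1 + r) ^ d := one_le_pow₀ (by linarith)
  by_cases hrr : r < r₀
  · have h1 : {x | |signedDistBoundary Ω x| ≤ r} ⊆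
        ⋃ p ∈ F, ({x | |signedDistBoundary Ω x| ≤ r} ∩ Metric.ball p (ρ p)) := by
      intro x hx
      obtain ⟨q, hq, hd⟩ := exists_frontier_dist_eq hne x
      have hx' : |signedDistBoundary Ω x| ≤ r := hx
      have := hthick (Metric.mem_thickening_iff.2 ⟨q, hq, by rw [hd]; linarith⟩)
      simp only [mem_iUnion, exists_prop] at this ⊢
      obtain ⟨p, hp, hxp⟩ := this
      exact ⟨p, hp, hx, hxp⟩
    calc volume.real {x | |signedDistBoundary Ω x| ≤ r}
        ≤ volume.real (⋃ p ∈ F, ({x | |signedDistBoundary Ω x| ≤ r} ∩ Metric.ball p (ρ p))) :=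
          measureReal_mono h1 (measure_mono (iUnion₂_subset fun p _ => inter_subset_left)
            |>.trans_lt (hfin r).lt_top |>.ne)
      _ ≤ ∑ p ∈ F, volume.real ({x | |signedDistBoundary Ω x| ≤ r} ∩ Metric.ball p (ρ p)) :=
          measureReal_biUnion_finset_le _ _
      _ ≤ ∑ p ∈ F, C p * r := Finset.sum_le_sum fun p hp => hloc p (hF p hp) r hr
      _ = (∑ p ∈ F, C p) * (r * 1) := by rw [mul_one, Finset.sum_mul]
      _ ≤ (∑ p ∈ F, C p + (R + 1) ^ d * v / r₀) * (r * (1 + r) ^ d) := by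
          gcongr
          exact le_add_of_nonneg_right (by positivity)
  -- For wide tubes the volume of an enclosing ball suffices; the factor `r / r₀ ≥ 1` brings it to
  -- the common form.
  · rw [not_lt] at hrr
    have h1 : 1 ≤ r / r₀ := (one_le_div hr₀).2 hrr
    calc volume.real {x | |signedDistBoundary Ω x| ≤ r}
        ≤ volume.real (Metric.closedBall (0 : 𝔼) (R + r)) :=
          measureReal_mono (hsub r) measure_closedBall_lt_top.ne
      _ = (R + r) ^ d * v := by
          rw [Measure.addHaar_real_closedBall _ _ (by positivity), finrank_euclideanSpace_fin]
      _ ≤ ((R + 1) * (1 + r)) ^ d * v := by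
          gcongr
          nlinarith
      _ ≤ ((R + 1) * (1 + r)) ^ d * v * (r / r₀) := le_mul_of_one_le_right (by positivity) h1
      _ = (R + 1) ^ d * v / r₀ * (r * (1 + r) ^ d) := by rw [mul_pow]; ring
      _ ≤ _ := by
          gcongr
          exact le_add_of_nonneg_left hCsum

lemma HasC3HolderBoundary.volume_frontier {α : ℝ≥0} {Ω : Set 𝔼}
    (hΩ : HasC3HolderBoundary α Ω) (hR : IsBoundedRegion Ω) (hne : (frontier Ω).Nonempty) :
    volume (frontier Ω) = 0 := by
  obtain ⟨C, -, hC⟩ := hΩ.exists_tube_le hR hne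
  have h1 : ∀ᶠ r : ℝ in 𝓝[>] 0, volume (frontier Ω) ≤ ENNReal.ofReal (C * (r * (1 + r) ^ d)) := by
    filter_upwards [self_mem_nhdsWithin] with r hr
    refine le_trans (measure_mono fun x hx => ?_) (hC r hr)
    have hr' : (0 : ℝ) < r := hr
    rw [mem_ofPred_eq, signedDist_eq_zero_of_mem_frontier hx, abs_zero]
    exact hr'.le
  have h2 : Continuous fun r : ℝ => ENNReal.ofReal (C * (r * (1 + r) ^ d)) :=
    ENNReal.continuous_ofReal.comp (by fun_prop)
  have h3 := (h2.tendsto 0).mono_left (nhdsWithin_le_nhds (s := Ioi 0))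
  simp only [zero_mul, mul_zero, ENNReal.ofReal_zero] at h3
  exact le_antisymm (ge_of_tendsto h3 h1) bot_le

lemma HasC3HolderBoundary.ae_notMem_frontier {α : ℝ≥0} {Ω : Set 𝔼}
    (hΩ : HasC3HolderBoundary α Ω) (hR : IsBoundedRegion Ω) (hne : (frontier Ω).Nonempty) :
    ∀ᵐ x : 𝔼, x ∉ frontier Ω :=
  measure_eq_zero_iff_ae_notMem.1 (hΩ.volume_frontier hR hne)

/-- If every point of `Q` reaches `S` in fewer than `N` steps, then `|Q| ≤ N |S|`. -/
lemma volume_le_mul_of_reaches {Q S : Set 𝔼} {v : 𝔼} {N : ℕ}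
    (h : ∀ x ∈ Q, ∃ j < N, x + (j : ℝ) • v ∈ S) : volume Q ≤ N * volume S := by
  have hsub : Q ⊆ ⋃ j ∈ Finset.range N, (fun x => x + (j : ℝ) • v) ⁻¹' S := fun x hx => by
    obtain ⟨j, hj, hxj⟩ := h x hx
    simp only [mem_iUnion, exists_prop]
    exact ⟨j, Finset.mem_range.2 hj, hxj⟩
  calc volume Q ≤ volume (⋃ j ∈ Finset.range N, (fun x => x + (j : ℝ) • v) ⁻¹' S) :=
        measure_mono hsub
    _ ≤ ∑ j ∈ Finset.range N, volume ((fun x => x + (j : ℝ) • v) ⁻¹' S) :=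
        measure_biUnion_finset_le _ _
    _ = _ := by simp [measure_preimage_add_right]

/-- Near a boundary point, the collars on both sides have volume at least of the order of their
width. -/
lemma HasC3HolderBoundary.exists_le_collar {α : ℝ≥0} {Ω : Set 𝔼}
    (hΩ : HasC3HolderBoundary α Ω) (hO : IsOpen Ω) {p : 𝔼} (hp : p ∈ frontier Ω) {σ : ℝ}
    (hσ : 0 < σ) :
    ∃ c r₀ : ℝ, 0 < c ∧ 0 < r₀ ∧ ∀ r : ℝ, 0 < r → r ≤ r₀ →
      c * r ≤ volume.real ({x | |signedDistBoundary Ω x| ≤ r} ∩ Metric.ball p σ ∩ Ω) ∧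
      c * r ≤ volume.real ({x | |signedDistBoundary Ω x| ≤ r} ∩ Metric.ball p σ ∩ Ωᶜ) := by
  obtain ⟨f, e, m, ρ, he, hm, hρ, hfΩ, hf0, hlip, hinc⟩ := hΩ.exists_increasing hO hp
  set t := min ρ σ / 2 with ht
  have ht0 : 0 < t := half_pos (lt_min hρ hσ)
  have htρ : 2 * t ≤ ρ := by rw [ht]; linarith [min_le_left ρ σ]
  have htσ : 2 * t ≤ σ := by rw [ht]; linarith [min_le_right ρ σ]
  -- A ball of starting points. By the centre, `f` is at most `-m * t`, and over the radius `t / 4`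
  -- it varies by less than `3 * m * t / 4`, so all of `Q` is inside; for the same reason the
  -- translate of `Q` by `2 * t` is outside.
  set Q := Metric.ball (p - t • e) (t / 4) with hQ
  have hQpos : 0 < volume.real Q := by
    rw [measureReal_def]
    exact ENNReal.toReal_pos (Metric.measure_ball_pos _ _ (by positivity)).ne'
      measure_ball_lt_top.ne
  -- the part of the line through a point of `Q` that stays close to `p`
  have hline : ∀ x ∈ Q, ∀ τ ∈ Icc (0 : ℝ) (2 * t), x + τ • e ∈ Metric.ball p (2 * t) :=
    fun x hx τ hτ => by
      have h1 : dist x (p - t • e) < t / 4 := hx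
      rw [dist_eq_norm] at h1
      rw [Metric.mem_ball, dist_eq_norm,
        show x + τ • e - p = (x - (p - t • e)) + (τ - t) • e by rw [sub_smul]; abel]
      have h2 : ‖(τ - t) • e‖ ≤ t := by
        rw [norm_smul, he, mul_one, Real.norm_eq_abs, abs_le]
        constructor <;> linarith [hτ.1, hτ.2]
      linarith [norm_add_le (x - (p - t • e)) ((τ - t) • e)]
  have hp0 : f p = 0 := hf0 p ⟨hp, Metric.mem_ball_self hρ⟩
  have hpm : p - t • e ∈ Metric.ball p ρ := by
    rw [Metric.mem_ball, dist_eq_norm, sub_sub_cancel_left, norm_neg, norm_smul, he, mul_one,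
      Real.norm_of_nonneg ht0.le]
    linarith
  have hpp : p + t • e ∈ Metric.ball p ρ := by
    rw [Metric.mem_ball, dist_eq_norm, add_sub_cancel_left, norm_smul, he, mul_one,
      Real.norm_of_nonneg ht0.le]
    linarith
  have hstart : ∀ x ∈ Q, x ∈ Ω := fun x hx => by
    have hxρ : x ∈ Metric.ball p ρ := by
      have := hline x hx 0 ⟨le_rfl, by positivity⟩
      rw [zero_smul, add_zero] at this
      exact Metric.ball_subset_ball htρ this
    have h1 := hinc _ hpm t ht0.le (by simpa using hρ)
    rw [sub_add_cancel, hp0] at h1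
    have h2 := (abs_le.1 (hlip x hxρ _ hpm)).2
    have h3 : dist x (p - t • e) < t / 4 := hx
    rw [hfΩ x hxρ]
    nlinarith [mul_pos hm ht0, mul_lt_mul_of_pos_left h3 hm]
  have hend : ∀ x ∈ Q, x + (2 * t) • e ∉ Ω := fun x hx => by
    have hxρ : x + (2 * t) • e ∈ Metric.ball p ρ :=
      Metric.ball_subset_ball htρ (hline x hx _ ⟨by positivity, le_rfl⟩)
    have h1 := hinc p (Metric.mem_ball_self hρ) t ht0.le hpp
    rw [hp0] at h1
    have h2 := (abs_le.1 (hlip _ hxρ _ hpp)).1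
    have h3 : dist (x + (2 * t) • e) (p + t • e) < t / 4 := by
      have h3 : dist x (p - t • e) < t / 4 := hx
      rw [dist_eq_norm] at h3 ⊢
      rwa [show x + (2 * t) • e - (p + t • e) = x - (p - t • e) by rw [two_mul, add_smul]; abel]
    rw [hfΩ _ hxρ]
    nlinarith [mul_pos hm ht0, mul_lt_mul_of_pos_left h3 hm]
  refine ⟨volume.real Q / (4 * t), t, by positivity, ht0, fun r hr hrt => ?_⟩
  set N := ⌈2 * t / r⌉₊ with hN
  have hNpos : 0 < N := Nat.ceil_pos.2 (by positivity)
  have hNpos' : (0 : ℝ) < N := Nat.cast_pos.2 hNpos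
  have hNr : 2 * t / N ≤ r := by
    rw [div_le_iff₀ hNpos', mul_comm r, ← div_le_iff₀ hr]
    exact Nat.le_ceil _
  have hNle : (N + 1 : ℝ) * r ≤ 4 * t := by
    have h1 := (Nat.ceil_lt_add_one (show 0 ≤ 2 * t / r by positivity)).le
    have h2 : (N + 1 : ℝ) * r ≤ (2 * t / r + 1 + 1) * r := by gcongr
    rw [add_mul (2 * t / r + 1), add_mul (2 * t / r), div_mul_cancel₀ _ hr.ne'] at h2
    linarith
  -- The first exit along the discretized line. The steps have length at most `r`, so the last point
  -- inside and the first point outside both lie in the collar of width `r`.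
  have hstep : ∀ x ∈ Q, ∃ j < N, x + (j : ℝ) • (2 * t / N) • e ∈ Ω ∧
      x + ((j + 1 : ℕ) : ℝ) • (2 * t / N) • e ∉ Ω := fun x hx => by
    classical
    have hex : ∃ j : ℕ, x + (j : ℝ) • (2 * t / N) • e ∉ Ω := ⟨N, by
      rw [smul_smul, mul_div_cancel₀ _ hNpos'.ne']
      exact hend x hx⟩
    have hle : Nat.find hex ≤ N := Nat.find_min' hex (by
      rw [smul_smul, mul_div_cancel₀ _ hNpos'.ne']
      exact hend x hx)
    have hne0 : Nat.find hex ≠ 0 := fun h => by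
      have := Nat.find_spec hex
      rw [h, Nat.cast_zero, zero_smul, add_zero] at this
      exact this (hstart x hx)
    obtain ⟨j, hj⟩ := Nat.exists_eq_succ_of_ne_zero hne0
    refine ⟨j, by omega, ?_, ?_⟩
    · have := Nat.find_min hex (show j < Nat.find hex by omega)
      rwa [not_not] at this
    · have := Nat.find_spec hex
      rwa [hj] at this
  have hnear : ∀ x ∈ Q, ∀ j : ℕ, j ≤ N →
      x + (j : ℝ) • (2 * t / N) • e ∈ Metric.ball p σ := fun x hx j hj => by
    refine Metric.ball_subset_ball htσ ?_
    rw [smul_smul]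
    refine hline x hx _ ⟨by positivity, ?_⟩
    rw [mul_div_assoc', div_le_iff₀ hNpos', mul_comm]
    gcongr
  have hdist : ∀ (x : 𝔼) (j : ℕ), dist (x + (j : ℝ) • (2 * t / N) • e)
      (x + ((j + 1 : ℕ) : ℝ) • (2 * t / N) • e) ≤ r := fun x j => by
    rw [dist_eq_norm, add_sub_add_left_eq_sub, ← sub_smul]
    push_cast
    rw [sub_add_cancel_left, neg_smul, one_smul, norm_neg, norm_smul, he, mul_one,
      Real.norm_of_nonneg (by positivity)]
    exact hNr
  have hfin : ∀ S : Set 𝔼, volume ({x | |signedDistBoundary Ω x| ≤ r} ∩ Metric.ball p σ ∩ S) ≠ ⊤ :=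
    fun S => (measure_mono (inter_subset_left.trans inter_subset_right)).trans_lt
      measure_ball_lt_top |>.ne
  have hconcl : ∀ (S : Set 𝔼) (M : ℕ), (M : ℝ) ≤ N + 1 →
      volume Q ≤ M * volume ({x | |signedDistBoundary Ω x| ≤ r} ∩ Metric.ball p σ ∩ S) →
      volume.real Q / (4 * t) * r ≤
        volume.real ({x | |signedDistBoundary Ω x| ≤ r} ∩ Metric.ball p σ ∩ S) := by
    intro S M hM h
    have h1 := ENNReal.toReal_mono (ENNReal.mul_ne_top (ENNReal.natCast_ne_top M) (hfin S)) h
    rw [ENNReal.toReal_mul, ENNReal.toReal_natCast, ← measureReal_def, ← measureReal_def] at h1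
    rw [div_mul_eq_mul_div, div_le_iff₀ (by positivity)]
    set V := volume.real ({x | |signedDistBoundary Ω x| ≤ r} ∩ Metric.ball p σ ∩ S)
    have hV : 0 ≤ V := measureReal_nonneg
    calc volume.real Q * r ≤ (M * V) * r := by gcongr
      _ ≤ ((N + 1) * V) * r := by gcongr
      _ = V * ((N + 1) * r) := by ring
      _ ≤ V * (4 * t) := by gcongr
  constructor
  · refine hconcl Ω N (by linarith) (volume_le_mul_of_reaches (v := (2 * t / N) • e) fun x hx => ?_)
    obtain ⟨j, hj, h1, h2⟩ := hstep x hx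
    refine ⟨j, hj, ⟨?_, hnear x hx j hj.le⟩, h1⟩
    rw [mem_ofPred_eq, signedDist_of_mem h1, abs_neg, abs_of_nonneg Metric.infDist_nonneg]
    exact (Metric.infDist_le_dist_of_mem h2).trans (hdist x j)
  -- The exit point has index `j + 1`, which may equal `N`, hence one more translate.
  · refine hconcl Ωᶜ (N + 1) (by push_cast; rfl)
      (volume_le_mul_of_reaches (v := (2 * t / N) • e) fun x hx => ?_)
    obtain ⟨j, hj, h1, h2⟩ := hstep x hx
    refine ⟨j + 1, by omega, ⟨?_, hnear x hx (j + 1) (by omega)⟩, h2⟩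
    rw [mem_ofPred_eq, signedDist_of_notMem h2, abs_of_nonneg Metric.infDist_nonneg]
    refine (Metric.infDist_le_dist_of_mem h1).trans ?_
    rw [dist_comm]
    exact hdist x j

end Collar

section ExponentialDecay

/-! ### Integrals of functions that decay exponentially off the boundary -/

/-- Split space into the layers `j ≤ |s| / r < j + 1`. Layer `j` lies in a tube of width `(j + 1)
r`, and `r ≤ 1` bounds its volume by `r` times a power of `j + 2` independent of `r`; the
exponential makes the series converge. -/
lemma HasC3HolderBoundary.lintegral_exp_le {α : ℝ≥0} {Ω : Set 𝔼}
    (hΩ : HasC3HolderBoundary α Ω) (hR : IsBoundedRegion Ω) (hne : (frontier Ω).Nonempty)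
    {c : ℝ} (hc : 0 < c) :
    ∃ C : ℝ, 0 ≤ C ∧ ∀ r : ℝ, 0 < r → r ≤ 1 →
      ∫⁻ x, ENNReal.ofReal (Real.exp (-(c * (|signedDistBoundary Ω x| / r)))) ≤
        ENNReal.ofReal (C * r) := by
  obtain ⟨C, hC, htube⟩ := hΩ.exists_tube_le hR hne
  have hsum : Summable fun j : ℕ => Real.exp (-(c * j)) * (j + 2) ^ (d + 1) := by
    have h1 := (summable_nat_add_iff 2).2 (Real.summable_pow_mul_exp_neg_nat_mul (d + 1) hc)
    refine (h1.mul_left (Real.exp (2 * c))).congr fun j => ?_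
    rw [mul_left_comm, ← Real.exp_add, mul_comm]
    push_cast
    ring_nf
  have hnn : ∀ j : ℕ, 0 ≤ Real.exp (-(c * j)) * (j + 2) ^ (d + 1) := fun j => by positivity
  refine ⟨C * ∑' j : ℕ, Real.exp (-(c * j)) * (j + 2) ^ (d + 1),
    mul_nonneg hC (tsum_nonneg hnn), fun r hr hr1 => ?_⟩
  set T : ℕ → Set 𝔼 := fun j => {x | |signedDistBoundary Ω x| ≤ (j + 1) * r} with hT
  have hTm : ∀ j, MeasurableSet (T j) := fun j =>
    (isClosed_le (continuous_signedDist Ω).abs continuous_const).measurableSet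
  calc ∫⁻ x, ENNReal.ofReal (Real.exp (-(c * (|signedDistBoundary Ω x| / r))))
      ≤ ∫⁻ x, ∑' j : ℕ, (T j).indicator (fun _ => ENNReal.ofReal (Real.exp (-(c * j)))) x := by
        refine lintegral_mono fun x => ?_
        refine le_trans ?_ (ENNReal.le_tsum ⌊|signedDistBoundary Ω x| / r⌋₊)
        have h0 : 0 ≤ |signedDistBoundary Ω x| / r := by positivity
        rw [indicator_of_mem]
        · refine ENNReal.ofReal_le_ofReal (Real.exp_le_exp.2 (neg_le_neg ?_))
          exact mul_le_mul_of_nonneg_left (Nat.floor_le h0) hc.le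
        · exact (div_le_iff₀ hr).1 (Nat.lt_floor_add_one _).le
    _ = ∑' j : ℕ, ENNReal.ofReal (Real.exp (-(c * j))) * volume (T j) := by
        rw [lintegral_tsum fun j => (measurable_const.indicator (hTm j)).aemeasurable]
        simp only [lintegral_indicator_const (hTm _)]
    _ ≤ ∑' j : ℕ, ENNReal.ofReal (C * r * (Real.exp (-(c * j)) * (j + 2) ^ (d + 1))) := by
        refine ENNReal.tsum_le_tsum fun j => ?_
        refine (mul_le_mul_right (htube ((j + 1) * r) (by positivity)) _).trans ?_
        rw [← ENNReal.ofReal_mul (Real.exp_pos _).le]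
        refine ENNReal.ofReal_le_ofReal ?_
        have h1 : (1 + (j + 1) * r) ^ d ≤ ((j : ℝ) + 2) ^ d := by
          have hj : (0 : ℝ) ≤ j := j.cast_nonneg
          exact pow_le_pow_left₀ (by positivity) (by nlinarith) d
        calc Real.exp (-(c * j)) * (C * ((j + 1) * r * (1 + (j + 1) * r) ^ d))
            ≤ Real.exp (-(c * j)) * (C * ((j + 2) * r * ((j : ℝ) + 2) ^ d)) := by
              gcongr
              norm_num
          _ = _ := by ring
    _ = ENNReal.ofReal (∑' j : ℕ, C * r * (Real.exp (-(c * j)) * (j + 2) ^ (d + 1))) :=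
        (ENNReal.ofReal_tsum_of_nonneg (fun j => mul_nonneg (by positivity) (hnn j))
          (hsum.mul_left _)).symm
    _ = _ := by rw [tsum_mul_left]; ring_nf

lemma continuous_exp_signedDist (Ω : Set 𝔼) (c r : ℝ) :
    Continuous fun x => Real.exp (-(c * (|signedDistBoundary Ω x| / r))) :=
  Real.continuous_exp.comp
    (continuous_const.mul ((continuous_signedDist Ω).abs.div_const r)).neg

/-- Integrability needs no restriction `r ≤ 1`: absorb `r` into the rate and use the estimate at
width 1. -/
lemma HasC3HolderBoundary.integrable_exp {α : ℝ≥0} {Ω : Set 𝔼}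
    (hΩ : HasC3HolderBoundary α Ω) (hR : IsBoundedRegion Ω) (hne : (frontier Ω).Nonempty)
    {c r : ℝ} (hc : 0 < c) (hr : 0 < r) :
    Integrable fun x => Real.exp (-(c * (|signedDistBoundary Ω x| / r))) := by
  obtain ⟨C, -, h⟩ := hΩ.lintegral_exp_le hR hne (div_pos hc hr)
  refine ⟨(continuous_exp_signedDist Ω c r).aestronglyMeasurable, ?_⟩
  rw [hasFiniteIntegral_iff_ofReal (Eventually.of_forall fun x => (Real.exp_pos _).le)]
  refine lt_of_le_of_lt (le_of_eq ?_) ((h 1 one_pos le_rfl).trans_lt ENNReal.ofReal_lt_top)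
  congr with x
  congr 3
  rw [div_one]
  ring

/-- Exponentially decaying moments of the distance to the boundary. -/
lemma HasC3HolderBoundary.integral_exp_moment_le {α : ℝ≥0} {Ω : Set 𝔼}
    (hΩ : HasC3HolderBoundary α Ω) (hR : IsBoundedRegion Ω) (hne : (frontier Ω).Nonempty)
    {c : ℝ} (hc : 0 < c) (k : ℕ) :
    ∃ C : ℝ, 0 ≤ C ∧ ∀ r : ℝ, 0 < r → r ≤ 1 →
      Integrable (fun x => Real.exp (-(c * (|signedDistBoundary Ω x| / r))) *
        |signedDistBoundary Ω x| ^ k) ∧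
      ∫ x, Real.exp (-(c * (|signedDistBoundary Ω x| / r))) * |signedDistBoundary Ω x| ^ k ≤
        C * r ^ (k + 1) := by
  obtain ⟨C, hC, h⟩ := hΩ.lintegral_exp_le hR hne (half_pos hc)
  -- `τ ^ k ≤ D * exp (c / 2 * τ)`
  set D := k.factorial / (c / 2) ^ k with hD
  have hD0 : 0 < D := by positivity
  have hpow : ∀ τ : ℝ, 0 ≤ τ → Real.exp (-(c * τ)) * τ ^ k ≤ D * Real.exp (-(c / 2 * τ)) :=
    fun τ hτ => by
      have h1 := Real.pow_div_factorial_le_exp (c / 2 * τ) (by positivity) k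
      have h2 : τ ^ k ≤ D * Real.exp (c / 2 * τ) := by
        rw [div_le_iff₀ (by positivity), mul_pow] at h1
        rw [hD, div_mul_eq_mul_div, le_div_iff₀ (by positivity)]
        linarith
      calc Real.exp (-(c * τ)) * τ ^ k ≤ Real.exp (-(c * τ)) * (D * Real.exp (c / 2 * τ)) := by
            gcongr
        _ = D * Real.exp (-(c / 2 * τ)) := by
            rw [mul_left_comm, ← Real.exp_add]; ring_nf
  refine ⟨D * C, by positivity, fun r hr hr1 => ?_⟩
  have hbound : ∀ x, Real.exp (-(c * (|signedDistBoundary Ω x| / r))) *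
      |signedDistBoundary Ω x| ^ k ≤
      r ^ k * D * Real.exp (-(c / 2 * (|signedDistBoundary Ω x| / r))) := fun x => by
    have h1 := hpow (|signedDistBoundary Ω x| / r) (by positivity)
    have h2 := mul_le_mul_of_nonneg_left h1 (pow_nonneg hr.le k)
    calc _ = r ^ k * (Real.exp (-(c * (|signedDistBoundary Ω x| / r))) *
        (|signedDistBoundary Ω x| / r) ^ k) := by rw [div_pow]; field_simp
      _ ≤ _ := h2
      _ = _ := by ring
  have hint := (hΩ.integrable_exp hR hne (half_pos hc) hr).const_mul (r ^ k * D)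
  have hintl : Integrable (fun x => Real.exp (-(c * (|signedDistBoundary Ω x| / r))) *
        |signedDistBoundary Ω x| ^ k) := by
    refine hint.mono' (((continuous_exp_signedDist Ω c r).mul
      ((continuous_signedDist Ω).abs.pow k)).aestronglyMeasurable)
      (Eventually.of_forall fun x => ?_)
    rw [Real.norm_of_nonneg (by positivity)]
    exact hbound x
  refine ⟨hintl, ?_⟩
  refine (integral_mono hintl hint hbound).trans ?_
  rw [integral_const_mul, integral_eq_lintegral_of_nonneg_ae
    (Eventually.of_forall fun x => (Real.exp_pos _).le)
    (continuous_exp_signedDist Ω _ r).aestronglyMeasurable]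
  have h1 := ENNReal.toReal_le_of_le_ofReal (by positivity) (h r hr hr1)
  calc _ ≤ r ^ k * D * (C * r) := by gcongr
    _ = _ := by ring

end ExponentialDecay

section Divergence

/-! ### Divergence of Lipschitz vector fields and integration by parts -/

lemma divergence_sub {X Y : 𝔼 → 𝔼} {x : 𝔼} (hX : DifferentiableAt ℝ X x)
    (hY : DifferentiableAt ℝ Y x) :
    divergence (fun y => X y - Y y) x = divergence X x - divergence Y x := by
  simp [divergence, fderiv_fun_sub hX hY, Finset.sum_sub_distrib]

lemma Filter.EventuallyEq.divergence_eq {X Y : 𝔼 → 𝔼} {x : 𝔼} (h : X =ᶠ[𝓝 x] Y) :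
    divergence X x = divergence Y x := by
  simp [divergence, h.fderiv_eq]

lemma divergence_of_notMem_tsupport {X : 𝔼 → 𝔼} {x : 𝔼} (h : x ∉ tsupport X) :
    divergence X x = 0 := by
  simp [divergence, fderiv_of_notMem_tsupport (𝕜 := ℝ) h]

lemma abs_apply_le_norm (v : 𝔼) (i : Fin d) : |v i| ≤ ‖v‖ := by
  simpa using PiLp.norm_apply_le v i

lemma abs_divergence_le {X : 𝔼 → 𝔼} {K : ℝ≥0} (hX : LipschitzWith K X) (x : 𝔼) :
    |divergence X x| ≤ d * K := by
  have h1 : ∀ i, |fderiv ℝ X x (EuclideanSpace.single i 1) i| ≤ K := fun i => by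
    refine (abs_apply_le_norm _ i).trans ((ContinuousLinearMap.le_opNorm _ _).trans ?_)
    simpa using norm_fderiv_le_of_lipschitz ℝ hX
  calc |divergence X x| ≤ ∑ i, |fderiv ℝ X x (EuclideanSpace.single i 1) i| :=
        Finset.abs_sum_le_sum_abs _ _
    _ ≤ ∑ _i : Fin d, (K : ℝ) := Finset.sum_le_sum fun i _ => h1 i
    _ = d * K := by simp

lemma measurable_divergence (X : 𝔼 → 𝔼) : Measurable (divergence X) := by
  unfold divergence
  refine Finset.measurable_sum _ fun i _ => ?_
  exact (EuclideanSpace.proj (𝕜 := ℝ) i).continuous.measurable.comp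
    (measurable_fderiv_apply_const ℝ X _)

lemma measurable_gradient (f : 𝔼 → ℝ) : Measurable (gradient f) :=
  (InnerProductSpace.toDual ℝ 𝔼).symm.continuous.measurable.comp (measurable_fderiv ℝ f)

lemma norm_gradient_le {g : 𝔼 → ℝ} {K : ℝ≥0} (hg : LipschitzWith K g) (x : 𝔼) :
    ‖gradient g x‖ ≤ K := by
  rw [norm_gradient]
  exact norm_fderiv_le_of_lipschitz ℝ hg

lemma integrable_of_bound_on_compact {f : 𝔼 → ℝ} (hf : AEStronglyMeasurable f volume) {S : Set 𝔼}
    (hS : IsCompact S) (hsupp : ∀ x ∉ S, f x = 0) {C : ℝ} (hC : ∀ x ∈ S, |f x| ≤ C) :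
    Integrable f := by
  rw [← integrableOn_iff_integrable_of_support_subset (s := S)
    (fun x hx => by_contra fun h => hx (hsupp x h))]
  exact Measure.integrableOn_of_bounded hS.measure_lt_top.ne hf
    (ae_restrict_of_forall_mem hS.measurableSet hC)

lemma integrable_mul_divergence {X : 𝔼 → 𝔼} {g : 𝔼 → ℝ} {K : ℝ≥0} (hX : LipschitzWith K X)
    (hXc : HasCompactSupport X) (hg : Continuous g) :
    Integrable fun x => g x * divergence X x := by
  obtain ⟨C, hC⟩ := hXc.isCompact.exists_bound_of_continuousOn hg.continuousOn
  refine integrable_of_bound_on_compact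
    (hg.measurable.mul (measurable_divergence X)).aestronglyMeasurable hXc.isCompact
    (fun x hx => by rw [divergence_of_notMem_tsupport hx, mul_zero]) (C := C * (d * K))
    fun x hx => ?_
  rw [abs_mul]
  exact mul_le_mul (hC x hx) (abs_divergence_le hX x) (abs_nonneg _)
    ((norm_nonneg _).trans (hC x hx))

lemma integrable_inner_gradient {X : 𝔼 → 𝔼} {g : 𝔼 → ℝ} {L : ℝ≥0} (hX : Continuous X)
    (hXc : HasCompactSupport X) (hg : LipschitzWith L g) :
    Integrable fun x => inner ℝ (X x) (gradient g x) := by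
  obtain ⟨C, hC⟩ := hXc.isCompact.exists_bound_of_continuousOn hX.continuousOn
  refine integrable_of_bound_on_compact
    (hX.measurable.inner (measurable_gradient g)).aestronglyMeasurable hXc.isCompact
    (fun x hx => by rw [image_eq_zero_of_notMem_tsupport hx, inner_zero_left]) (C := C * L)
    fun x hx => ?_
  exact (abs_real_inner_le_norm _ _).trans (mul_le_mul (hC x hx) (norm_gradient_le hg x)
    (norm_nonneg _) ((norm_nonneg _).trans (hC x hx)))

lemma LipschitzWith.apply_coord {X : 𝔼 → 𝔼} {K : ℝ≥0} (hX : LipschitzWith K X) (i : Fin d) :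
    LipschitzWith K fun x => X x i :=
  LipschitzWith.of_dist_le_mul fun x y => by
    refine le_trans ?_ (hX.dist_le_mul x y)
    rw [Real.dist_eq, dist_eq_norm]
    exact abs_apply_le_norm (X x - X y) i

/-- Integration by parts for Lipschitz functions. -/
lemma integral_mul_divergence {X : 𝔼 → 𝔼} {g : 𝔼 → ℝ} {K L : ℝ≥0} (hX : LipschitzWith K X)
    (hXc : HasCompactSupport X) (hg : LipschitzWith L g) :
    ∫ x, g x * divergence X x = -∫ x, inner ℝ (X x) (gradient g x) := by
  have hsupp : ∀ i : Fin d, ∀ x ∉ tsupport X, X x i = 0 := fun i x hx => by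
    rw [image_eq_zero_of_notMem_tsupport hx]; rfl
  have hci : ∀ i : Fin d, HasCompactSupport fun x => X x i := fun i =>
    HasCompactSupport.intro hXc.isCompact (hsupp i)
  have hXd := hX.ae_differentiableAt (μ := (volume : Measure 𝔼))
  have hgd := hg.ae_differentiableAt (μ := (volume : Measure 𝔼))
  obtain ⟨C, hC⟩ := hXc.isCompact.exists_bound_of_continuousOn hg.continuous.continuousOn
  obtain ⟨D, hD⟩ := hXc.isCompact.exists_bound_of_continuousOn hX.continuous.continuousOn
  have hmeas : ∀ i : Fin d, Measurable fun x => fderiv ℝ X x (EuclideanSpace.single i 1) i :=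
    fun i => (EuclideanSpace.proj (𝕜 := ℝ) i).continuous.measurable.comp
      (measurable_fderiv_apply_const ℝ X _)
  have h1 : ∀ i : Fin d, ∫ x, g x * (fderiv ℝ X x (EuclideanSpace.single i 1)) i =
      -∫ x, X x i * fderiv ℝ g x (EuclideanSpace.single i 1) := fun i => by
    have h := LipschitzWith.integral_lineDeriv_mul_eq (μ := (volume : Measure 𝔼)) hg
      (hX.apply_coord i) (hci i) (EuclideanSpace.single i 1)
    rw [← integral_neg]
    have e1 : ∫ x, lineDeriv ℝ g x (EuclideanSpace.single i 1) * X x i =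
        ∫ x, X x i * fderiv ℝ g x (EuclideanSpace.single i 1) := by
      refine integral_congr_ae ?_
      filter_upwards [hgd] with x hx
      rw [hx.lineDeriv_eq_fderiv, mul_comm]
    have e2 : ∫ x, lineDeriv ℝ (fun x => X x i) x (-EuclideanSpace.single i 1) * g x =
        ∫ x, -(g x * (fderiv ℝ X x (EuclideanSpace.single i 1)) i) := by
      refine integral_congr_ae ?_
      filter_upwards [hXd] with x hx
      have h3 : HasFDerivAt (fun x => X x i)
          ((EuclideanSpace.proj (𝕜 := ℝ) i).comp (fderiv ℝ X x)) x :=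
        (EuclideanSpace.proj (𝕜 := ℝ) i).hasFDerivAt.comp x hx.hasFDerivAt
      rw [h3.differentiableAt.lineDeriv_eq_fderiv, h3.fderiv, map_neg, neg_mul, mul_comm]
      rfl
    rw [e1, e2, integral_neg] at h
    rw [integral_neg, h, neg_neg]
  have hint1 : ∀ i : Fin d,
      Integrable fun x => g x * (fderiv ℝ X x (EuclideanSpace.single i 1)) i := fun i => by
    refine integrable_of_bound_on_compact
      (hg.continuous.measurable.mul (hmeas i)).aestronglyMeasurable hXc.isCompact
      (fun x hx => by rw [fderiv_of_notMem_tsupport (𝕜 := ℝ) hx]; simp) (C := C * K) fun x hx => ?_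
    rw [abs_mul]
    refine mul_le_mul (hC x hx) ?_ (abs_nonneg _) ((norm_nonneg _).trans (hC x hx))
    refine (abs_apply_le_norm _ i).trans ((ContinuousLinearMap.le_opNorm _ _).trans ?_)
    simpa using norm_fderiv_le_of_lipschitz ℝ hX
  have hint2 : ∀ i : Fin d,
      Integrable fun x => X x i * fderiv ℝ g x (EuclideanSpace.single i 1) := fun i => by
    refine integrable_of_bound_on_compact
      ((hX.apply_coord i).continuous.measurable.mul
        (measurable_fderiv_apply_const ℝ g _)).aestronglyMeasurable hXc.isCompact
      (fun x hx => by rw [hsupp i x hx, zero_mul]) (C := D * L) fun x hx => ?_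
    rw [abs_mul]
    refine mul_le_mul ((abs_apply_le_norm _ i).trans (hD x hx)) ?_ (abs_nonneg _)
      ((norm_nonneg _).trans (hD x hx))
    refine (ContinuousLinearMap.le_opNorm (fderiv ℝ g x) _).trans ?_
    simpa using norm_fderiv_le_of_lipschitz ℝ hg
  have hinner : ∀ x, inner ℝ (X x) (gradient g x) =
      ∑ i, X x i * fderiv ℝ g x (EuclideanSpace.single i 1) := fun x => by
    have : ∀ i, fderiv ℝ g x (EuclideanSpace.single i 1) = gradient g x i := fun i => by
      rw [← inner_gradient, EuclideanSpace.inner_single_right]; simp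
    simp only [this, PiLp.inner_apply]
    refine Finset.sum_congr rfl fun i _ => ?_
    simp [mul_comm]
  simp only [divergence, Finset.mul_sum, hinner]
  rw [integral_finsetSum _ fun i _ => hint1 i, integral_finsetSum _ fun i _ => hint2 i,
    ← Finset.sum_neg_distrib]
  exact Finset.sum_congr rfl fun i _ => h1 i

/-- Truncation costs nothing in the Lipschitz constant: for `x` inside and `y` outside, the boundary
point nearest to `x` is no farther away than `y`, and `X` vanishes there. Integration by parts on
the region thus reduces to the whole space. -/
lemma LipschitzWith.indicator_of_eq_zero {Ω : Set 𝔼} {X : 𝔼 → 𝔼} {K : ℝ≥0}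
    (hX : LipschitzWith K X) (hne : (frontier Ω).Nonempty) (h0 : ∀ x ∈ frontier Ω, X x = 0) :
    LipschitzWith K (Ω.indicator X) := by
  have key : ∀ x ∈ Ω, ∀ y ∉ Ω, ‖X x‖ ≤ K * dist x y := fun x hx y hy => by
    obtain ⟨q, hq, hd⟩ := exists_mem_frontier_infDist_compl_eq_dist hx
      (ne_univ_of_frontier_nonempty hne)
    have h1 := hX.dist_le_mul x q
    rw [h0 q hq, dist_zero_right] at h1
    refine h1.trans (mul_le_mul_of_nonneg_left ?_ K.coe_nonneg)
    rw [← hd]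
    exact Metric.infDist_le_dist_of_mem hy
  refine LipschitzWith.of_dist_le_mul fun x y => ?_
  by_cases hx : x ∈ Ω <;> by_cases hy : y ∈ Ω
  · rw [indicator_of_mem hx, indicator_of_mem hy]; exact hX.dist_le_mul x y
  · rw [indicator_of_mem hx, indicator_of_notMem hy, dist_zero_right]; exact key x hx y hy
  · rw [indicator_of_notMem hx, indicator_of_mem hy, dist_zero_left, dist_comm]
    exact key y hy x hx
  · rw [indicator_of_notMem hx, indicator_of_notMem hy, dist_self]; positivity

/-- Integration by parts on `Ω` for a vector field that vanishes on the boundary. -/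
lemma setIntegral_mul_divergence {Ω : Set 𝔼} {X : 𝔼 → 𝔼} {g : 𝔼 → ℝ} {K L : ℝ≥0}
    (hO : IsOpen Ω) (hnull : volume (frontier Ω) = 0) (hne : (frontier Ω).Nonempty)
    (hX : LipschitzWith K X) (hXc : HasCompactSupport X) (h0 : ∀ x ∈ frontier Ω, X x = 0)
    (hg : LipschitzWith L g) :
    ∫ x in Ω, g x * divergence X x = -∫ x in Ω, inner ℝ (X x) (gradient g x) := by
  have hc : HasCompactSupport (Ω.indicator X) :=
    HasCompactSupport.intro hXc.isCompact fun x hx => by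
      by_cases h : x ∈ Ω
      · rw [indicator_of_mem h, image_eq_zero_of_notMem_tsupport hx]
      · rw [indicator_of_notMem h]
  have h := integral_mul_divergence (hX.indicator_of_eq_zero hne h0) hc hg
  rw [← integral_indicator hO.measurableSet, ← integral_indicator hO.measurableSet]
  refine Eq.trans ?_ (h.trans ?_)
  · refine integral_congr_ae ?_
    filter_upwards [measure_eq_zero_iff_ae_notMem.1 hnull] with x hx
    by_cases hxΩ : x ∈ Ω
    · have : Ω.indicator X =ᶠ[𝓝 x] X := by
        filter_upwards [hO.mem_nhds hxΩ] with y hy using indicator_of_mem hy _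
      rw [indicator_of_mem hxΩ, this.divergence_eq]
    · have hxc : x ∈ (closure Ω)ᶜ := fun h => hx (by rw [hO.frontier_eq]; exact ⟨h, hxΩ⟩)
      have : Ω.indicator X =ᶠ[𝓝 x] fun _ => 0 := by
        filter_upwards [isClosed_closure.isOpen_compl.mem_nhds hxc] with y hy using
          indicator_of_notMem (fun h => hy (subset_closure h)) _
      rw [indicator_of_notMem hxΩ, this.divergence_eq]
      simp [divergence]
  · congr 1
    refine integral_congr_ae (Eventually.of_forall fun x => ?_)
    by_cases hxΩ : x ∈ Ω
    · simp [hxΩ]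
    · simp [hxΩ]

end Divergence

section Extension

/-! ### A regular extension of the exterior normal -/

lemma ContDiffAt.gradient {f : 𝔼 → ℝ} {x : 𝔼} (hf : ContDiffAt ℝ 3 f x) :
    ContDiffAt ℝ 2 (gradient f) x := by
  have h1 : ContDiffAt ℝ 2 (fderiv ℝ f) x := hf.fderiv_right (by norm_num)
  have h2 : _root_.gradient f =
      fun y => ∑ i, (fderiv ℝ f y (EuclideanSpace.single i 1)) • EuclideanSpace.single i (1 : ℝ) := by
    funext y
    ext j
    have : fderiv ℝ f y (EuclideanSpace.single j 1) = _root_.gradient f y j := by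
      rw [← inner_gradient, EuclideanSpace.inner_single_right]; simp
    simp [this, Pi.single_apply]
  rw [h2]
  exact ContDiffAt.sum fun i _ => (h1.clm_apply contDiffAt_const).smul contDiffAt_const

lemma ContDiff.smul_of_contDiffAt_tsupport {β : 𝔼 → ℝ} {g : 𝔼 → 𝔼} (hβ : ContDiff ℝ 2 β)
    (hg : ∀ x ∈ tsupport β, ContDiffAt ℝ 2 g x) : ContDiff ℝ 2 fun x => β x • g x := by
  rw [contDiff_iff_contDiffAt]
  intro x
  by_cases hx : x ∈ tsupport β
  · exact hβ.contDiffAt.smul (hg x hx)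
  · refine (contDiffAt_const (c := (0 : 𝔼))).congr_of_eventuallyEq ?_
    filter_upwards [notMem_tsupport_iff_eventuallyEq.1 hx] with y hy
    rw [hy, Pi.zero_apply, zero_smul]

/-- A smooth map that agrees with `w ↦ w / ‖w‖` outside of a ball. -/
lemma exists_contDiff_normalize {m : ℝ} (hm : 0 < m) :
    ∃ G : 𝔼 → 𝔼, ContDiff ℝ 2 G ∧ G 0 = 0 ∧ (∀ w, ‖G w‖ ≤ 1) ∧
      ∀ w, m ≤ ‖w‖ → G w = ‖w‖⁻¹ • w := by
  let β : ContDiffBump (0 : 𝔼) := ⟨m / 2, m, half_pos hm, half_lt_self hm⟩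
  refine ⟨fun w => (1 - β w) • (‖w‖⁻¹ • w), ?_, by simp, fun w => ?_, fun w hw => ?_⟩
  · rw [contDiff_iff_contDiffAt]
    intro w
    by_cases hw : w = 0
    · refine (contDiffAt_const (c := (0 : 𝔼))).congr_of_eventuallyEq ?_
      rw [hw]
      filter_upwards [β.eventuallyEq_one] with y hy
      rw [hy, Pi.one_apply, sub_self, zero_smul]
    · exact (contDiffAt_const.sub β.contDiffAt).smul
        (((contDiffAt_norm ℝ hw).inv (norm_ne_zero_iff.2 hw)).smul contDiffAt_id)
  · rw [norm_smul, norm_smul, norm_inv, norm_norm, Real.norm_of_nonneg (sub_nonneg.2 β.le_one)]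
    have h1 : ‖w‖⁻¹ * ‖w‖ ≤ 1 := inv_mul_le_one
    have h2 : 0 ≤ ‖w‖⁻¹ * ‖w‖ := by positivity
    nlinarith [β.nonneg' w, β.le_one (x := w)]
  · dsimp only
    rw [β.zero_of_le_dist (by simpa using hw), sub_zero, one_smul]

/-- Glue the gradients of local defining functions with bump functions. At a boundary point all of
them are positive multiples of the same normal, so the sum cannot cancel; composition with a `C²`
normalization then gives unit length near the boundary. -/
lemma HasC3HolderBoundary.exists_extension {α : ℝ≥0} {Ω : Set 𝔼}
    (hΩ : HasC3HolderBoundary α Ω) (hR : IsBoundedRegion Ω) (hne : (frontier Ω).Nonempty) :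
    ∃ (Y : 𝔼 → 𝔼) (r₀ : ℝ), ContDiff ℝ 2 Y ∧ HasCompactSupport Y ∧ 0 < r₀ ∧ (∀ x, ‖Y x‖ ≤ 1) ∧
      (∀ x, |signedDistBoundary Ω x| < r₀ → ‖Y x‖ = 1) ∧
      ∀ p ∈ frontier Ω, IsExteriorNormal Ω p (Y p) := by
  have hcomp : IsCompact (frontier Ω) :=
    Metric.isCompact_of_isClosed_isBounded isClosed_frontier
      (hR.isBounded.closure.subset frontier_subset_closure)
  choose! V f hV hpV hf _ hg hfΩ using hΩ
  have hball : ∀ p ∈ frontier Ω, ∃ σ : ℝ, 0 < σ ∧ Metric.closedBall p σ ⊆ V p := fun p hp =>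
    Metric.nhds_basis_closedBall.mem_iff.1 ((hV p hp).mem_nhds (hpV p hp))
  choose! σ hσ hσV using hball
  have hfat : ∀ p ∈ frontier Ω, ∀ x ∈ V p, ContDiffAt ℝ 3 (f p) x := fun p hp x hx =>
    (hf p hp).contDiffAt ((hV p hp).mem_nhds hx)
  obtain ⟨F, hF, hcov⟩ := hcomp.elim_nhds_subcover (fun p => Metric.ball p (σ p / 2))
    (fun p hp => Metric.ball_mem_nhds p (half_pos (hσ p hp)))
  -- the bump functions are indexed by all points to avoid dependent sums
  have hbump : ∀ p ∈ F, ∃ β : 𝔼 → ℝ, ContDiff ℝ 2 β ∧ (∀ x, 0 ≤ β x) ∧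
      tsupport β ⊆ Metric.closedBall p (σ p) ∧ ∀ x ∈ Metric.ball p (σ p / 2), 0 < β x :=
    fun p hp => by
      have h0 := hσ p (hF p hp)
      let β : ContDiffBump p := ⟨σ p / 2, σ p, half_pos h0, half_lt_self h0⟩
      exact ⟨β, β.contDiff, β.nonneg', β.tsupport_eq.subset, fun x hx => β.pos_of_mem_ball
        (Metric.ball_subset_ball (half_le_self h0.le) hx)⟩
  choose! β hβ hβ0 hβs hβpos using hbump
  set N : 𝔼 → 𝔼 := fun x => ∑ p ∈ F, β p x • gradient (f p) x with hN
  have hNd : ContDiff ℝ 2 N := ContDiff.sum fun p hp =>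
    ContDiff.smul_of_contDiffAt_tsupport (hβ p hp) fun x hx =>
      (hfat p (hF p hp) x (hσV p (hF p hp) (hβs p hp hx))).gradient
  have hNc : HasCompactSupport N := by
    refine HasCompactSupport.intro (K := ⋃ p ∈ F, Metric.closedBall p (σ p))
      (F.isCompact_biUnion fun p _ => isCompact_closedBall p (σ p)) fun x hx => ?_
    refine Finset.sum_eq_zero fun p hp => ?_
    have h0 : β p x = 0 :=
      image_eq_zero_of_notMem_tsupport fun h => hx (mem_biUnion hp (hβs p hp h))
    rw [h0, zero_smul]
  have hnormal : ∀ p ∈ F, ∀ q ∈ frontier Ω, q ∈ V p →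
      IsExteriorNormal Ω q (‖gradient (f p) q‖⁻¹ • gradient (f p) q) := fun p hp q hq hqV => by
    have h0 : 0 < ‖gradient (f p) q‖ := norm_pos_iff.2 (hg p (hF p hp) q hqV)
    refine ⟨?_, V p, f p, ‖gradient (f p) q‖, hV p (hF p hp), hqV,
      (hf p (hF p hp)).of_le (by norm_num), hfΩ p (hF p hp), h0, ?_⟩
    · rw [norm_smul, norm_inv, norm_norm, inv_mul_cancel₀ h0.ne']
    · rw [smul_smul, mul_inv_cancel₀ h0.ne', one_smul]
  have hNn : ∀ q ∈ frontier Ω, ∃ (c : ℝ) (n : 𝔼), 0 < c ∧ IsExteriorNormal Ω q n ∧ N q = c • n := by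
    intro q hq
    obtain ⟨p, hp, hqp⟩ := mem_iUnion₂.1 (hcov hq)
    have hqV : q ∈ V p := hσV p (hF p hp) (Metric.ball_subset_closedBall
      (Metric.ball_subset_ball (half_le_self (hσ p (hF p hp)).le) hqp))
    set n := ‖gradient (f p) q‖⁻¹ • gradient (f p) q with hn
    have hnn := hnormal p hp q hq hqV
    refine ⟨∑ p ∈ F, β p q * ‖gradient (f p) q‖, n, ?_, hnn, ?_⟩
    · refine lt_of_lt_of_le ?_ (Finset.single_le_sum (f := fun p => β p q * ‖gradient (f p) q‖)
        (fun p hp => mul_nonneg (hβ0 p hp q) (norm_nonneg _)) hp)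
      exact mul_pos (hβpos p hp q hqp) (norm_pos_iff.2 (hg p (hF p hp) q hqV))
    · rw [hN, Finset.sum_smul]
      refine Finset.sum_congr rfl fun p' hp' => ?_
      by_cases hz : β p' q = 0
      · rw [hz, zero_smul, zero_mul, zero_smul]
      have hqV' : q ∈ V p' := hσV p' (hF p' hp') (hβs p' hp' (subset_tsupport _ hz))
      have h0 : ‖gradient (f p') q‖ ≠ 0 := norm_ne_zero_iff.2 (hg p' (hF p' hp') q hqV')
      rw [show n = _ from hnn.unique hR.isOpen hq (hnormal p' hp' q hq hqV'), mul_smul, smul_smul ‖_‖,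
        mul_inv_cancel₀ h0, one_smul]
  obtain ⟨K, hK⟩ := hNd.lipschitzWith_of_hasCompactSupport hNc (by norm_num)
  obtain ⟨q₀, hq₀, hmin⟩ := hcomp.exists_isMinOn hne hNd.continuous.norm.continuousOn
  set m := ‖N q₀‖ / 2 with hm
  have hm0 : 0 < m := by
    obtain ⟨c, n, hc, hn, h⟩ := hNn q₀ hq₀
    rw [hm, h, norm_smul, hn.1, mul_one, Real.norm_of_nonneg hc.le]
    exact half_pos hc
  have hNm : ∀ q ∈ frontier Ω, 2 * m ≤ ‖N q‖ := fun q hq => by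
    rw [hm, mul_div_cancel₀ _ two_ne_zero]
    exact hmin hq
  obtain ⟨G, hG, hG0, hG1, hGm⟩ := exists_contDiff_normalize (d := d) hm0
  -- On the boundary `‖N‖ ≥ 2 * m`. Within distance `m / (K + 1)` it drops by at most `m`, so `G`
  -- still normalizes exactly.
  refine ⟨fun x => G (N x), m / (K + 1), hG.comp hNd, hNc.comp_left hG0, by positivity,
    fun x => hG1 _, fun x hx => ?_, fun p hp => ?_⟩
  · obtain ⟨q, hq, hd⟩ := exists_frontier_dist_eq hne x
    have h1 := hK.dist_le_mul q x
    rw [dist_comm q x, hd, dist_eq_norm] at h1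
    rw [lt_div_iff₀ (by positivity)] at hx
    have h2 : (K : ℝ) * |signedDistBoundary Ω x| ≤ m := by
      nlinarith [abs_nonneg (signedDistBoundary Ω x)]
    have h3 := norm_sub_norm_le (N q) (N x)
    have h4 : m ≤ ‖N x‖ := by linarith [hNm q hq]
    change ‖G (N x)‖ = 1
    rw [hGm _ h4, norm_smul, norm_inv, norm_norm, inv_mul_cancel₀ (hm0.trans_le h4).ne']
  · obtain ⟨c, n, hc, hn, h⟩ := hNn p hp
    have : G (N p) = n := by
      rw [hGm _ (by linarith [hNm p hp]), h, norm_smul, hn.1, mul_one,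
        Real.norm_of_nonneg hc.le, smul_smul, inv_mul_cancel₀ hc.ne', one_smul]
    change IsExteriorNormal Ω p (G (N p))
    rwa [this]

end Extension

section Mass

/-! ### The mass constraint -/

lemma exists_mul_exp_le (A : ℝ) {B κ : ℝ} (hB : 0 < B) (hκ : 0 < κ) :
    ∃ K : ℝ, 1 ≤ K ∧ A * Real.exp (-(κ * K)) ≤ B := by
  have h1 : Tendsto (fun K : ℝ => A * Real.exp (-(κ * K))) atTop (𝓝 (A * 0)) :=
    ((Real.tendsto_exp_neg_atTop_nhds_zero.comp
      (tendsto_id.const_mul_atTop hκ))).const_mul A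
  rw [mul_zero] at h1
  obtain ⟨K, hK1, hK2⟩ := ((eventually_ge_atTop (1 : ℝ)).and (h1.eventually (ge_mem_nhds hB))).exists
  exact ⟨K, hK1, hK2⟩

variable {W U : ℝ → ℝ}

/-- The distance of the diffuse indicator function to the sharp one. -/
lemma abs_psi_sub_indicator_le {κ C : ℝ} (hκ : 0 < κ) (hC : 0 < C)
    (h0 : ∀ z, wellPrimitive W (U z) ∈ Ioo (0 : ℝ) 1)
    (hbot : ∀ z, wellPrimitive W (U z) ≤ C * Real.exp (κ * z))
    (htop : ∀ z, 1 - wellPrimitive W (U z) ≤ C * Real.exp (-(κ * z)))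
    (Ω : Set 𝔼) {a ε K : ℝ} (hε : 0 < ε) (ha : |a| ≤ K * ε) (x : 𝔼) :
    |wellPrimitive W (gluedProfile U Ω a ε x) - Ω.indicator (fun _ => (1 : ℝ)) x| ≤
      C * Real.exp (κ * K) * Real.exp (-(κ * (|signedDistBoundary Ω x| / ε))) := by
  have ha' : |a| / ε ≤ K := (div_le_iff₀ hε).2 ha
  rw [mul_assoc, ← Real.exp_add]
  unfold gluedProfile
  by_cases hx : x ∈ Ω
  · rw [indicator_of_mem hx, abs_sub_comm, abs_of_nonneg (sub_nonneg.2 (h0 _).2.le)]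
    refine (htop _).trans (mul_le_mul_of_nonneg_left (Real.exp_le_exp.2 ?_) hC.le)
    rw [abs_of_nonpos (signedDist_nonpos hx), sub_div]
    have h1 : a / ε ≤ K := (div_le_div_of_nonneg_right (le_abs_self a) hε.le).trans ha'
    nlinarith
  · rw [indicator_of_notMem hx, sub_zero, abs_of_pos (h0 _).1]
    refine (hbot _).trans (mul_le_mul_of_nonneg_left (Real.exp_le_exp.2 ?_) hC.le)
    rw [abs_of_nonneg (signedDist_nonneg hx), sub_div, neg_div]
    have h1 : -a / ε ≤ K := (div_le_div_of_nonneg_right (neg_le_abs a) hε.le).trans ha'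
    rw [neg_div] at h1
    nlinarith

lemma continuous_gluedProfile (hU : Continuous U) (Ω : Set 𝔼) (a ε : ℝ) :
    Continuous (gluedProfile U Ω a ε) :=
  hU.comp (((continuous_signedDist Ω).neg.sub continuous_const).div_const ε)

lemma IsBoundedRegion.integrable_indicator {Ω : Set 𝔼} (hR : IsBoundedRegion Ω) :
    Integrable (Ω.indicator fun _ => (1 : ℝ)) :=
  (integrable_indicator_iff hR.isOpen.measurableSet).2
    (integrableOn_const hR.isBounded.measure_lt_top.ne)

lemma hasExactMass_of_integral_eq_zero {Ω : Set 𝔼} (hR : IsBoundedRegion Ω) {u : 𝔼 → ℝ}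
    (hi : Integrable fun x => wellPrimitive W (u x) - Ω.indicator (fun _ => (1 : ℝ)) x)
    (h0 : ∫ x, (wellPrimitive W (u x) - Ω.indicator (fun _ => (1 : ℝ)) x) = 0) :
    HasExactMass W Ω u := by
  have h1 : Integrable fun x => wellPrimitive W (u x) := by
    refine (hi.add hR.integrable_indicator).congr (Eventually.of_forall fun x => ?_)
    simp
  refine ⟨h1, ?_⟩
  rw [integral_sub h1 hR.integrable_indicator, sub_eq_zero,
    integral_indicator hR.isOpen.measurableSet] at h0
  rw [h0]
  simp [measureReal_def]

variable {Ω : Set (EuclideanSpace ℝ (Fin d))} {α : ℝ≥0}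

lemma HasC3HolderBoundary.integrable_psi_sub_indicator (hΩ : HasC3HolderBoundary α Ω)
    (hR : IsBoundedRegion Ω) (hne : (frontier Ω).Nonempty)
    (hW : IsDoubleWell W) (hU : IsOptimalProfile W U) (a : ℝ) {ε : ℝ} (hε : 0 < ε) :
    Integrable fun x => wellPrimitive W (gluedProfile U Ω a ε x) -
      Ω.indicator (fun _ => (1 : ℝ)) x := by
  obtain ⟨κ, C, hκ, hC, hb⟩ := hU.bounds hW
  have hφ : Continuous (wellPrimitive W) :=
    continuous_iff_continuousAt.2 fun v => (hW.hasDerivAt_wellPrimitive v).continuousAt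
  refine ((hΩ.integrable_exp hR hne hκ hε).const_mul (C * Real.exp (κ * (|a| / ε)))).mono' ?_
    (Eventually.of_forall fun x => ?_)
  · exact ((hφ.comp (continuous_gluedProfile hU.contDiff.continuous Ω a ε)).aestronglyMeasurable).sub
      hR.integrable_indicator.aestronglyMeasurable
  · exact abs_psi_sub_indicator_le hκ hC (fun z => hW.wellPrimitive_mem_Ioo (hU.mem_Ioo hW z))
      (fun z => (hb z).2.1) (fun z => (hb z).2.2) Ω hε (by rw [div_mul_cancel₀ _ hε.ne']) x

/-- The mass constraint can be met by a shift of size at most `K ε`. -/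
lemma HasC3HolderBoundary.exists_shift (hΩ : HasC3HolderBoundary α Ω) (hR : IsBoundedRegion Ω)
    (hne : (frontier Ω).Nonempty) (hW : IsDoubleWell W) (hU : IsOptimalProfile W U)
    {κ C : ℝ} (hκ : 0 < κ) (hC : 0 < C)
    (hbot : ∀ z, wellPrimitive W (U z) ≤ C * Real.exp (κ * z))
    (htop : ∀ z, 1 - wellPrimitive W (U z) ≤ C * Real.exp (-(κ * z)))
    {ε K r b m : ℝ} (hε : 0 < ε) (hK : 0 ≤ K) (hr : r ≤ K * ε)
    (hm0 : m ≤ wellPrimitive W (U 0)) (hm1 : m ≤ 1 - wellPrimitive W (U 0)) (hmnn : 0 ≤ m)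
    (hin : b ≤ volume.real ({x | |signedDistBoundary Ω x| ≤ r} ∩ Ω))
    (hout : b ≤ volume.real ({x | |signedDistBoundary Ω x| ≤ r} ∩ Ωᶜ))
    (hfin : volume {x | |signedDistBoundary Ω x| ≤ r} ≠ ⊤)
    (hbal : C * Real.exp (-(κ * K)) *
      ∫ x, Real.exp (-(κ * (|signedDistBoundary Ω x| / ε))) ≤ m * b) :
    ∃ a : ℝ, |a| ≤ K * ε ∧ HasExactMass W Ω (gluedProfile U Ω a ε) := by
  set Φ : ℝ → ℝ := fun z => wellPrimitive W (U z) with hΦ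
  have hΦ01 : ∀ z, Φ z ∈ Ioo (0 : ℝ) 1 := fun z => hW.wellPrimitive_mem_Ioo (hU.mem_Ioo hW z)
  have hΦmono : Monotone Φ := monotone_of_hasDerivAt_nonneg
    (fun z => hU.hasDerivAt_wellPrimitive_comp hW z)
    fun z => mul_nonneg two_pos.le (hW.nonneg _)
  have hΦc : Continuous Φ := continuous_iff_continuousAt.2 fun z =>
    (hU.hasDerivAt_wellPrimitive_comp hW z).continuousAt
  have hexp := hΩ.integrable_exp hR hne hκ hε
  set D : ℝ → ℝ := fun a => ∫ x, (wellPrimitive W (gluedProfile U Ω a ε x) -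
    Ω.indicator (fun _ => (1 : ℝ)) x) with hD
  have hint : ∀ a, Integrable fun x => wellPrimitive W (gluedProfile U Ω a ε x) -
      Ω.indicator (fun _ => (1 : ℝ)) x := fun a =>
    hΩ.integrable_psi_sub_indicator hR hne hW hU a hε
  have hKε : 0 ≤ K * ε := by positivity
  have hcont : ContinuousOn D (Icc (-(K * ε)) (K * ε)) := by
    refine continuousOn_of_dominated (bound := fun x => C * Real.exp (κ * K) *
      Real.exp (-(κ * (|signedDistBoundary Ω x| / ε)))) (fun a _ => (hint a).aestronglyMeasurable)
      (fun a ha => Eventually.of_forall fun x => ?_) (hexp.const_mul _)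
      (Eventually.of_forall fun x => ?_)
    · exact abs_psi_sub_indicator_le hκ hC hΦ01 hbot htop Ω hε (abs_le.2 ha) x
    · refine (Continuous.sub ?_ continuous_const).continuousOn
      exact hΦc.comp ((continuous_const.sub continuous_id).div_const ε)
  have hcollar : ∀ S : Set 𝔼, MeasurableSet S → b ≤ volume.real ({x | |signedDistBoundary Ω x| ≤ r} ∩ S) →
      Integrable (({x | |signedDistBoundary Ω x| ≤ r} ∩ S).indicator fun _ => m) ∧
      m * b ≤ ∫ x, ({x | |signedDistBoundary Ω x| ≤ r} ∩ S).indicator (fun _ => m) x := by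
    intro S hS h
    have hm : MeasurableSet ({x | |signedDistBoundary Ω x| ≤ r} ∩ S) :=
      (isClosed_le (continuous_signedDist Ω).abs continuous_const).measurableSet.inter hS
    refine ⟨(integrable_indicator_iff hm).2 (integrableOn_const
      ((measure_mono inter_subset_left).trans_lt hfin.lt_top).ne), ?_⟩
    rw [integral_indicator_const _ hm, smul_eq_mul, mul_comm]
    gcongr
  have hI : ∫ x, C * Real.exp (-(κ * K)) * Real.exp (-(κ * (|signedDistBoundary Ω x| / ε))) ≤
      m * b := by rwa [integral_const_mul]
  have hexpK := hexp.const_mul (C * Real.exp (-(κ * K)))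
  -- The profile is moved outwards by `K * ε`. It is then at least `Φ 0 ≥ m` on the outer collar,
  -- while the deficit inside carries the factor `exp (-κ K)`; `hbal` says that the gain prevails.
  -- The case `a = K * ε` is the mirror image.
  have hlow : 0 ≤ D (-(K * ε)) := by
    obtain ⟨hi, hle⟩ := hcollar Ωᶜ hR.isOpen.measurableSet.compl hout
    have h1 := integral_mono (hi.sub hexpK) (hint (-(K * ε))) fun x => ?_
    · simp only [Pi.sub_apply] at h1
      rw [integral_sub hi hexpK] at h1
      exact le_trans (by linarith) h1
    · simp only [Pi.sub_apply]
      have hz : (-signedDistBoundary Ω x - -(K * ε)) / ε = K - signedDistBoundary Ω x / ε := by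
        field_simp
        ring
      by_cases hx : x ∈ Ω
      · have e1 : x ∉ {x | |signedDistBoundary Ω x| ≤ r} ∩ Ωᶜ := fun h => h.2 hx
        rw [indicator_of_notMem e1, indicator_of_mem hx, gluedProfile, hz]
        have h2 := htop (K - signedDistBoundary Ω x / ε)
        rw [mul_assoc, ← Real.exp_add, abs_of_nonpos (signedDist_nonpos hx)]
        rw [show -(κ * (K - signedDistBoundary Ω x / ε)) =
          -(κ * K) + -(κ * (-signedDistBoundary Ω x / ε)) by ring] at h2
        linarith
      · rw [indicator_of_notMem hx, gluedProfile, hz, sub_zero]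
        refine (sub_le_self _ (by positivity)).trans ?_
        by_cases hxr : |signedDistBoundary Ω x| ≤ r
        · rw [indicator_of_mem (show x ∈ {x | |signedDistBoundary Ω x| ≤ r} ∩ Ωᶜ from ⟨hxr, hx⟩)]
          refine hm0.trans (hΦmono (sub_nonneg.2 ((div_le_iff₀ hε).2 ?_)))
          exact (le_abs_self _).trans (hxr.trans hr)
        · rw [indicator_of_notMem fun h => hxr h.1]
          exact (hΦ01 _).1.le
  have hhigh : D (K * ε) ≤ 0 := by
    obtain ⟨hi, hle⟩ := hcollar Ω hR.isOpen.measurableSet hin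
    have h1 := integral_mono (hint (K * ε)) (hexpK.sub hi) fun x => ?_
    · simp only [Pi.sub_apply] at h1
      rw [integral_sub hexpK hi] at h1
      exact h1.trans (by linarith)
    · simp only [Pi.sub_apply]
      have hz : (-signedDistBoundary Ω x - K * ε) / ε = -K - signedDistBoundary Ω x / ε := by
        field_simp
        ring
      by_cases hx : x ∈ Ω
      · rw [indicator_of_mem hx, gluedProfile, hz]
        refine le_trans ?_ (sub_le_sub_right (by positivity :
          0 ≤ C * Real.exp (-(κ * K)) * Real.exp (-(κ * (|signedDistBoundary Ω x| / ε)))) _)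
        by_cases hxr : |signedDistBoundary Ω x| ≤ r
        · rw [indicator_of_mem (show x ∈ {x | |signedDistBoundary Ω x| ≤ r} ∩ Ω from ⟨hxr, hx⟩)]
          have h2 : -signedDistBoundary Ω x / ε ≤ K :=
            (div_le_iff₀ hε).2 ((neg_le_abs _).trans (hxr.trans hr))
          rw [neg_div] at h2
          have h3 : Φ (-K - signedDistBoundary Ω x / ε) ≤ Φ 0 := hΦmono (by linarith)
          simp only [hΦ] at h3
          linarith
        · rw [indicator_of_notMem fun h => hxr h.1]
          linarith [(hΦ01 (-K - signedDistBoundary Ω x / ε)).2]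
      · have e1 : x ∉ {x | |signedDistBoundary Ω x| ≤ r} ∩ Ω := fun h => hx h.2
        rw [indicator_of_notMem e1, indicator_of_notMem hx, gluedProfile, hz, sub_zero, sub_zero]
        refine (hbot _).trans (le_of_eq ?_)
        rw [mul_assoc, ← Real.exp_add, abs_of_nonneg (signedDist_nonneg hx)]
        ring_nf
  obtain ⟨a, ha, ha0⟩ := intermediate_value_Icc' (neg_le_self hKε) hcont ⟨hhigh, hlow⟩
  exact ⟨a, abs_le.2 ha, hasExactMass_of_integral_eq_zero hR (hint a) ha0⟩

/-- Shifts of order `ε` that realize the mass constraint. -/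
lemma HasC3HolderBoundary.exists_shifts (hΩ : HasC3HolderBoundary α Ω) (hR : IsBoundedRegion Ω)
    (hne : (frontier Ω).Nonempty) (hW : IsDoubleWell W) (hU : IsOptimalProfile W U) :
    ∃ (a : ℝ → ℝ) (K ε₀ : ℝ), 0 < ε₀ ∧ (∀ ε, 0 < ε → ε ≤ ε₀ → |a ε| ≤ K * ε) ∧
      ∀ ε, 0 < ε → HasExactMass W Ω (gluedProfile U Ω (a ε) ε) := by
  obtain ⟨κ, C, hκ, hC, hb⟩ := hU.bounds hW
  obtain ⟨p, hp⟩ := hne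
  have hne : (frontier Ω).Nonempty := ⟨p, hp⟩
  obtain ⟨c, r₀, hc, hr₀, hcollar⟩ := hΩ.exists_le_collar hR.isOpen hp one_pos
  obtain ⟨C', -, htube⟩ := hΩ.exists_tube_le hR hne
  obtain ⟨I, hI0, hI⟩ := hΩ.integral_exp_moment_le hR hne hκ 0
  have hΦ0 := hW.wellPrimitive_mem_Ioo (hU.mem_Ioo hW 0)
  set m := min (wellPrimitive W (U 0)) (1 - wellPrimitive W (U 0)) with hm
  have hm0 : 0 < m := lt_min hΦ0.1 (sub_pos.2 hΦ0.2)
  have key : ∀ ε K r : ℝ, 0 < ε → 0 ≤ K → 0 < r → r ≤ r₀ → r ≤ K * ε →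
      C * Real.exp (-(κ * K)) *
        ∫ x, Real.exp (-(κ * (|signedDistBoundary Ω x| / ε))) ≤ m * (c * r) →
      ∃ a : ℝ, |a| ≤ K * ε ∧ HasExactMass W Ω (gluedProfile U Ω a ε) := by
    intro ε K r hε hK hr hr0 hrK hbal
    have hfin : volume {x | |signedDistBoundary Ω x| ≤ r} ≠ ⊤ :=
      ((htube r hr).trans_lt ENNReal.ofReal_lt_top).ne
    have hmono : ∀ S : Set 𝔼, volume.real ({x | |signedDistBoundary Ω x| ≤ r} ∩
        Metric.ball p 1 ∩ S) ≤ volume.real ({x | |signedDistBoundary Ω x| ≤ r} ∩ S) := fun S =>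
      measureReal_mono (inter_subset_inter_left _ inter_subset_left)
        ((measure_mono inter_subset_left).trans_lt hfin.lt_top).ne
    have hcr := hcollar r hr hr0
    exact hΩ.exists_shift hR hne hW hU hκ hC (fun z => (hb z).2.1) (fun z => (hb z).2.2) hε hK hrK
      (min_le_left _ _) (min_le_right _ _) hm0.le (hcr.1.trans (hmono _)) (hcr.2.trans (hmono _))
      hfin hbal
  -- Collar mass and tail are both of order `ε`, so for small `ε` one `K` serves for all.
  obtain ⟨K, hK1, hK⟩ := exists_mul_exp_le (C * I) (mul_pos hm0 hc) hκ
  have hall : ∀ ε : ℝ, 0 < ε → ∃ a : ℝ, (ε ≤ min 1 r₀ → |a| ≤ K * ε) ∧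
      HasExactMass W Ω (gluedProfile U Ω a ε) := by
    intro ε hε
    by_cases hsmall : ε ≤ min 1 r₀
    · obtain ⟨a, ha, hmass⟩ := key ε K ε hε (by linarith) hε (hsmall.trans (min_le_right _ _))
        (by nlinarith) (by
          have h1 := (hI ε hε (hsmall.trans (min_le_left _ _))).2
          simp only [pow_zero, mul_one, zero_add, pow_one] at h1
          calc _ ≤ C * Real.exp (-(κ * K)) * (I * ε) := by gcongr
            _ = C * I * Real.exp (-(κ * K)) * ε := by ring
            _ ≤ m * c * ε := by gcongr
            _ = _ := by ring)
      exact ⟨a, fun _ => ha, hmass⟩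
    -- For large `ε` only the exact mass is required, and `K'` may depend on `ε`.
    · set J := ∫ x, Real.exp (-(κ * (|signedDistBoundary Ω x| / ε)))
      have hr : 0 < min ε r₀ := lt_min hε hr₀
      obtain ⟨K', hK1', hK'⟩ := exists_mul_exp_le (C * J)
        (mul_pos hm0 (mul_pos hc hr)) hκ
      obtain ⟨a, -, hmass⟩ := key ε K' (min ε r₀) hε (by linarith) hr (min_le_right _ _)
        ((min_le_left _ _).trans (by nlinarith)) (by
          calc _ = C * J * Real.exp (-(κ * K')) := by ring
            _ ≤ _ := hK')
      exact ⟨a, fun h => absurd h hsmall, hmass⟩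
  choose! a ha using hall
  exact ⟨a, K, min 1 r₀, lt_min one_pos hr₀, fun ε hε h => (ha ε hε).1 h, fun ε hε => (ha ε hε).2⟩

end Mass

section Calibration

/-! ### The divergence of a calibration on the boundary -/

lemma HasC3HolderBoundary.ae_differentiableAt_notMem_frontier {α : ℝ≥0} {Ω : Set 𝔼}
    (hΩ : HasC3HolderBoundary α Ω) (hR : IsBoundedRegion Ω) (hne : (frontier Ω).Nonempty) :
    ∀ᵐ x : 𝔼, DifferentiableAt ℝ (signedDistBoundary Ω) x ∧ x ∉ frontier Ω :=
  ((lipschitzWith_signedDist Ω).ae_differentiableAt).and (hΩ.ae_notMem_frontier hR hne)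

/-- A Lipschitz unit extension of the normal agrees with the gradient of the signed distance up
to a quadratic error. -/
lemma HasC3HolderBoundary.exists_defect_le {α : ℝ≥0} {Ω : Set 𝔼}
    (hΩ : HasC3HolderBoundary α Ω) (hR : IsBoundedRegion Ω) (hne : (frontier Ω).Nonempty)
    {Y : 𝔼 → 𝔼} {K : ℝ≥0} {r₀ : ℝ} (hr₀ : 0 < r₀) (hY : LipschitzWith K Y)
    (hY1 : ∀ x, ‖Y x‖ ≤ 1) (hYr : ∀ x, |signedDistBoundary Ω x| < r₀ → ‖Y x‖ = 1)
    (hYn : ∀ p ∈ frontier Ω, IsExteriorNormal Ω p (Y p)) :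
    ∃ C : ℝ, 0 ≤ C ∧ ∀ᵐ x, ‖gradient (signedDistBoundary Ω) x‖ = 1 ∧
      |1 - inner ℝ (Y x) (gradient (signedDistBoundary Ω) x)| ≤ C * |signedDistBoundary Ω x| ^ 2 := by
  refine ⟨K ^ 2 + 2 / r₀ ^ 2, by positivity, ?_⟩
  filter_upwards [hΩ.ae_differentiableAt_notMem_frontier hR hne] with x ⟨hd, hx⟩
  obtain ⟨p, hp, hdist⟩ := exists_frontier_dist_eq hne x
  rw [gradient_signedDist hR.isOpen hp (hYn p hp) hdist hx hd]
  have hYp : ‖Y p‖ = 1 := (hYn p hp).1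
  refine ⟨hYp, ?_⟩
  by_cases hs : |signedDistBoundary Ω x| < r₀
  · have h1 := norm_sub_sq_real (Y x) (Y p)
    rw [hYp, hYr x hs] at h1
    have h2 := hY.dist_le_mul x p
    rw [hdist, dist_eq_norm] at h2
    have h3 : ‖Y x - Y p‖ ^ 2 ≤ (K * |signedDistBoundary Ω x|) ^ 2 := by gcongr
    -- Both vectors have unit length, which upgrades the Lipschitz bound to a quadratic defect.
    have h4 : 1 - inner ℝ (Y x) (Y p) = ‖Y x - Y p‖ ^ 2 / 2 := by linarith
    rw [h4, abs_of_nonneg (by positivity)]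
    have h5 : 0 ≤ 2 / r₀ ^ 2 * |signedDistBoundary Ω x| ^ 2 := by positivity
    have h6 : 0 ≤ ‖Y x - Y p‖ ^ 2 := by positivity
    rw [mul_pow] at h3
    rw [add_mul]
    linarith
  · rw [not_lt] at hs
    have h1 : |inner ℝ (Y x) (Y p)| ≤ 1 := by
      refine (abs_real_inner_le_norm _ _).trans ?_
      rw [hYp, mul_one]
      exact hY1 x
    have h2 : |1 - inner ℝ (Y x) (Y p)| ≤ 2 := by
      rw [abs_le] at h1 ⊢
      constructor <;> linarith [h1.1, h1.2]
    refine h2.trans ?_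
    have h3 : r₀ ^ 2 ≤ |signedDistBoundary Ω x| ^ 2 := by gcongr
    have h4 : 2 ≤ 2 / r₀ ^ 2 * |signedDistBoundary Ω x| ^ 2 := by
      rw [div_mul_eq_mul_div, le_div_iff₀ (by positivity)]
      linarith
    have h5 : 0 ≤ (K : ℝ) ^ 2 * |signedDistBoundary Ω x| ^ 2 := by positivity
    rw [add_mul]
    linarith

lemma LipschitzWith.mul_of_abs_le_one {f g : 𝔼 → ℝ} {K L : ℝ≥0} (hf : LipschitzWith K f)
    (hg : LipschitzWith L g) (hf1 : ∀ x, |f x| ≤ 1) (hg1 : ∀ x, |g x| ≤ 1) :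
    LipschitzWith (K + L) fun x => f x * g x :=
  LipschitzWith.of_dist_le_mul fun x y => by
    have h1 := hf.dist_le_mul x y
    have h2 := hg.dist_le_mul x y
    rw [Real.dist_eq] at h1 h2 ⊢
    calc |f x * g x - f y * g y| = |(f x - f y) * g x + f y * (g x - g y)| := by ring_nf
      _ ≤ |f x - f y| * |g x| + |f y| * |g x - g y| := by
        rw [← abs_mul, ← abs_mul]; exact abs_add_le _ _
      _ ≤ K * dist x y * 1 + 1 * (L * dist x y) := by
        gcongr
        · exact hg1 x
        · exact hf1 y
      _ = _ := by push_cast; ring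

/-- The Gaussian is the cut-off across the collar. Its derivative carries the factor `τ / r ^ 2`, so
after composition with `s` the quadratic bound on `η·∇s` produces a third moment divided by `r ^ 2`.
-/
lemma hasDerivAt_gaussian (r τ : ℝ) :
    HasDerivAt (fun τ => Real.exp (-(τ / r) ^ 2))
      (Real.exp (-(τ / r) ^ 2) * (-(2 * τ / r ^ 2))) τ := by
  have h := ((((hasDerivAt_id τ).div_const r).pow 2).neg).exp
  refine h.congr_deriv ?_
  simp only [id, Pi.pow_apply, Pi.neg_apply]
  push_cast
  ring

lemma lipschitzWith_gaussian {r : ℝ} (hr : 0 < r) :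
    LipschitzWith (2 / r).toNNReal fun τ : ℝ => Real.exp (-(τ / r) ^ 2) := by
  refine lipschitzWith_of_nnnorm_deriv_le
    (fun τ => (hasDerivAt_gaussian r τ).differentiableAt) fun τ => ?_
  rw [← NNReal.coe_le_coe, coe_nnnorm, (hasDerivAt_gaussian r τ).deriv,
    Real.coe_toNNReal _ (by positivity), Real.norm_eq_abs, abs_mul, abs_neg,
    abs_of_pos (Real.exp_pos _)]
  have h1 : |2 * τ / r ^ 2| = 2 / r * |τ / r| := by
    rw [abs_div, abs_div, abs_mul, abs_of_pos hr, abs_of_pos (pow_pos hr 2)]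
    norm_num
    field_simp
  have h2 : |τ / r| ≤ Real.exp ((τ / r) ^ 2) := by
    have := Real.add_one_le_exp ((τ / r) ^ 2)
    rw [← sq_abs] at this ⊢
    nlinarith [sq_nonneg (|τ / r| - 1)]
  rw [h1, Real.exp_neg, ← mul_assoc, mul_comm _ (2 / r), mul_assoc]
  refine mul_le_of_le_one_right (by positivity) ?_
  rw [inv_mul_le_iff₀ (Real.exp_pos _), mul_one]
  exact h2

/-- If `η` vanishes on the boundary and points inwards up to a quadratic error, then its divergence
at the boundary, seen from one side `S`, has a sign: test with functions that concentrate on a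
thin collar. -/
lemma HasC3HolderBoundary.mul_nonpos_of_divergence {α : ℝ≥0} {Ω S : Set 𝔼}
    (hΩ : HasC3HolderBoundary α Ω) (hR : IsBoundedRegion Ω) {p : 𝔼} (hp : p ∈ frontier Ω)
    {η : 𝔼 → 𝔼} {k : 𝔼 → ℝ} {K : ℝ≥0} {C θ : ℝ} (hη : LipschitzWith K η)
    (hηc : HasCompactSupport η) (hη0 : ∀ x, ‖η x‖ ≤ K * |signedDistBoundary Ω x|)
    (hC : 0 ≤ C) (hdiv : ∀ᵐ x, |divergence η x - k x| ≤ C * |signedDistBoundary Ω x|)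
    (hsgn : ∀ᵐ x, inner ℝ (η x) (gradient (signedDistBoundary Ω) x) ≤
      C * |signedDistBoundary Ω x| ^ 2)
    (hk : Continuous k) (hS : MeasurableSet S) (hθ : |θ| = 1)
    (hθs : ∀ x ∈ S, θ * signedDistBoundary Ω x = |signedDistBoundary Ω x|)
    (hibp : ∀ (g : 𝔼 → ℝ) (L : ℝ≥0), LipschitzWith L g →
      ∫ x in S, g x * divergence η x = -∫ x in S, inner ℝ (η x) (gradient g x))
    (hcollar : ∀ σ : ℝ, 0 < σ → ∃ c r₀ : ℝ, 0 < c ∧ 0 < r₀ ∧ ∀ r : ℝ, 0 < r → r ≤ r₀ →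
      c * r ≤ volume.real ({x | |signedDistBoundary Ω x| ≤ r} ∩ Metric.ball p σ ∩ S)) :
    θ * k p ≤ 0 := by
  have hne : (frontier Ω).Nonempty := ⟨p, hp⟩
  by_contra! hpos
  set s := signedDistBoundary Ω with hs
  set κ₀ := θ * k p / 2 with hκ₀
  have hκ : 0 < κ₀ := half_pos hpos
  obtain ⟨ρ, hρ, hball⟩ := Metric.eventually_nhds_iff_ball.1
    ((continuous_const.mul hk).continuousAt.eventually (lt_mem_nhds (half_lt_self hpos)))
  let ζ : ContDiffBump p := ⟨ρ / 2, ρ, half_pos hρ, half_lt_self hρ⟩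
  obtain ⟨Z, hZ⟩ := (ζ.contDiff (n := 1)).lipschitzWith_of_hasCompactSupport ζ.hasCompactSupport
    (by norm_num)
  obtain ⟨c, r₀, hc, hr₀, hcol⟩ := hcollar (ρ / 2) (half_pos hρ)
  obtain ⟨I₁, hI₁, h₁⟩ := hΩ.integral_exp_moment_le hR hne one_pos 1
  obtain ⟨I₃, hI₃, h₃⟩ := hΩ.integral_exp_moment_le hR hne one_pos 3
  set A₁ := (C + Z * K) * Real.exp 1 with hA₁
  set A₃ := 2 * C * Real.exp 1 with hA₃
  -- If `θ * k p` were positive, the term with `k` would be at least of order `r`, the volume of the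
  -- collar. All other terms are of order `r ^ 2`: first moments, and `r ^ (-2)` times a third
  -- moment. Both sides are already divided by `r` here.
  have hmain : ∀ r : ℝ, 0 < r → r ≤ min r₀ 1 →
      κ₀ * Real.exp (-1) * c ≤ (A₁ * I₁ + A₃ * I₃) * r := by
    intro r hr hr1
    set q : 𝔼 → ℝ := fun x => Real.exp (-(s x / r) ^ 2) with hq
    set E : 𝔼 → ℝ := fun x => Real.exp (-(1 * (|s x| / r))) with hE
    have hq0 : ∀ x, 0 < q x := fun x => Real.exp_pos _
    have hq1 : ∀ x, q x ≤ 1 := fun x => Real.exp_le_one_iff.2 (neg_nonpos.2 (sq_nonneg _))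
    have hqE : ∀ x, q x ≤ Real.exp 1 * E x := fun x => by
      rw [hE, ← Real.exp_add, hq]
      refine Real.exp_le_exp.2 ?_
      rw [← sq_abs, abs_div, abs_of_pos hr]
      nlinarith [sq_nonneg (|s x| / r - 1)]
    obtain ⟨L, hL⟩ : ∃ L : ℝ≥0, LipschitzWith L q :=
      ⟨_, (lipschitzWith_gaussian hr).comp (lipschitzWith_signedDist Ω)⟩
    have hgL : LipschitzWith (Z + L) fun x => ζ x * q x := hZ.mul_of_abs_le_one hL
      (fun x => by rw [abs_of_nonneg (ζ.nonneg' x)]; exact ζ.le_one)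
      (fun x => by rw [abs_of_pos (hq0 x)]; exact hq1 x)
    set T := {x | |s x| ≤ r} ∩ Metric.ball p (ρ / 2) ∩ S with hT
    have hTm : MeasurableSet T := ((isClosed_le (continuous_signedDist Ω).abs
      continuous_const).measurableSet.inter measurableSet_ball).inter hS
    have hTfin : volume T ≠ ⊤ := ((measure_mono (inter_subset_left.trans inter_subset_right)).trans_lt
      measure_ball_lt_top).ne
    set F : 𝔼 → ℝ := fun x => θ * ((ζ x * q x) * divergence η x +
      inner ℝ (η x) (gradient (fun y => ζ y * q y) x)) with hF
    have hi1 := integrable_mul_divergence hη hηc hgL.continuous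
    have hi2 := integrable_inner_gradient hη.continuous hηc hgL
    have hFi : Integrable F := (hi1.add hi2).const_mul θ
    have hF0 : ∫ x in S, F x = 0 := by
      simp only [hF]
      rw [integral_const_mul, integral_add hi1.integrableOn hi2.integrableOn, hibp _ _ hgL,
        neg_add_cancel, mul_zero]
    have hpt : ∀ᵐ x, T.indicator (fun _ => κ₀ * Real.exp (-1)) x ≤
        S.indicator F x + (A₁ * (E x * |s x| ^ 1) + A₃ / r ^ 2 * (E x * |s x| ^ 3)) := by
      filter_upwards [hdiv, hsgn, hΩ.ae_differentiableAt_notMem_frontier hR hne]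
        with x hx1 hx2 ⟨hxd, _⟩
      have hE0 : 0 < E x := Real.exp_pos _
      by_cases hxS : x ∈ S
      swap
      · rw [indicator_of_notMem (fun h => hxS h.2), indicator_of_notMem hxS]
        positivity
      rw [indicator_of_mem hxS]
      -- the gradient of the test function
      have hgrad : inner ℝ (η x) (gradient (fun y => ζ y * q y) x) =
          q x * fderiv ℝ ζ x (η x) -
            ζ x * q x * (2 * s x / r ^ 2) * inner ℝ (η x) (gradient s x) := by
        have e1 : HasFDerivAt q ((Real.exp (-(s x / r) ^ 2) * (-(2 * s x / r ^ 2))) •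
            fderiv ℝ s x) x := (hasDerivAt_gaussian r (s x)).comp_hasFDerivAt x hxd.hasFDerivAt
        have e2 : HasFDerivAt ζ (fderiv ℝ ζ x) x :=
          ((ζ.contDiff (n := 1)).differentiable (by norm_num) x).hasFDerivAt
        rw [real_inner_comm, inner_gradient, (e2.fun_mul e1).fderiv, real_inner_comm, inner_gradient]
        simp only [add_apply, smul_apply, smul_eq_mul, hq]
        ring
      have hb1 : κ₀ * (ζ x * q x) - C * (Real.exp 1 * E x * |s x|) ≤
          θ * ((ζ x * q x) * divergence η x) := by
        have e1 : κ₀ * ζ x ≤ θ * k x * ζ x := by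
          by_cases hxb : x ∈ Metric.ball p ρ
          · exact mul_le_mul_of_nonneg_right (hball x hxb).le (ζ.nonneg' x)
          · rw [ζ.zero_of_le_dist (not_lt.1 hxb)]; simp
        have e2 : -(C * |s x|) ≤ θ * (divergence η x - k x) := by
          refine (neg_le_neg ?_).trans (neg_abs_le _)
          rw [abs_mul, hθ, one_mul]; exact hx1
        have e3 : ζ x * q x ≤ Real.exp 1 * E x :=
          (mul_le_of_le_one_left (hq0 x).le ζ.le_one).trans (hqE x)
        have e4 : 0 ≤ ζ x * q x := mul_nonneg (ζ.nonneg' x) (hq0 x).le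
        have e5 := mul_le_mul_of_nonneg_right e1 (hq0 x).le
        have e6 := mul_le_mul_of_nonneg_left e2 e4
        have e7 := mul_le_mul_of_nonneg_right e3 (mul_nonneg hC (abs_nonneg (s x)))
        linarith
      have hb2 : -(Z * K * (Real.exp 1 * E x * |s x|)) ≤ θ * (q x * fderiv ℝ ζ x (η x)) := by
        refine (neg_le_neg ?_).trans (neg_abs_le _)
        rw [abs_mul, hθ, one_mul, abs_mul, abs_of_pos (hq0 x)]
        have e1 : |fderiv ℝ ζ x (η x)| ≤ Z * (K * |s x|) :=
          ((fderiv ℝ ζ x).le_opNorm _).trans (mul_le_mul (norm_fderiv_le_of_lipschitz ℝ hZ) (hη0 x)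
            (norm_nonneg _) Z.coe_nonneg)
        calc q x * |fderiv ℝ ζ x (η x)| ≤ (Real.exp 1 * E x) * (Z * (K * |s x|)) :=
              mul_le_mul (hqE x) e1 (abs_nonneg _) (by positivity)
          _ = _ := by ring
      have hb3 : -(A₃ / r ^ 2 * (E x * |s x| ^ 3)) ≤
          -(θ * (ζ x * q x * (2 * s x / r ^ 2) * inner ℝ (η x) (gradient s x))) := by
        refine neg_le_neg ?_
        -- The sign `θ` turns `s` into `|s|`, so an upper bound on `η·∇s` alone is enough on either
        -- side.
        have e0 : θ * (ζ x * q x * (2 * s x / r ^ 2) * inner ℝ (η x) (gradient s x)) =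
            ζ x * q x * (2 * |s x| / r ^ 2) * inner ℝ (η x) (gradient s x) := by
          rw [← hθs x hxS]; ring
        have e3 : ζ x * q x ≤ Real.exp 1 * E x :=
          (mul_le_of_le_one_left (hq0 x).le ζ.le_one).trans (hqE x)
        have e4 : 0 ≤ ζ x * q x := mul_nonneg (ζ.nonneg' x) (hq0 x).le
        rw [e0]
        calc _ ≤ ζ x * q x * (2 * |s x| / r ^ 2) * (C * |s x| ^ 2) :=
              mul_le_mul_of_nonneg_left hx2 (by positivity)
          _ ≤ Real.exp 1 * E x * (2 * |s x| / r ^ 2) * (C * |s x| ^ 2) := by gcongr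
          _ = _ := by rw [hA₃]; ring
      have hb4 : T.indicator (fun _ => κ₀ * Real.exp (-1)) x ≤ κ₀ * (ζ x * q x) := by
        by_cases hxT : x ∈ T
        · rw [indicator_of_mem hxT, ζ.one_of_mem_closedBall (Metric.ball_subset_closedBall hxT.1.2),
            one_mul]
          refine mul_le_mul_of_nonneg_left (Real.exp_le_exp.2 (neg_le_neg ?_)) hκ.le
          rw [← sq_abs, abs_div, abs_of_pos hr]
          exact pow_le_one₀ (by positivity) ((div_le_one hr).2 hxT.1.1)
        · rw [indicator_of_notMem hxT]
          exact mul_nonneg hκ.le (mul_nonneg (ζ.nonneg' x) (hq0 x).le)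
      have hFx : F x = θ * ((ζ x * q x) * divergence η x) + θ * (q x * fderiv ℝ ζ x (η x)) -
          θ * (ζ x * q x * (2 * s x / r ^ 2) * inner ℝ (η x) (gradient s x)) := by
        simp only [hF]
        rw [hgrad]
        ring
      rw [hFx, hA₁, pow_one]
      linarith
    have hm1 := h₁ r hr (hr1.trans (min_le_right _ _))
    have hm3 := h₃ r hr (hr1.trans (min_le_right _ _))
    have hm : Integrable fun x => A₁ * (E x * |s x| ^ 1) + A₃ / r ^ 2 * (E x * |s x| ^ 3) :=
      (hm1.1.const_mul A₁).add (hm3.1.const_mul (A₃ / r ^ 2))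
    have hsplit : ∫ x, (S.indicator F x + (A₁ * (E x * |s x| ^ 1) + A₃ / r ^ 2 * (E x * |s x| ^ 3))) =
        A₁ * (∫ x, E x * |s x| ^ 1) + A₃ / r ^ 2 * ∫ x, E x * |s x| ^ 3 := by
      rw [integral_add (hFi.indicator hS) hm, integral_indicator hS, hF0, zero_add,
        integral_add (hm1.1.const_mul A₁) (hm3.1.const_mul (A₃ / r ^ 2)),
        integral_const_mul, integral_const_mul]
    have hint := integral_mono_ae ((integrable_indicator_iff hTm).2 (integrableOn_const hTfin))
      ((hFi.indicator hS).add hm) hpt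
    rw [integral_indicator_const _ hTm, smul_eq_mul] at hint
    replace hint := hint.trans_eq hsplit
    have hA₁0 : 0 ≤ A₁ := by positivity
    have hA₃0 : 0 ≤ A₃ := by positivity
    have hlow := mul_le_mul_of_nonneg_right (hcol r hr (hr1.trans (min_le_left _ _)))
      (mul_nonneg hκ.le (Real.exp_pos (-1)).le)
    have hup : κ₀ * Real.exp (-1) * c * r ≤ (A₁ * I₁ + A₃ * I₃) * r * r := by
      calc κ₀ * Real.exp (-1) * c * r = c * r * (κ₀ * Real.exp (-1)) := by ring
        _ ≤ _ := hlow
        _ ≤ _ := hint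
        _ ≤ A₁ * (I₁ * r ^ (1 + 1)) + A₃ / r ^ 2 * (I₃ * r ^ (3 + 1)) := by
          gcongr
          · exact hm1.2
          · exact hm3.2
        _ = _ := by field_simp; ring
    exact le_of_mul_le_mul_right hup hr
  have hM : 0 ≤ A₁ * I₁ + A₃ * I₃ := by positivity
  have hlim : Tendsto (fun r : ℝ => (A₁ * I₁ + A₃ * I₃) * r) (𝓝[>] 0) (𝓝 0) := by
    have : Continuous fun r : ℝ => (A₁ * I₁ + A₃ * I₃) * r := by fun_prop
    simpa using (this.tendsto 0).mono_left (nhdsWithin_le_nhds (s := Ioi 0))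
  have hev : ∀ᶠ r : ℝ in 𝓝[>] 0, κ₀ * Real.exp (-1) * c ≤ (A₁ * I₁ + A₃ * I₃) * r := by
    filter_upwards [Ioc_mem_nhdsGT (lt_min hr₀ one_pos)] with r hr using hmain r hr.1 hr.2
  have := ge_of_tendsto hlim hev
  have hpos' : 0 < κ₀ * Real.exp (-1) * c := by positivity
  linarith

/-- A Lipschitz `B` may grow at infinity. If at least one of the two points lies in the support of
`ξ`, the product rule can be arranged so that only the value of `B` at that point enters. -/
lemma LipschitzWith.inner_of_hasCompactSupport {B ξ : 𝔼 → 𝔼} {K L : ℝ≥0} (hB : LipschitzWith K B)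
    (hξ : LipschitzWith L ξ) (hξc : HasCompactSupport ξ) (hξ1 : ∀ x, ‖ξ x‖ ≤ 1) :
    ∃ M : ℝ≥0, LipschitzWith M fun x => inner ℝ (B x) (ξ x) := by
  obtain ⟨D, hD⟩ := hξc.isCompact.exists_bound_of_continuousOn hB.continuous.continuousOn
  have hD' : ∀ x ∈ tsupport ξ, ‖B x‖ ≤ max D 0 := fun x hx => (hD x hx).trans (le_max_left _ _)
  have key : ∀ x ∈ tsupport ξ, ∀ y, |inner ℝ (B x) (ξ x) - inner ℝ (B y) (ξ y)| ≤
      (K + max D 0 * L) * dist x y := fun x hx y => by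
    have h1 : inner ℝ (B x) (ξ x) - inner ℝ (B y) (ξ y) =
        inner ℝ (B x - B y) (ξ y) + inner ℝ (B x) (ξ x - ξ y) := by
      rw [inner_sub_left, inner_sub_right]; ring
    have h2 := hB.dist_le_mul x y
    have h3 := hξ.dist_le_mul x y
    rw [dist_eq_norm] at h2 h3
    rw [h1]
    calc _ ≤ |inner ℝ (B x - B y) (ξ y)| + |inner ℝ (B x) (ξ x - ξ y)| := abs_add_le _ _
      _ ≤ ‖B x - B y‖ * ‖ξ y‖ + ‖B x‖ * ‖ξ x - ξ y‖ :=
        add_le_add (abs_real_inner_le_norm _ _) (abs_real_inner_le_norm _ _)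
      _ ≤ K * dist x y * 1 + max D 0 * (L * dist x y) := by
        gcongr
        · exact hξ1 y
        · exact hD' x hx
      _ = _ := by ring
  refine ⟨⟨K + max D 0 * L, by positivity⟩, LipschitzWith.of_dist_le_mul fun x y => ?_⟩
  rw [Real.dist_eq]
  by_cases hx : x ∈ tsupport ξ
  · exact key x hx y
  by_cases hy : y ∈ tsupport ξ
  · rw [abs_sub_comm, dist_comm]
    exact key y hy x
  · rw [image_eq_zero_of_notMem_tsupport hx, image_eq_zero_of_notMem_tsupport hy]
    simp only [inner_zero_right, sub_self, abs_zero]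
    exact mul_nonneg NNReal.zero_le_coe dist_nonneg

/-- Two derivatives of the extension, hence three of the defining functions of the boundary, are
spent here. -/
lemma exists_lipschitzWith_divergence {Y : 𝔼 → 𝔼} (hY : ContDiff ℝ 2 Y) (hYc : HasCompactSupport Y) :
    ∃ M : ℝ≥0, LipschitzWith M (divergence Y) := by
  have h1 : ContDiff ℝ 1 (divergence Y) := by
    unfold divergence
    refine ContDiff.sum fun i _ => ?_
    have h2 : ContDiff ℝ 1 (fderiv ℝ Y) := hY.fderiv_right (by norm_num)
    exact (EuclideanSpace.proj (𝕜 := ℝ) i).contDiff.comp (h2.clm_apply contDiff_const)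
  exact h1.lipschitzWith_of_hasCompactSupport
    (HasCompactSupport.intro hYc.isCompact fun x hx => divergence_of_notMem_tsupport hx)
    (by norm_num)

/-- The difference of a calibration field `ξ` and a regular extension `Y` of the normal has a
divergence that vanishes on the boundary. -/
lemma HasC3HolderBoundary.exists_divergence_le {α : ℝ≥0} {Ω : Set 𝔼}
    (hΩ : HasC3HolderBoundary α Ω) (hR : IsBoundedRegion Ω) (hne : (frontier Ω).Nonempty)
    {Y ξ B : 𝔼 → 𝔼} {K L M : ℝ≥0} {C D lam : ℝ} (hYd : ContDiff ℝ 2 Y)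
    (hYc : HasCompactSupport Y) (hY : LipschitzWith K Y) (hC : 0 ≤ C)
    (hdef : ∀ᵐ x, ‖gradient (signedDistBoundary Ω) x‖ = 1 ∧
      |1 - inner ℝ (Y x) (gradient (signedDistBoundary Ω) x)| ≤ C * |signedDistBoundary Ω x| ^ 2)
    (hξ : LipschitzWith L ξ) (hξc : HasCompactSupport ξ) (hξ1 : ∀ x, ‖ξ x‖ ≤ 1)
    (hξY : ∀ p ∈ frontier Ω, ξ p = Y p) (hB : LipschitzWith M B)
    (hevol : ∀ᵐ x, |inner ℝ (B x) (ξ x) + divergence ξ x - lam| ≤ D * |signedDistBoundary Ω x|) :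
    ∃ C' : ℝ, 0 ≤ C' ∧ ∀ᵐ x, |divergence (fun y => ξ y - Y y) x| ≤ C' * |signedDistBoundary Ω x| := by
  obtain ⟨N₁, hN₁⟩ := hB.inner_of_hasCompactSupport hξ hξc hξ1
  obtain ⟨N₂, hN₂⟩ := exists_lipschitzWith_divergence hYd hYc
  -- The evolution equation makes `k` a Lipschitz representative of `divergence η` up to `O(|s|)`,
  -- so that boundary values are meaningful.
  set k : 𝔼 → ℝ := fun x => lam - inner ℝ (B x) (ξ x) - divergence Y x with hk
  have hkL : LipschitzWith (0 + N₁ + N₂) k := ((LipschitzWith.const lam).sub hN₁).sub hN₂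
  set η : 𝔼 → 𝔼 := fun y => ξ y - Y y with hη
  have hηL : LipschitzWith (L + K) η := hξ.sub hY
  have hηc : HasCompactSupport η := hξc.sub hYc
  have hη0 : ∀ x ∈ frontier Ω, η x = 0 := fun x hx => sub_eq_zero.2 (hξY x hx)
  have hηs : ∀ x, ‖η x‖ ≤ (L + K : ℝ≥0) * |signedDistBoundary Ω x| := fun x => by
    obtain ⟨p, hp, hd⟩ := exists_frontier_dist_eq hne x
    have h := hηL.dist_le_mul x p
    rwa [hη0 p hp, dist_zero_right, hd] at h
  have hdivη : ∀ᵐ x, |divergence η x - k x| ≤ max C D * |signedDistBoundary Ω x| := by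
    filter_upwards [hevol, hξ.ae_differentiableAt] with x hx hxd
    rw [hη, divergence_sub hxd (hYd.differentiable (by norm_num) x)]
    have e : divergence ξ x - divergence Y x - k x =
        inner ℝ (B x) (ξ x) + divergence ξ x - lam := by simp only [hk]; ring
    rw [e]
    exact hx.trans (mul_le_mul_of_nonneg_right (le_max_right _ _) (abs_nonneg _))
  have hsgn : ∀ᵐ x, inner ℝ (η x) (gradient (signedDistBoundary Ω) x) ≤
      max C D * |signedDistBoundary Ω x| ^ 2 := by
    filter_upwards [hdef] with x ⟨hx1, hx2⟩
    rw [hη, inner_sub_left]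
    have h1 : inner ℝ (ξ x) (gradient (signedDistBoundary Ω) x) ≤ 1 := by
      refine (real_inner_le_norm _ _).trans ?_
      rw [hx1, mul_one]; exact hξ1 x
    have h2 := (le_abs_self _).trans hx2
    have h3 : C * |signedDistBoundary Ω x| ^ 2 ≤ max C D * |signedDistBoundary Ω x| ^ 2 := by
      gcongr
      exact le_max_left _ _
    linarith
  have hnull := hΩ.volume_frontier hR hne
  have hibp : ∀ (g : 𝔼 → ℝ) (N : ℝ≥0), LipschitzWith N g →
      ∫ x in Ω, g x * divergence η x = -∫ x in Ω, inner ℝ (η x) (gradient g x) := fun g N hg =>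
    setIntegral_mul_divergence hR.isOpen hnull hne hηL hηc hη0 hg
  have hibp' : ∀ (g : 𝔼 → ℝ) (N : ℝ≥0), LipschitzWith N g →
      ∫ x in Ωᶜ, g x * divergence η x = -∫ x in Ωᶜ, inner ℝ (η x) (gradient g x) :=
    fun g N hg => by
      have h1 := integral_add_compl hR.isOpen.measurableSet
        (integrable_mul_divergence hηL hηc hg.continuous)
      have h2 := integral_add_compl hR.isOpen.measurableSet
        (integrable_inner_gradient hηL.continuous hηc hg)
      have h3 := integral_mul_divergence hηL hηc hg
      have h4 := hibp g N hg
      linarith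
  -- The inner collar gives `k p ≥ 0`, the outer collar `k p ≤ 0`.
  have hk0 : ∀ p ∈ frontier Ω, k p = 0 := fun p hp => by
    have hin := hΩ.mul_nonpos_of_divergence hR hp (θ := -1) hηL hηc hηs
      (hC.trans (le_max_left _ _)) hdivη hsgn hkL.continuous hR.isOpen.measurableSet (by norm_num)
      (fun x hx => by rw [abs_of_nonpos (signedDist_nonpos hx)]; ring) hibp (fun σ hσ => by
        obtain ⟨c, r₀, hc, hr₀, h⟩ := hΩ.exists_le_collar hR.isOpen hp hσ
        exact ⟨c, r₀, hc, hr₀, fun r h1 h2 => (h r h1 h2).1⟩)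
    have hout := hΩ.mul_nonpos_of_divergence hR hp (θ := 1) hηL hηc hηs
      (hC.trans (le_max_left _ _)) hdivη hsgn hkL.continuous hR.isOpen.measurableSet.compl
      (by norm_num) (fun x hx => by rw [abs_of_nonneg (signedDist_nonneg hx)]; ring) hibp'
      (fun σ hσ => by
        obtain ⟨c, r₀, hc, hr₀, h⟩ := hΩ.exists_le_collar hR.isOpen hp hσ
        exact ⟨c, r₀, hc, hr₀, fun r h1 h2 => (h r h1 h2).2⟩)
    linarith
  refine ⟨max C D + (0 + N₁ + N₂ : ℝ≥0), add_nonneg (hC.trans (le_max_left _ _)) NNReal.zero_le_coe,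
    ?_⟩
  filter_upwards [hdivη] with x hx
  obtain ⟨p, hp, hd⟩ := exists_frontier_dist_eq hne x
  have h1 := hkL.dist_le_mul x p
  rw [hk0 p hp, dist_zero_right, hd, Real.norm_eq_abs] at h1
  rw [add_mul]
  calc |divergence η x| = |(divergence η x - k x) + k x| := by rw [sub_add_cancel]
    _ ≤ _ := abs_add_le _ _
    _ ≤ _ := add_le_add hx h1

end Calibration

section WellPrepared

/-! ### Well-preparedness -/

lemma gradient_comp_affine {g : ℝ → ℝ} {g' a ε : ℝ} {s : 𝔼 → ℝ} {x : 𝔼}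
    (hg : HasDerivAt g g' ((-s x - a) / ε)) (hs : DifferentiableAt ℝ s x) :
    gradient (fun y => g ((-s y - a) / ε)) x = (-(g' / ε)) • gradient s x := by
  have h1 : HasDerivAt (fun τ : ℝ => g ((-τ - a) / ε)) (-(g' / ε)) (s x) := by
    have h2 : HasDerivAt (fun τ : ℝ => (-τ - a) / ε) (-1 / ε) (s x) :=
      (((hasDerivAt_id (s x)).neg.sub_const a).div_const ε)
    exact (HasDerivAt.comp (s x) hg h2).congr_deriv (by ring)
  have h3 : HasFDerivAt (fun y => g ((-s y - a) / ε)) ((-(g' / ε)) • fderiv ℝ s x) x :=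
    h1.comp_hasFDerivAt x hs.hasFDerivAt
  unfold gradient
  rw [h3.fderiv, map_smul]

variable {W U : ℝ → ℝ}

/-- Equipartition: since `|∇s| = 1` and `U'² = 2 W(U)`, gradient and potential terms agree. -/
lemma energyDensity_gluedProfile (hW : IsDoubleWell W) (hU : IsOptimalProfile W U) {Ω : Set 𝔼}
    {a ε : ℝ} (hε : 0 < ε) {x : 𝔼} (hs : DifferentiableAt ℝ (signedDistBoundary Ω) x)
    (h1 : ‖gradient (signedDistBoundary Ω) x‖ = 1) :
    energyDensity W ε (gluedProfile U Ω a ε) x = 2 * W (gluedProfile U Ω a ε x) / ε := by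
  have h2 : gradient (gluedProfile U Ω a ε) x = _ := gradient_comp_affine (hU.hasDerivAt hW _) hs
  unfold energyDensity
  rw [h2, norm_smul, h1, mul_one, Real.norm_eq_abs, sq_abs, neg_sq, div_pow,
    Real.sq_sqrt (mul_nonneg zero_le_two (hW.nonneg _))]
  unfold gluedProfile
  field_simp
  ring

lemma gradient_psi (hW : IsDoubleWell W) (hU : IsOptimalProfile W U) {Ω : Set 𝔼}
    {a ε : ℝ} {x : 𝔼} (hs : DifferentiableAt ℝ (signedDistBoundary Ω) x) :
    gradient (fun y => wellPrimitive W (gluedProfile U Ω a ε y)) x =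
      (-(2 * W (gluedProfile U Ω a ε x) / ε)) • gradient (signedDistBoundary Ω) x :=
  gradient_comp_affine (hU.hasDerivAt_wellPrimitive_comp hW _) hs

lemma two_mul_gluedProfile_le {κ C : ℝ} (hκ : 0 < κ) (hC : 0 < C)
    (hb : ∀ z, 2 * W (U z) ≤ C * Real.exp (-(κ * |z|))) (Ω : Set 𝔼) {a ε K : ℝ} (hε : 0 < ε)
    (ha : |a| ≤ K * ε) (x : 𝔼) :
    2 * W (gluedProfile U Ω a ε x) ≤
      C * Real.exp (κ * K) * Real.exp (-(κ * (|signedDistBoundary Ω x| / ε))) := by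
  have ha' : |a| / ε ≤ K := (div_le_iff₀ hε).2 ha
  rw [mul_assoc, ← Real.exp_add]
  refine (hb _).trans (mul_le_mul_of_nonneg_left (Real.exp_le_exp.2 ?_) hC.le)
  have h1 : |signedDistBoundary Ω x| / ε - |a| / ε ≤ |(-signedDistBoundary Ω x - a) / ε| := by
    rw [abs_div, abs_of_pos hε, ← sub_div]
    refine div_le_div_of_nonneg_right ?_ hε.le
    have := abs_sub_abs_le_abs_sub (-signedDistBoundary Ω x) a
    rwa [abs_neg] at this
  nlinarith

lemma exists_lipschitzWith_psi (hW : IsDoubleWell W) (hU : IsOptimalProfile W U) (Ω : Set 𝔼)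
    (a ε : ℝ) :
    ∃ L : ℝ≥0, LipschitzWith L fun x => wellPrimitive W (gluedProfile U Ω a ε x) := by
  obtain ⟨κ, C, hκ, hC, hb⟩ := hU.bounds hW
  have h1 : LipschitzWith C.toNNReal fun z => wellPrimitive W (U z) := by
    refine lipschitzWith_of_nnnorm_deriv_le
      (fun z => (hU.hasDerivAt_wellPrimitive_comp hW z).differentiableAt) fun z => ?_
    rw [← NNReal.coe_le_coe, coe_nnnorm, (hU.hasDerivAt_wellPrimitive_comp hW z).deriv,
      Real.coe_toNNReal _ hC.le, Real.norm_of_nonneg (mul_nonneg zero_le_two (hW.nonneg _))]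
    refine (hb z).1.trans (mul_le_of_le_one_right hC.le (Real.exp_le_one_iff.2 ?_))
    exact neg_nonpos.2 (by positivity)
  have h2 : LipschitzWith (‖ε⁻¹‖₊ * (2 + 0)) fun x : 𝔼 => (-signedDistBoundary Ω x - a) / ε := by
    simp only [div_eq_inv_mul, ← smul_eq_mul]
    exact (lipschitzWith_smul ε⁻¹).comp
      ((lipschitzWith_signedDist Ω).neg.sub (LipschitzWith.const a))
  exact ⟨_, h1.comp h2⟩

variable {α : ℝ≥0} {Ω : Set (EuclideanSpace ℝ (Fin d))}

lemma HasC3HolderBoundary.integrable_energyDensity (hΩ : HasC3HolderBoundary α Ω)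
    (hR : IsBoundedRegion Ω) (hne : (frontier Ω).Nonempty) (hW : IsDoubleWell W)
    (hU : IsOptimalProfile W U) (h1 : ∀ᵐ x, ‖gradient (signedDistBoundary Ω) x‖ = 1) (a : ℝ)
    {ε : ℝ} (hε : 0 < ε) :
    Integrable (fun x => 2 * W (gluedProfile U Ω a ε x) / ε) ∧
      energyDensity W ε (gluedProfile U Ω a ε) =ᵐ[volume]
        fun x => 2 * W (gluedProfile U Ω a ε x) / ε := by
  obtain ⟨κ, C, hκ, hC, hb⟩ := hU.bounds hW
  constructor
  · refine Integrable.div_const ?_ ε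
    refine ((hΩ.integrable_exp hR hne hκ hε).const_mul (C * Real.exp (κ * (|a| / ε)))).mono'
      (continuous_const.mul (hW.contDiff.continuous.comp
        (continuous_gluedProfile hU.contDiff.continuous Ω a ε))).aestronglyMeasurable
      (Eventually.of_forall fun x => ?_)
    rw [Real.norm_of_nonneg (mul_nonneg zero_le_two (hW.nonneg _))]
    exact two_mul_gluedProfile_le hκ hC (fun z => (hb z).1) Ω hε
      (div_mul_cancel₀ _ hε.ne').ge x
  · filter_upwards [h1, (lipschitzWith_signedDist Ω).ae_differentiableAt] with x hx hd
    exact energyDensity_gluedProfile hW hU hε hd hx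

/-- The estimate of the relative energy by moments of the distance to the boundary. -/
lemma HasC3HolderBoundary.abs_relativeEnergy_le (hΩ : HasC3HolderBoundary α Ω)
    (hR : IsBoundedRegion Ω) (hne : (frontier Ω).Nonempty) (hW : IsDoubleWell W)
    (hU : IsOptimalProfile W U) {Y ξ : 𝔼 → 𝔼} {L M : ℝ≥0} {C C' : ℝ}
    (hY : LipschitzWith L Y) (hYc : HasCompactSupport Y)
    (hξ : LipschitzWith M ξ) (hξc : HasCompactSupport ξ) (hξY : ∀ p ∈ frontier Ω, ξ p = Y p)
    (hdef : ∀ᵐ x, ‖gradient (signedDistBoundary Ω) x‖ = 1 ∧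
      |1 - inner ℝ (Y x) (gradient (signedDistBoundary Ω) x)| ≤ C * |signedDistBoundary Ω x| ^ 2)
    (hdiv : ∀ᵐ x, |divergence (fun y => ξ y - Y y) x| ≤ C' * |signedDistBoundary Ω x|)
    {a ε A κ : ℝ} (hε : 0 < ε)
    (hA : ∀ x, 2 * W (gluedProfile U Ω a ε x) ≤
      A * Real.exp (-(κ * (|signedDistBoundary Ω x| / ε))))
    (hA' : ∀ x, |wellPrimitive W (gluedProfile U Ω a ε x) - Ω.indicator (fun _ => (1 : ℝ)) x| ≤
      A * Real.exp (-(κ * (|signedDistBoundary Ω x| / ε))))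
    (h1 : Integrable fun x => Real.exp (-(κ * (|signedDistBoundary Ω x| / ε))) *
        |signedDistBoundary Ω x| ^ 1)
    (h2 : Integrable fun x => Real.exp (-(κ * (|signedDistBoundary Ω x| / ε))) *
        |signedDistBoundary Ω x| ^ 2) :
    |relativeEnergy W ε ξ (gluedProfile U Ω a ε)| ≤
      A * C / ε * (∫ x, Real.exp (-(κ * (|signedDistBoundary Ω x| / ε))) *
        |signedDistBoundary Ω x| ^ 2) +
      A * C' * ∫ x, Real.exp (-(κ * (|signedDistBoundary Ω x| / ε))) *
        |signedDistBoundary Ω x| ^ 1 := by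
  set s := signedDistBoundary Ω with hs
  set u := gluedProfile U Ω a ε with hu
  have hgrad1 : ∀ᵐ x, ‖gradient s x‖ = 1 := hdef.mono fun x hx => hx.1
  obtain ⟨hei, hee⟩ := hΩ.integrable_energyDensity hR hne hW hU hgrad1 a hε
  obtain ⟨N, hN⟩ := exists_lipschitzWith_psi hW hU Ω a ε
  have hηL : LipschitzWith (M + L) fun y => ξ y - Y y := hξ.sub hY
  have hηc : HasCompactSupport fun y => ξ y - Y y := hξc.sub hYc
  have hη0 : ∀ x ∈ frontier Ω, ξ x - Y x = 0 := fun x hx => sub_eq_zero.2 (hξY x hx)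
  have hti := integrable_inner_gradient hξ.continuous hξc hN
  have hYi := integrable_inner_gradient hY.continuous hYc hN
  have hfi : Integrable fun x => 2 * W (u x) / ε + inner ℝ (Y x)
      (gradient (fun y => wellPrimitive W (u y)) x) := hei.add hYi
  have hηi := integrable_inner_gradient hηL.continuous hηc hN
  have hone : LipschitzWith 0 fun _ : 𝔼 => (1 : ℝ) := LipschitzWith.const 1
  have hzero : ∫ x in Ω, divergence (fun y => ξ y - Y y) x = 0 := by
    have h := setIntegral_mul_divergence hR.isOpen (hΩ.volume_frontier hR hne) hne hηL hηc hη0 hone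
    have e : ∀ x : 𝔼, gradient (fun _ : 𝔼 => (1 : ℝ)) x = 0 := fun x => by simp [gradient]
    simpa [e] using h
  have hψi := integrable_mul_divergence hηL hηc hN.continuous
  have hχi : Integrable fun x => Ω.indicator (fun _ => (1 : ℝ)) x *
      divergence (fun y => ξ y - Y y) x := by
    have h := (integrable_mul_divergence hηL hηc hone.continuous).indicator hR.isOpen.measurableSet
    refine h.congr (Eventually.of_forall fun x => ?_)
    by_cases hx : x ∈ Ω <;> simp [hx]
  have hχ0 : ∫ x, Ω.indicator (fun _ => (1 : ℝ)) x * divergence (fun y => ξ y - Y y) x = 0 := by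
    rw [← hzero, ← integral_indicator hR.isOpen.measurableSet]
    refine integral_congr_ae (Eventually.of_forall fun x => ?_)
    by_cases hx : x ∈ Ω <;> simp [hx]
  -- Energy and the `Y` part of the tilt combine into the quadratic defect. The `ξ - Y` part is
  -- integrated by parts, and the indicator is inserted at no cost by `hχ0`, which leaves an
  -- integrand concentrated at the boundary.
  have hsplit : relativeEnergy W ε ξ u =
      (∫ x, (2 * W (u x) / ε + inner ℝ (Y x) (gradient (fun y => wellPrimitive W (u y)) x))) -
      ∫ x, (wellPrimitive W (u x) - Ω.indicator (fun _ => (1 : ℝ)) x) *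
        divergence (fun y => ξ y - Y y) x := by
    have e1 : ∫ x, (wellPrimitive W (u x) - Ω.indicator (fun _ => (1 : ℝ)) x) *
        divergence (fun y => ξ y - Y y) x =
        ∫ x, wellPrimitive W (u x) * divergence (fun y => ξ y - Y y) x := by
      simp only [sub_mul]
      rw [integral_sub hψi hχi, hχ0, sub_zero]
    have e2 : ∫ x, inner ℝ (ξ x - Y x) (gradient (fun y => wellPrimitive W (u y)) x) =
        (∫ x, inner ℝ (ξ x) (gradient (fun y => wellPrimitive W (u y)) x)) -
        ∫ x, inner ℝ (Y x) (gradient (fun y => wellPrimitive W (u y)) x) := by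
      simp only [inner_sub_left]
      exact integral_sub hti hYi
    rw [e1, integral_mul_divergence hηL hηc hN, e2, integral_add hei hYi]
    unfold relativeEnergy
    rw [integral_congr_ae hee]
    unfold tiltDensity
    ring
  have hb1 : |∫ x, (2 * W (u x) / ε + inner ℝ (Y x) (gradient (fun y => wellPrimitive W (u y)) x))| ≤
      ∫ x, A * C / ε * (Real.exp (-(κ * (|s x| / ε))) * |s x| ^ 2) := by
    rw [← Real.norm_eq_abs]
    refine norm_integral_le_of_norm_le (h2.const_mul _) ?_
    filter_upwards [hdef, (lipschitzWith_signedDist Ω).ae_differentiableAt] with x ⟨_, hx⟩ hd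
    have e : 2 * W (u x) / ε + inner ℝ (Y x) (gradient (fun y => wellPrimitive W (u y)) x) =
        2 * W (u x) / ε * (1 - inner ℝ (Y x) (gradient s x)) := by
      rw [hu, gradient_psi hW hU hd, inner_smul_right]
      ring
    have hw : 0 ≤ 2 * W (u x) := mul_nonneg zero_le_two (hW.nonneg _)
    rw [e, Real.norm_eq_abs, abs_mul, abs_of_nonneg (div_nonneg hw hε.le)]
    calc _ ≤ A * Real.exp (-(κ * (|s x| / ε))) / ε * (C * |s x| ^ 2) :=
          mul_le_mul (div_le_div_of_nonneg_right (hA x) hε.le) hx (abs_nonneg _)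
            (div_nonneg (hw.trans (hA x)) hε.le)
      _ = _ := by ring
  have hb2 : |∫ x, (wellPrimitive W (u x) - Ω.indicator (fun _ => (1 : ℝ)) x) *
        divergence (fun y => ξ y - Y y) x| ≤
      ∫ x, A * C' * (Real.exp (-(κ * (|s x| / ε))) * |s x| ^ 1) := by
    rw [← Real.norm_eq_abs]
    refine norm_integral_le_of_norm_le (h1.const_mul _) ?_
    filter_upwards [hdiv] with x hx
    rw [Real.norm_eq_abs, abs_mul]
    calc _ ≤ A * Real.exp (-(κ * (|s x| / ε))) * (C' * |s x|) :=
          mul_le_mul (hA' x) hx (abs_nonneg _) ((abs_nonneg _).trans (hA' x))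
      _ = _ := by ring
  rw [integral_const_mul] at hb1 hb2
  rw [hsplit]
  exact (abs_sub _ _).trans (add_le_add hb1 hb2)

lemma HasC3HolderBoundary.isWellPrepared (hΩ : HasC3HolderBoundary α Ω)
    (hR : IsBoundedRegion Ω) (hne : (frontier Ω).Nonempty) (hW : IsDoubleWell W)
    (hU : IsOptimalProfile W U) {a : ℝ → ℝ} {K ε₀ : ℝ} (hε₀ : 0 < ε₀)
    (ha : ∀ ε, 0 < ε → ε ≤ ε₀ → |a ε| ≤ K * ε)
    (hmass : ∀ ε, 0 < ε → HasExactMass W Ω (gluedProfile U Ω (a ε) ε))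
    {ξ B : 𝔼 → 𝔼} {ϑ : 𝔼 → ℝ} {L M N : ℝ≥0} {D lam Q : ℝ}
    (hξ : LipschitzWith L ξ) (hξc : HasCompactSupport ξ) (hξ1 : ∀ x, ‖ξ x‖ ≤ 1)
    (hξn : ∀ p ∈ frontier Ω, IsExteriorNormal Ω p (ξ p)) (hB : LipschitzWith M B)
    (hevol : ∀ᵐ x, |inner ℝ (B x) (ξ x) + divergence ξ x - lam| ≤ D * |signedDistBoundary Ω x|)
    (hϑ : LipschitzWith N ϑ) (hϑ1 : ∀ x, |ϑ x| ≤ Q) (hϑ0 : ∀ p ∈ frontier Ω, ϑ p = 0) :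
    IsWellPrepared W Ω ξ ϑ fun ε => gluedProfile U Ω (a ε) ε := by
  obtain ⟨Y, r₀, hYd, hYc, hr₀, hY1, hYr, hYn⟩ := hΩ.exists_extension hR hne
  obtain ⟨Z, hZ⟩ := (hYd.of_le (m := 1) (by norm_num)).lipschitzWith_of_hasCompactSupport hYc
    (by norm_num)
  obtain ⟨C, hC, hdef⟩ := hΩ.exists_defect_le hR hne hr₀ hZ hY1 hYr hYn
  have hξY : ∀ p ∈ frontier Ω, ξ p = Y p := fun p hp =>
    IsExteriorNormal.unique hR.isOpen hp (hξn p hp) (hYn p hp)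
  obtain ⟨C', hC', hdiv⟩ := hΩ.exists_divergence_le hR hne hYd hYc hZ hC hdef hξ hξc hξ1 hξY hB hevol
  have hgrad1 : ∀ᵐ x, ‖gradient (signedDistBoundary Ω) x‖ = 1 := hdef.mono fun x hx => hx.1
  have hϑs : ∀ x, |ϑ x| ≤ N * |signedDistBoundary Ω x| := fun x => by
    obtain ⟨p, hp, hd⟩ := exists_frontier_dist_eq hne x
    have h := hϑ.dist_le_mul x p
    rwa [hϑ0 p hp, dist_zero_right, hd] at h
  have hvi : ∀ ε : ℝ, 0 < ε →
      Integrable (volumeErrorDensity W Ω ϑ (gluedProfile U Ω (a ε) ε)) := fun ε hε =>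
    (hΩ.integrable_psi_sub_indicator hR hne hW hU (a ε) hε).abs.mul_bdd
      hϑ.continuous.abs.aestronglyMeasurable (Eventually.of_forall fun x => by
        rw [Real.norm_eq_abs, abs_abs]; exact hϑ1 x)
  refine ⟨hmass, fun ε hε => ?_, fun ε hε => ?_, hvi, ?_⟩
  · obtain ⟨h1, h2⟩ := hΩ.integrable_energyDensity hR hne hW hU hgrad1 (a ε) hε
    exact h1.congr h2.symm
  · obtain ⟨N', hN'⟩ := exists_lipschitzWith_psi hW hU Ω (a ε) ε
    exact integrable_inner_gradient hξ.continuous hξc hN'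
  obtain ⟨κ, G, hκ, hG, hb⟩ := hU.bounds hW
  obtain ⟨I₁, hI₁, h₁⟩ := hΩ.integral_exp_moment_le hR hne hκ 1
  obtain ⟨I₂, hI₂, h₂⟩ := hΩ.integral_exp_moment_le hR hne hκ 2
  set A := G * Real.exp (κ * K) with hA
  have hA0 : 0 < A := by positivity
  refine IsBigO.of_bound (A * C * I₂ + A * C' * I₁ + A * N * I₁) ?_
  filter_upwards [Ioc_mem_nhdsGT (lt_min hε₀ one_pos)] with ε ⟨hε, hε1⟩
  have haε := ha ε hε (hε1.trans (min_le_left _ _))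
  obtain ⟨hi₁, hm₁⟩ := h₁ ε hε (hε1.trans (min_le_right _ _))
  obtain ⟨hi₂, hm₂⟩ := h₂ ε hε (hε1.trans (min_le_right _ _))
  have hψ := abs_psi_sub_indicator_le hκ hG
    (fun z => hW.wellPrimitive_mem_Ioo (hU.mem_Ioo hW z)) (fun z => (hb z).2.1)
    (fun z => (hb z).2.2) Ω hε haε
  have hRE := hΩ.abs_relativeEnergy_le hR hne hW hU hZ hYc hξ hξc hξY hdef hdiv hε
    (two_mul_gluedProfile_le hκ hG (fun z => (hb z).1) Ω hε haε) hψ hi₁ hi₂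
  have hVE : |volumeError W Ω ϑ (gluedProfile U Ω (a ε) ε)| ≤
      A * N * ∫ x, Real.exp (-(κ * (|signedDistBoundary Ω x| / ε))) *
        |signedDistBoundary Ω x| ^ 1 := by
    rw [← integral_const_mul, ← Real.norm_eq_abs]
    refine norm_integral_le_of_norm_le (hi₁.const_mul _) (Eventually.of_forall fun x => ?_)
    unfold volumeErrorDensity
    rw [Real.norm_eq_abs, abs_mul, abs_abs, abs_abs]
    calc _ ≤ A * Real.exp (-(κ * (|signedDistBoundary Ω x| / ε))) *
          (N * |signedDistBoundary Ω x|) :=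
          mul_le_mul (hψ x) (hϑs x) (abs_nonneg _) (by positivity)
      _ = _ := by ring
  rw [Real.norm_eq_abs, Real.norm_of_nonneg (sq_nonneg ε)]
  calc _ ≤ _ := abs_add_le _ _
    _ ≤ _ := add_le_add hRE hVE
    _ ≤ (A * C / ε * (I₂ * ε ^ (2 + 1)) + A * C' * (I₁ * ε ^ (1 + 1))) +
        A * N * (I₁ * ε ^ (1 + 1)) := by gcongr
    _ = _ := by field_simp; ring

/-- In positive dimension a bounded set is not the whole space, and a nonempty proper subset of a
connected space has boundary. -/
lemma IsBoundedRegion.frontier_nonempty (hd : 1 ≤ d) (hR : IsBoundedRegion Ω) :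
    (frontier Ω).Nonempty := by
  have : Nonempty (Fin d) := ⟨⟨0, hd⟩⟩
  rw [nonempty_frontier_iff]
  refine ⟨hR.nonempty, fun h => ?_⟩
  exact NormedSpace.unbounded_univ ℝ 𝔼 (h ▸ hR.isBounded)

lemma LipschitzOnWith.slice {F : Type*} [PseudoEMetricSpace F] {f : ℝ → 𝔼 → F} {T : ℝ} {K : ℝ≥0}
    (h : LipschitzOnWith K (fun p : ℝ × EuclideanSpace ℝ (Fin d) => f p.1 p.2) (Icc 0 T ×ˢ univ))
    {t : ℝ} (ht : t ∈ Icc 0 T) : LipschitzWith K (f t) := fun x y => by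
  have h1 := h (x := (t, x)) ⟨ht, mem_univ _⟩ (y := (t, y)) ⟨ht, mem_univ _⟩
  simpa [Prod.edist_eq] using h1

/-- Shortness forces `ξ` to vanish wherever `c * δ ^ 2 ≥ 1`, so its support lies in a bounded tube
around the compact boundary. -/
lemma IsGradientFlowCalibration.hasCompactSupport {T : ℝ}
    {Ω : ℝ → Set (EuclideanSpace ℝ (Fin d))} {ξ B : ℝ → 𝔼 → 𝔼} {ϑ : ℝ → 𝔼 → ℝ} {lam : ℝ → ℝ}
    (h : IsGradientFlowCalibration T Ω ξ B ϑ lam) {t : ℝ} (ht : t ∈ Icc 0 T)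
    (hne : (frontier (Ω t)).Nonempty) : HasCompactSupport (ξ t) := by
  obtain ⟨c, hc, hshort⟩ := h.short
  have hcomp : IsCompact (frontier (Ω t)) :=
    Metric.isCompact_of_isClosed_isBounded isClosed_frontier
      ((h.region t ht).isBounded.closure.subset frontier_subset_closure)
  refine HasCompactSupport.intro (K := Metric.cthickening (√(1 / c)) (frontier (Ω t)))
    hcomp.cthickening fun x hx => ?_
  obtain ⟨p, hp, hxp⟩ := hcomp.exists_infDist_eq_dist hne x
  replace hx : √(1 / c) < Metric.infDist x (frontier (Ω t)) :=
    lt_of_not_ge fun h => hx (Metric.mem_cthickening_of_dist_le x p _ _ hp (hxp ▸ h))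
  rw [← norm_le_zero_iff]
  refine (hshort t ht x).trans (max_le ?_ le_rfl)
  have h1 : 1 / c < Metric.infDist x (frontier (Ω t)) ^ 2 := Real.lt_sq_of_sqrt_lt hx
  rw [div_lt_iff₀ hc] at h1
  linarith

lemma IsGradientFlowCalibration.isWellPrepared {T : ℝ}
    {Ω : ℝ → Set (EuclideanSpace ℝ (Fin d))} {ξ B : ℝ → 𝔼 → 𝔼} {ϑ : ℝ → 𝔼 → ℝ} {lam : ℝ → ℝ}
    (h : IsGradientFlowCalibration T Ω ξ B ϑ lam) {t : ℝ} (ht : t ∈ Icc 0 T)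
    (hΩ : HasC3HolderBoundary α (Ω t)) (hne : (frontier (Ω t)).Nonempty) (hW : IsDoubleWell W)
    (hU : IsOptimalProfile W U) {a : ℝ → ℝ} {K ε₀ : ℝ} (hε₀ : 0 < ε₀)
    (ha : ∀ ε, 0 < ε → ε ≤ ε₀ → |a ε| ≤ K * ε)
    (hmass : ∀ ε, 0 < ε → HasExactMass W (Ω t) (gluedProfile U (Ω t) (a ε) ε)) :
    IsWellPrepared W (Ω t) (ξ t) (ϑ t) fun ε => gluedProfile U (Ω t) (a ε) ε := by
  obtain ⟨L, hL⟩ := h.lipschitz_xi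
  obtain ⟨N, hN⟩ := h.lipschitz_weight
  obtain ⟨M, hM⟩ := h.lipschitz_B t ht
  obtain ⟨c, hc, hshort⟩ := h.short
  obtain ⟨D, hD⟩ := h.evolution
  obtain ⟨Q, hQ⟩ := h.weight_bounded
  obtain ⟨c', C', -, hcoer⟩ := h.weight_coercive
  refine hΩ.isWellPrepared (h.region t ht) hne hW hU hε₀ ha hmass (hL.slice ht)
    (h.hasCompactSupport ht hne)
    (fun x => (hshort t ht x).trans (max_le ?_ zero_le_one)) (h.normal t ht) hM (D := |D|) (lam := lam t) ?_
    (hN.slice ht) (hQ t ht) fun p hp => ?_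
  · exact sub_le_self _ (by positivity)
  · filter_upwards [hD t ht] with x hx
    refine hx.trans ?_
    exact mul_le_mul (le_abs_self D) (infDist_frontier_le hne x) Metric.infDist_nonneg (abs_nonneg _)
  -- The upper coercivity bound holds on the support of `ξ`, which contains the boundary because `ξ`
  -- is a unit vector there; hence the weight vanishes on the boundary.
  · have hξp : ξ t p ≠ 0 := norm_ne_zero_iff.1 (by rw [(h.normal t ht p hp).1]; norm_num)
    have h1 := (hcoer t ht p (subset_tsupport _ hξp)).2
    rw [Metric.infDist_zero_of_mem hp, mul_zero] at h1
    exact abs_nonpos_iff.1 h1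

end WellPrepared

end Geometry

/-! ### The theorem -/

theorem lemma1 (W : ℝ → ℝ) (hW : IsDoubleWell W) :
    (∃! U : ℝ → ℝ, IsOptimalProfile W U) ∧
    ∀ (U : ℝ → ℝ), IsOptimalProfile W U →
    ∀ (d : ℕ), 1 ≤ d → ∀ (α : ℝ≥0), 0 < α → α < 1 →
    ∀ (Ω₀ : Set (EuclideanSpace ℝ (Fin d))), IsBoundedRegion Ω₀ → HasC3HolderBoundary α Ω₀ →
    ∃ a : ℝ → ℝ, a =O[𝓝[>] 0] (fun ε : ℝ => ε) ∧
      (∀ ε : ℝ, 0 < ε → HasExactMass W Ω₀ (gluedProfile U Ω₀ (a ε) ε)) ∧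
      ∀ (T : ℝ), 0 ≤ T → ∀ (Ω : ℝ → Set (EuclideanSpace ℝ (Fin d)))
        (ξ B : ℝ → EuclideanSpace ℝ (Fin d) → EuclideanSpace ℝ (Fin d))
        (ϑ : ℝ → EuclideanSpace ℝ (Fin d) → ℝ) (lam : ℝ → ℝ),
        IsGradientFlowCalibration T Ω ξ B ϑ lam → Ω 0 = Ω₀ →
        IsWellPrepared W Ω₀ (ξ 0) (ϑ 0) (fun ε => gluedProfile U Ω₀ (a ε) ε) := by
  constructor
  · obtain ⟨U, hU⟩ := hW.exists_isOptimalProfile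
    exact ⟨U, hU, fun V hV => IsOptimalProfile.unique hW hV hU⟩
  intro U hU d hd α _ _ Ω₀ hR hΩ
  have hne := hR.frontier_nonempty hd
  -- The shifts are fixed by the mass constraint alone, before any calibration appears, and are
  -- therefore independent of it.
  obtain ⟨a, K, ε₀, hε₀, ha, hmass⟩ := hΩ.exists_shifts hR hne hW hU
  refine ⟨a, IsBigO.of_bound K ?_, hmass, ?_⟩
  · filter_upwards [Ioc_mem_nhdsGT hε₀] with ε ⟨hε, hε1⟩
    rw [Real.norm_eq_abs, Real.norm_of_nonneg hε.le]
    exact ha ε hε hε1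
  · rintro T hT Ω ξ B ϑ lam hcal rfl
    exact hcal.isWellPrepared ⟨le_rfl, hT⟩ hΩ hne hW hU hε₀ ha hmass
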